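/- **Setting.** Let $d\ge 2$ and let $\Omega\subset\mathbb R^d$ be open and bounded with boundary of class $\mathcal C^{1,\alpha}$ for some $\alpha\in(\tfrac12,1]$, with outward unit normal $n(x)$ and surface measure $\pi$ on $\partial\Omega$. Let $\boldsymbol m$ be a nonnegative, orthogonally invariant Borel measure on $\mathbb R^d$ with support $V$, such that $0\in V$, $\boldsymbol m(\{0\})=0$ and $\boldsymbol m(V\cap B(0,r))>0$ for all $r>0$. Put $$\Gamma_\pm(x)=\{v\in V:\pm v\cdot n(x)>0\},\qquad \Gamma_\pm=\{(x,v)\in\partial\Omega\times V:\ v\in\Gamma_\pm(x)\},$$ $$\mathrm d\mu_\pm(x,v)=|v\cdot n(x)|\,\pi(\mathrm dx)\otimes\boldsymbol m(\mathrm dv)\ \text{ on }\Gamma_\pm,\qquad L^1_\pm=L^1(\Gamma_\pm,\mathrm d\mu_\pm)\ \text{(complex valued)},$$ and $\tau_-(x,v)=\inf\{s>0:\ x-sv\notin\Omega\}$. For $\mathrm{Re}\,\lambda\ge0$ let $$\mathsf M_\lambda u(x,v)=e^{-\lambda\tau_-(x,v)}\,u(x-\tau_-(x,v)v,v),\qquad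 (x,v)\in\Gamma_+,\ u\in L^1_-,$$ and, for a real kernel $\boldsymbol k(x,v,v')$ defined for $(x,v)\in\Gamma_-$, $(x,v')\in\Gamma_+$, let $$\mathsf H\psi(x,v)=\int_{\Gamma_+(x)}\boldsymbol k(x,v,v')\,\psi(x,v')\,|v'\cdot n(x)|\,\boldsymbol m(\mathrm dv'),\qquad (x,v)\in\Gamma_-,\ \psi\in L^1_+ .$$ **Assumption (A).** The kernel $\boldsymbol k$ is nonnegative and measurable, with $\int_{\Gamma_-(x)}\boldsymbol k(x,v,v')|v\cdot n(x)|\,\boldsymbol m(\mathrm dv)=1$ for all $(x,v')\in\Gamma_+$. There is a differentiable function $\varpi:(0,\infty)\to(0,\infty)$ such that the image of $\boldsymbol m$ under $v\mapsto|v|$ is $|\mathbb S^{d-1}|\varrho^{d-1}\varpi(\varrho)\,\mathrm d\varrho$. The kernel $\boldsymbol k(x,v,v')$ is differentiable in $v$ and differentiable in $v'$ (with gradients $\nabla_2\boldsymbol k$, $\nabla_3\boldsymbol k$), and the following hold, each for those arguments at which the kernel values are defined: 1. for all $(x,v)\in\Gamma_-$, $(y,w)\in\Gamma_+$ and $\sigma=\frac{x-y}{|x-y|}$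 with $\sigma\cdot n(x)>0>\sigma\cdot n(y)$, $$\lim_{\varrho\to\infty}\varrho^{d+2}\,\boldsymbol k(x,v,\varrho\sigma)\,\boldsymbol k(y,\varrho\sigma,w)\,\varpi(\varrho)=0;$$ 2. $$\sup\int_0^\infty\varrho^{d+1}\Big[\varrho\,\varpi(\varrho)\,|\nabla_2\boldsymbol k(y,\varrho\sigma,w)|+\boldsymbol k(y,\varrho\sigma,w)\big(\varrho|\varpi'(\varrho)|+\varpi(\varrho)\big)\Big]\mathrm d\varrho<\infty,$$ the supremum being over $(y,w)\in\Gamma_+$ and $\sigma\in\mathbb S^{d-1}$ with $\sigma\cdot n(y)<0$; 3. $$\sup\int_0^\infty\varrho^{d+2}\varpi(\varrho)\,\boldsymbol k(y,\varrho\sigma,w)\Big(\int_{\Gamma_-(x)}|\nabla_3\boldsymbol k(x,v,\varrho\sigma)|\,|v\cdot n(x)|\,\boldsymbol m(\mathrm dv)\Big)\mathrm d\varrho<\infty,$$ the supremum being over $x\in\partial\Omega$, $(y,w)\in\Gamma_+$ and $\sigma\in\mathbb S^{d-1}$ with $\sigma\cdot n(x)>0>\sigma\cdot n(y)$. **Proposition.**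 Under Assumption (A), the formulas above define bounded operators $\mathsf H:L^1_+\to L^1_-$ and $\mathsf M_\lambda:L^1_-\to L^1_+$ ($\mathrm{Re}\,\lambda\ge0$), and there is a constant $C>0$ such that $$\big\|(\mathsf M_\lambda\mathsf H)^2\big\|_{\mathscr B(L^1_+)}\le\frac{C}{|\lambda|}\qquad\text{for all }\lambda\ne0\text{ with }\mathrm{Re}\,\lambda\ge0 .$$ In particular, there is a constant $C'>0$ such that $$\int_{\mathbb R}\big\|(\mathsf M_{\varepsilon+i\eta}\mathsf H)^4\big\|_{\mathscr B(L^1_+)}\,\mathrm d\eta\le C'\qquad\text{for all }\varepsilon\ge0 .$$ Moreover, this covers the Maxwell diffuse boundary condition: if $\theta:\partial\Omega\to\mathbb R$ is continuous and bounded below by a positive constant, then $\boldsymbol m(\mathrm dv)=\mathrm dv$ satisfies the requirements on the velocity measure, and Assumption (A) holds with $\boldsymbol m(\mathrm dv)=\mathrm dv$, $\varpi\equiv1$ and $$\boldsymbol k(x,v,v')=\gamma(x)^{-1}\mathcal M_{\theta(x)}(v),\quad \mathcal M_\theta(v)=(2\pi\theta)^{-d/2}e^{-|v|^2/(2\theta)},\quad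 \gamma(x)=\int_{v\cdot n(x)<0}\mathcal M_{\theta(x)}(v)|v\cdot n(x)|\,\mathrm dv .$$ -/

import Mathlib

open MeasureTheory Set Filter Topology
open scoped ENNReal NNReal

noncomputable section

namespace Kinetic

/-- The Euclidean space `ℝ^d`, used for positions and for velocities. -/
abbrev Space (d : ℕ) : Type := EuclideanSpace ℝ (Fin d)

variable {d : ℕ}

/-! ### The spatial domain -/

/-- `∂Ω` is of class `C^{1,α}`: near each of its points, `Ω` is the sublevel set `{ψ < 0}` of a
`C¹` function `ψ` without critical points whose differential is `α`-Hölder continuous (by the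
implicit function theorem, `Ω` is locally the region on one side of the graph of a `C^{1,α}`
function). -/
def HasHolderBoundary (Ω : Set (Space d)) (α : ℝ) : Prop :=
  ∀ x ∈ frontier Ω, ∃ (U : Set (Space d)) (ψ : Space d → ℝ),
    IsOpen U ∧ x ∈ U ∧ ContDiffOn ℝ 1 ψ U ∧
    (∀ y ∈ U, fderiv ℝ ψ y ≠ 0) ∧
    (∃ K : ℝ, ∀ y ∈ U, ∀ z ∈ U, ‖fderiv ℝ ψ y - fderiv ℝ ψ z‖ ≤ K * ‖y - z‖ ^ α) ∧
    (∀ y ∈ U, y ∈ Ω ↔ ψ y < 0)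

/-- `n` is an outward unit normal to `Ω` at `x`: directions making an obtuse angle with `n` point
into `Ω` and directions making an acute angle with `n` point out of `Ω`. -/
def IsOutwardNormal (Ω : Set (Space d)) (x n : Space d) : Prop :=
  ‖n‖ = 1 ∧ ∀ w : Space d,
    (inner ℝ w n < 0 → ∀ᶠ t in 𝓝[>] (0 : ℝ), x + t • w ∈ Ω) ∧
    (0 < inner ℝ w n → ∀ᶠ t in 𝓝[>] (0 : ℝ), x + t • w ∉ Ω)

/-- There is at most one outward unit normal at a point. -/
theorem IsOutwardNormal.unique {Ω : Set (Space d)} {x n₁ n₂ : Space d}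
    (h₁ : IsOutwardNormal Ω x n₁) (h₂ : IsOutwardNormal Ω x n₂) : n₁ = n₂ := by
  by_contra hne
  have hlt : inner ℝ n₁ n₂ < 1 := by
    refine lt_of_le_of_ne ?_ ?_
    · have := real_inner_le_norm n₁ n₂
      rwa [h₁.1, h₂.1, one_mul] at this
    · intro h
      exact hne ((inner_eq_one_iff_of_norm_eq_one h₁.1 h₂.1).1 h)
  have e₁ : inner ℝ (n₁ - n₂) n₁ = 1 - inner ℝ n₁ n₂ := by
    rw [inner_sub_left, real_inner_self_eq_norm_sq, h₁.1, real_inner_comm n₁ n₂]; norm_num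
  have e₂ : inner ℝ (n₁ - n₂) n₂ = inner ℝ n₁ n₂ - 1 := by
    rw [inner_sub_left, real_inner_self_eq_norm_sq, h₂.1]; norm_num
  have a := (h₁.2 (n₁ - n₂)).2 (by rw [e₁]; linarith)
  have b := (h₂.2 (n₁ - n₂)).1 (by rw [e₂]; linarith)
  obtain ⟨t, ht⟩ := (a.and b).exists
  exact ht.1 ht.2

open Classical in
/-- The outward unit normal `n(x)` at `x ∈ ∂Ω` (with value `0` where there is none). -/
def normal (Ω : Set (Space d)) (x : Space d) : Space d :=
  if h : ∃ n, IsOutwardNormal Ω x n then h.choose else 0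

/-- The Lebesgue surface measure `π` on `∂Ω`: the `(d-1)`-dimensional Hausdorff measure, normalized
so as to agree with Lebesgue measure on hyperplanes. -/
def surfaceMeasure (Ω : Set (Space d)) : Measure (Space d) :=
  (Measure.euclideanHausdorffMeasure (d - 1)).restrict (frontier Ω)

/-- The backward travel time `τ₋(x,v) = inf {s > 0 ; x - s v ∉ Ω}`. -/
def travelTime (Ω : Set (Space d)) (x v : Space d) : ℝ :=
  sInf {s : ℝ | 0 < s ∧ x - s • v ∉ Ω}

/-! ### Velocities, phase space boundary, trace spaces -/

/-- The standing assumptions on the velocity measure `m`, with `V` the support of `m`: `m` is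
invariant under the orthogonal group, `0 ∈ V`, `m({0}) = 0`, and `m(V ∩ B(0,r)) > 0` for all
`r > 0`. -/
structure IsVelocityMeasure (m : Measure (Space d)) : Prop where
  invariant : ∀ Q : Space d ≃ₗᵢ[ℝ] Space d, m.map Q = m
  zero_mem : (0 : Space d) ∈ m.support
  zero_null : m {0} = 0
  ball_pos : ∀ r : ℝ, 0 < r → 0 < m (m.support ∩ Metric.ball 0 r)

/-- The outgoing velocities `Γ₊(x) = {v ∈ V ; v · n(x) > 0}` at `x`. -/
def outgoing (Ω : Set (Space d)) (m : Measure (Space d)) (x : Space d) : Set (Space d) :=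
  {v | v ∈ m.support ∧ 0 < inner ℝ v (normal Ω x)}

/-- The incoming velocities `Γ₋(x) = {v ∈ V ; v · n(x) < 0}` at `x`. -/
def incoming (Ω : Set (Space d)) (m : Measure (Space d)) (x : Space d) : Set (Space d) :=
  {v | v ∈ m.support ∧ inner ℝ v (normal Ω x) < 0}

/-- `Γ₊ = {(x,v) ∈ ∂Ω × V ; v · n(x) > 0}`. -/
def gammaPlus (Ω : Set (Space d)) (m : Measure (Space d)) : Set (Space d × Space d) :=
  {p | p.1 ∈ frontier Ω ∧ p.2 ∈ outgoing Ω m p.1}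

/-- `Γ₋ = {(x,v) ∈ ∂Ω × V ; v · n(x) < 0}`. -/
def gammaMinus (Ω : Set (Space d)) (m : Measure (Space d)) : Set (Space d × Space d) :=
  {p | p.1 ∈ frontier Ω ∧ p.2 ∈ incoming Ω m p.1}

/-- The measure `|v · n(x)| π(dx) ⊗ m(dv)`. -/
def fluxMeasure (Ω : Set (Space d)) (m : Measure (Space d)) : Measure (Space d × Space d) :=
  ((surfaceMeasure Ω).prod m).withDensity
    fun p => ENNReal.ofReal |inner ℝ p.2 (normal Ω p.1)|

/-- `dμ₊`, the measure `|v · n(x)| π(dx) ⊗ m(dv)` on `Γ₊`. -/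
def muPlus (Ω : Set (Space d)) (m : Measure (Space d)) : Measure (Space d × Space d) :=
  (fluxMeasure Ω m).restrict (gammaPlus Ω m)

/-- `dμ₋`, the measure `|v · n(x)| π(dx) ⊗ m(dv)` on `Γ₋`. -/
def muMinus (Ω : Set (Space d)) (m : Measure (Space d)) : Measure (Space d × Space d) :=
  (fluxMeasure Ω m).restrict (gammaMinus Ω m)

/-- The trace space `L¹₊ = L¹(Γ₊, dμ₊)` (complex valued). -/
abbrev LOnePlus (Ω : Set (Space d)) (m : Measure (Space d)) : Type :=
  Lp ℂ 1 (muPlus Ω m)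

/-- The trace space `L¹₋ = L¹(Γ₋, dμ₋)` (complex valued). -/
abbrev LOneMinus (Ω : Set (Space d)) (m : Measure (Space d)) : Type :=
  Lp ℂ 1 (muMinus Ω m)

/-! ### The operators `H` and `M_λ` -/

/-- `H ∈ B(L¹₊, L¹₋)` is the diffuse boundary operator with kernel `k`:
`Hψ(x,v) = ∫_{v'·n(x)>0} k(x,v,v') ψ(x,v') |v'·n(x)| m(dv')` for a.e. `(x,v) ∈ Γ₋`. -/
def IsDiffuseOperator (Ω : Set (Space d)) (m : Measure (Space d))
    (k : Space d → Space d → Space d → ℝ) (H : LOnePlus Ω m →L[ℂ] LOneMinus Ω m) : Prop :=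
  ∀ ψ : LOnePlus Ω m, ∀ᵐ p ∂(muMinus Ω m),
    (H ψ : Space d × Space d → ℂ) p =
      ∫ v' in outgoing Ω m p.1,
        ((k p.1 p.2 v' * |inner ℝ v' (normal Ω p.1)| : ℝ) : ℂ) *
          (ψ : Space d × Space d → ℂ) (p.1, v') ∂m

/-- `M ∈ B(L¹₋, L¹₊)` is the transfer operator `M_λ`:
`M_λ u(x,v) = e^{-λ τ₋(x,v)} u(x - τ₋(x,v) v, v)` for a.e. `(x,v) ∈ Γ₊`. -/
def IsTransferOperator (Ω : Set (Space d)) (m : Measure (Space d)) (lam : ℂ)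
    (M : LOneMinus Ω m →L[ℂ] LOnePlus Ω m) : Prop :=
  ∀ u : LOneMinus Ω m, ∀ᵐ p ∂(muPlus Ω m),
    (M u : Space d × Space d → ℂ) p =
      Complex.exp (-lam * (travelTime Ω p.1 p.2 : ℂ)) *
        (u : Space d × Space d → ℂ) (p.1 - travelTime Ω p.1 p.2 • p.2, p.2)

/-- For a family `T_λ` (`Re λ ≥ 0`) of bounded operators and an exponent `q`: there is `C > 0` with
`∫_ℝ ‖(T_{ε+iη})^q‖ dη ≤ C` for all `ε ≥ 0` (integrability being part of the claim). -/
def HasIntegrablePower {X : Type*} [NormedAddCommGroup X] [NormedSpace ℂ X]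
    (T : ℂ → X →L[ℂ] X) (q : ℕ) : Prop :=
  ∃ C : ℝ, 0 < C ∧ ∀ ε : ℝ, 0 ≤ ε →
    Integrable (fun η : ℝ => ‖(T ((ε : ℂ) + Complex.I * (η : ℂ))) ^ q‖) ∧
    ∫ η : ℝ, ‖(T ((ε : ℂ) + Complex.I * (η : ℂ))) ^ q‖ ≤ C

/-! ### Assumptions on the kernel -/

/-- The set of `(x,v,v')` with `(x,v) ∈ Γ₋` and `(x,v') ∈ Γ₊`, on which a kernel is defined. -/
def kernelDomain (Ω : Set (Space d)) (m : Measure (Space d)) :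
    Set (Space d × Space d × Space d) :=
  {p | p.1 ∈ frontier Ω ∧ p.2.1 ∈ incoming Ω m p.1 ∧ p.2.2 ∈ outgoing Ω m p.1}

/-- The assumptions on the boundary kernel `k(x,v,v')` and on the radial profile `ϖ` (here `w`) of
the velocity measure. Values of `k` outside `kernelDomain` play no role, and `ϖ` matters only on
`(0,∞)`. -/
structure RegularKernel (Ω : Set (Space d)) (m : Measure (Space d)) (w : ℝ → ℝ)
    (k : Space d → Space d → Space d → ℝ) : Prop where
  nonneg : ∀ p ∈ kernelDomain Ω m, 0 ≤ k p.1 p.2.1 p.2.2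
  measurable : Measurable fun p : kernelDomain Ω m => k p.1.1 p.1.2.1 p.1.2.2
  /-- `∫_{v·n(x)<0} k(x,v,v') |v·n(x)| m(dv) = 1` for all `(x,v') ∈ Γ₊`. -/
  normalized : ∀ x ∈ frontier Ω, ∀ v' ∈ outgoing Ω m x,
    ∫ v in incoming Ω m x, k x v v' * |inner ℝ v (normal Ω x)| ∂m = 1
  profile_pos : ∀ r : ℝ, 0 < r → 0 < w r
  /-- The image `m₀` of `m` under `v ↦ |v|` is `|S^{d-1}| ρ^{d-1} ϖ(ρ) dρ` on `(0,∞)`. -/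
  radial : m.map (fun v => ‖v‖) =
    (volume.restrict (Ioi (0 : ℝ))).withDensity fun r =>
      (volume : Measure (Space d)).toSphere univ * ENNReal.ofReal (r ^ (d - 1) * w r)
  /-- The derivatives `ϖ'`, `∇₂k`, `∇₃k` in the integral conditions below exist. -/
  profile_diff : ∀ r : ℝ, 0 < r → DifferentiableAt ℝ w r
  diff_two : ∀ p ∈ kernelDomain Ω m, DifferentiableAt ℝ (fun v => k p.1 v p.2.2) p.2.1
  diff_three : ∀ p ∈ kernelDomain Ω m, DifferentiableAt ℝ (fun v' => k p.1 p.2.1 v') p.2.2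
  /-- `ρ^{d+2} k(x,v,ρσ) k(y,ρσ,v') ϖ(ρ) → 0` as `ρ → ∞`, where `σ = (x-y)/|x-y|`, for all
  `(x,v) ∈ Γ₋` and `(y,v') ∈ Γ₊` for which both kernel values are defined. -/
  decay : ∀ x ∈ frontier Ω, ∀ v ∈ incoming Ω m x, ∀ y ∈ frontier Ω, ∀ v' ∈ outgoing Ω m y,
    ∀ σ : Space d, σ = ‖x - y‖⁻¹ • (x - y) →
      0 < inner ℝ σ (normal Ω x) → inner ℝ σ (normal Ω y) < 0 →
      Tendsto (fun r : ℝ => r ^ (d + 2) * k x v (r • σ) * k y (r • σ) v' * w r) atTop (𝓝 0)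
  /-- `sup ∫₀^∞ ρ^{d+1} [ρ ϖ |∇₂k(y,ρσ,v')| + k(y,ρσ,v') (ρ |ϖ'| + ϖ)] dρ < ∞`, the supremum being
  over `(y,v') ∈ Γ₊` and unit vectors `σ` with `σ·n(y) < 0`. -/
  bound_two : ∃ B : ℝ≥0, ∀ y ∈ frontier Ω, ∀ v' ∈ outgoing Ω m y,
    ∀ σ : Space d, ‖σ‖ = 1 → inner ℝ σ (normal Ω y) < 0 →
      ∫⁻ r in Ioi (0 : ℝ), ENNReal.ofReal (r ^ (d + 1) *
        (r * w r * ‖gradient (fun v => k y v v') (r • σ)‖ +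
          k y (r • σ) v' * (r * |deriv w r| + w r))) ≤ B
  /-- `sup ∫₀^∞ ρ^{d+2} ϖ k(y,ρσ,v') (∫_{Γ₋(x)} |∇₃k(x,v,ρσ)| |v·n(x)| m(dv)) dρ < ∞`, the supremum
  being over `x ∈ ∂Ω`, `(y,v') ∈ Γ₊` and unit vectors `σ` with `σ·n(x) > 0`, `σ·n(y) < 0`. -/
  bound_three : ∃ B : ℝ≥0, ∀ x ∈ frontier Ω, ∀ y ∈ frontier Ω, ∀ v' ∈ outgoing Ω m y,
    ∀ σ : Space d, ‖σ‖ = 1 → 0 < inner ℝ σ (normal Ω x) → inner ℝ σ (normal Ω y) < 0 →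
      ∫⁻ r in Ioi (0 : ℝ), ENNReal.ofReal (r ^ (d + 2) * w r * k y (r • σ) v') *
        (∫⁻ v in incoming Ω m x, ENNReal.ofReal
          (‖gradient (fun u => k x v u) (r • σ)‖ * |inner ℝ v (normal Ω x)|) ∂m) ≤ B

/-! ### The Maxwell diffuse boundary condition -/

/-- The Maxwellian `M_θ(v) = (2πθ)^{-d/2} exp(-|v|²/(2θ))`. -/
def maxwellian (θ : ℝ) (v : Space d) : ℝ :=
  (2 * Real.pi * θ) ^ (-(d : ℝ) / 2) * Real.exp (-‖v‖ ^ 2 / (2 * θ))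

/-- The kernel `k(x,v,v') = γ(x)⁻¹ M_{θ(x)}(v)`, with
`γ(x) = ∫_{v·n(x)<0} M_{θ(x)}(v) |v·n(x)| dv`. -/
def maxwellKernel (Ω : Set (Space d)) (θ : Space d → ℝ) (x v _v' : Space d) : ℝ :=
  (∫ u in incoming Ω volume x, maxwellian (θ x) u * |inner ℝ u (normal Ω x)|)⁻¹ *
    maxwellian (θ x) v

end Kinetic

end

open Kinetic

noncomputable section

open MeasureTheory Set Filter Topology
open scoped ENNReal NNReal

namespace Kinetic

variable {d : ℕ}

/-! Since `(M H)² = M (H M H)` and both operators are contractions in L¹, only `H M_λ H` has to be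
estimated. Written out, it re-emits at `x` with velocity `v` the particles that left a boundary
point `y` with velocity `v'`, and the free flight from `y` to `x` contributes the factor `exp(-λ
τ(x,v'))`. The gain `1/|λ|` is a velocity averaging effect, produced by the oscillation of this
factor in the speed `r = |v'|` at fixed direction `σ`.

By orthogonal invariance and its radial law, `m` has density `ϖ(|v|)`
(`RegularKernel.eq_withDensity`), so polar coordinates are available. For `v' = r σ` the point `y`
depends on `σ` only, and `τ(x, rσ) = τ(x,σ)/r`. With `F(r) = r^(d+2) ϖ(r) k(x,v,rσ) k(y,rσ,u)`, the
radial integral is that of `r⁻² F(r) exp(-λτ/r)`. As `exp(-λτ/r)` has derivative `λτ r⁻²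
exp(-λτ/r)`, one integration by parts bounds it by `1/(|λ| τ(x,σ))` times the integrals of `|F'|`
and `|F|/r` (`enorm_integral_oscillatory_le`). These are controlled, after integration in `v`, by
the normalization of `k` and the two integral conditions (`RegularKernel.lintegral_majorant_le`).

What remains is the singularity `1/τ(x,σ)` at short chords. A `C^{1,α}` boundary is flat to order `1
+ α`, so short chords are nearly tangential: `1/τ ≤ K |σ·n(y)|^(-1/α)`
(`HasHolderBoundary.exists_inv_travelTime_le`). Free transport at fixed velocity carries the flux
`|σ·n(x)| π(dx)` at the arrival point into a measure bounded by the flux `|σ·n(y)| π(dy)` at the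
departure point (`HasHolderBoundary.transport`), because both are measured by the shadow on the
hyperplane orthogonal to `σ`. The weight becomes `|σ·n(y)|^(1-1/α)`, integrable over the sphere
uniformly in `y` because `α > 1/2` (`exists_sphere_bound`). The pieces are joined in
`RegularKernel.exists_lintegral_iterated_le` and `RegularKernel.exists_norm_sq_le`.

For the fourth power, the norm is at most both `1` and `C²/η²`, hence dominated by a multiple of
`1/(1+η²)` uniformly in `ε` (`HasHolderBoundary.hasIntegrablePower`). For the Maxwell kernel all
conditions reduce to Gaussian moments, uniform because `θ` lies between positive constants on the
compact boundary (`HasHolderBoundary.regularKernel_maxwell`). -/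

/-! ### Normals and local defining functions -/

theorem isOutwardNormal_of_hasStrictFDerivAt {Ω : Set (Space d)} {x : Space d} {ψ : Space d → ℝ}
    {U : Set (Space d)} (hU : U ∈ 𝓝 x) (hΩ : ∀ y ∈ U, y ∈ Ω ↔ ψ y < 0)
    {g : Space d} (hg : g ≠ 0) (hψ : HasFDerivAt ψ (innerSL ℝ g) x) (h0 : ψ x = 0) :
    IsOutwardNormal Ω x (‖g‖⁻¹ • g) := by
  have hgn : 0 < ‖g‖ := norm_pos_iff.2 hg
  refine ⟨by rw [norm_smul, norm_inv, norm_norm, inv_mul_cancel₀ hgn.ne'], fun w => ?_⟩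
  have hline : HasDerivAt (fun t : ℝ => ψ (x + t • w)) (inner ℝ g w) 0 := by
    have h1 : HasDerivAt (fun t : ℝ => x + t • w) w 0 := by
      simpa using ((hasDerivAt_id (0 : ℝ)).smul_const w).const_add x
    have h2 : HasFDerivAt ψ (innerSL ℝ g) (x + (0 : ℝ) • w) := by simpa using hψ
    have h3 := h2.comp_hasDerivAt (0 : ℝ) h1
    rwa [innerSL_apply_apply] at h3
  have hmem : ∀ᶠ t in 𝓝[>] (0 : ℝ), x + t • w ∈ U := by
    have : Tendsto (fun t : ℝ => x + t • w) (𝓝[>] 0) (𝓝 x) := by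
      have : Continuous fun t : ℝ => x + t • w := by fun_prop
      have h := this.tendsto 0
      simp only [zero_smul, add_zero] at h
      exact h.mono_left nhdsWithin_le_nhds
    exact this hU
  have hs := (hasDerivAt_iff_tendsto_slope.1 hline).mono_left
    (nhdsWithin_mono 0 (fun t (ht : 0 < t) => ht.ne'))
  have hin : inner ℝ w (‖g‖⁻¹ • g) = ‖g‖⁻¹ * inner ℝ g w := by
    rw [inner_smul_right, real_inner_comm]
  rw [hin]
  constructor
  · intro h
    have h' : inner ℝ g w < 0 := by
      by_contra hc
      exact absurd h (not_lt.2 (mul_nonneg (inv_nonneg.2 hgn.le) (not_lt.1 hc)))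
    filter_upwards [hmem, hs (Iio_mem_nhds h'), self_mem_nhdsWithin] with t h1 h2 h3
    rw [hΩ _ h1]
    have h3' : 0 < t := h3
    simp only [slope, mem_preimage, zero_smul, add_zero, h0, vsub_eq_sub, sub_zero, smul_eq_mul,
      mem_Iio] at h2
    by_contra hc
    exact absurd h2 (not_lt.2 (mul_nonneg (inv_nonneg.2 h3'.le) (not_lt.1 hc)))
  · intro h
    have h' : 0 < inner ℝ g w := by
      by_contra hc
      exact absurd h (not_lt.2 (mul_nonpos_of_nonneg_of_nonpos (inv_nonneg.2 hgn.le)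
        (not_lt.1 hc)))
    filter_upwards [hmem, hs (Ioi_mem_nhds h'), self_mem_nhdsWithin] with t h1 h2 h3
    rw [hΩ _ h1]
    have h3' : 0 < t := h3
    simp only [slope, mem_preimage, zero_smul, add_zero, h0, vsub_eq_sub, sub_zero, smul_eq_mul,
      mem_Ioi] at h2
    intro hc
    exact absurd h2 (not_lt.2 (mul_nonpos_of_nonneg_of_nonpos (inv_nonneg.2 h3'.le) hc.le))

theorem IsOutwardNormal.normal_eq {Ω : Set (Space d)} {x n : Space d}
    (h : IsOutwardNormal Ω x n) : normal Ω x = n := by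
  have hex : ∃ n, IsOutwardNormal Ω x n := ⟨n, h⟩
  rw [normal, dif_pos hex]
  exact hex.choose_spec.unique h

/-- Outside the boundary there is no outward normal. -/
theorem normal_eq_zero_of_notMem_frontier {Ω : Set (Space d)} {x : Space d}
    (hx : x ∉ frontier Ω) : normal Ω x = 0 := by
  rw [normal, dif_neg]
  rintro ⟨n, hn, h⟩
  have hcont : ∀ w : Space d, Tendsto (fun t : ℝ => x + t • w) (𝓝[>] 0) (𝓝 x) := fun w => by
    have : Continuous fun t : ℝ => x + t • w := by fun_prop
    have h := this.tendsto 0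
    simp only [zero_smul, add_zero] at h
    exact h.mono_left nhdsWithin_le_nhds
  have hnn : inner ℝ n n = (1 : ℝ) := by rw [real_inner_self_eq_norm_sq, hn]; norm_num
  rw [frontier_eq_closure_inter_closure, mem_inter_iff, not_and_or] at hx
  rcases hx with hx | hx
  · have h1 := (h (-n)).1 (by rw [inner_neg_left, hnn]; norm_num)
    have h2 := hcont (-n) (isClosed_closure.isOpen_compl.mem_nhds hx)
    obtain ⟨t, ht1, ht2⟩ := (h1.and h2).exists
    exact ht2 (subset_closure ht1)
  · have h1 := (h n).2 (by rw [hnn]; norm_num)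
    have h2 := hcont n (isClosed_closure.isOpen_compl.mem_nhds hx)
    obtain ⟨t, ht1, ht2⟩ := (h1.and h2).exists
    exact ht2 (subset_closure ht1)

/-- Local defining function of a boundary of class `C^{1,α}`, in a form centred at a boundary
point. -/
theorem HasHolderBoundary.exists_local {Ω : Set (Space d)} {α : ℝ} (hΩ : IsOpen Ω)
    (h : HasHolderBoundary Ω α) {x₀ : Space d} (hx₀ : x₀ ∈ frontier Ω) :
    ∃ (r : ℝ) (ψ : Space d → ℝ) (K : ℝ), 0 < r ∧ 0 ≤ K ∧
      (∀ y ∈ Metric.ball x₀ r, ContDiffAt ℝ 1 ψ y ∧ fderiv ℝ ψ y ≠ 0 ∧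
        (y ∈ Ω ↔ ψ y < 0) ∧ (y ∈ frontier Ω → ψ y = 0)) ∧
      (∀ y ∈ Metric.ball x₀ r, ∀ z ∈ Metric.ball x₀ r,
        ‖fderiv ℝ ψ y - fderiv ℝ ψ z‖ ≤ K * ‖y - z‖ ^ α) := by
  obtain ⟨U, ψ, hU, hxU, hψ, hne, ⟨K, hK⟩, hΩU⟩ := h x₀ hx₀
  obtain ⟨r, hr, hrU⟩ := Metric.isOpen_iff.1 hU x₀ hxU
  refine ⟨r, ψ, max K 0, hr, le_max_right _ _, fun y hy => ?_, fun y hy z hz => ?_⟩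
  · have hyU := hrU hy
    have hcd : ContDiffAt ℝ 1 ψ y := hψ.contDiffAt (hU.mem_nhds hyU)
    refine ⟨hcd, hne y hyU, hΩU y hyU, fun hyf => ?_⟩
    rw [frontier_eq_closure_inter_closure] at hyf
    apply le_antisymm
    · by_contra hc
      push Not at hc
      have : ∀ᶠ z in 𝓝 y, 0 < ψ z ∧ z ∈ U :=
        (hcd.continuousAt.eventually (Ioi_mem_nhds hc)).and (hU.mem_nhds hyU)
      obtain ⟨z, hz, hzΩ⟩ := mem_closure_iff_nhds.1 hyf.1 _ this
      exact absurd ((hΩU z hz.2).1 hzΩ) (not_lt.2 hz.1.le)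
    · by_contra hc
      push Not at hc
      have hyn : y ∉ Ω := by
        have := hyf.2
        rwa [hΩ.isClosed_compl.closure_eq] at this
      exact hyn ((hΩU y hyU).2 hc)
  · exact (hK y (hrU hy) z (hrU hz)).trans
      (mul_le_mul_of_nonneg_right (le_max_left _ _) (Real.rpow_nonneg (norm_nonneg _) _))

/-- The gradient, as the Riesz representative of the Fréchet derivative. -/
theorem innerSL_gradient (ψ : Space d → ℝ) (x : Space d) :
    innerSL ℝ (gradient ψ x) = fderiv ℝ ψ x := by
  ext w
  simp [gradient]

theorem norm_gradient (ψ : Space d → ℝ) (x : Space d) : ‖gradient ψ x‖ = ‖fderiv ℝ ψ x‖ := by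
  simp [gradient]

theorem HasHolderBoundary.exists_local_normal {Ω : Set (Space d)} {α : ℝ} (hΩ : IsOpen Ω)
    (h : HasHolderBoundary Ω α) {x₀ : Space d} (hx₀ : x₀ ∈ frontier Ω) :
    ∃ (r : ℝ) (ψ : Space d → ℝ) (K : ℝ), 0 < r ∧ 0 ≤ K ∧
      (∀ y ∈ Metric.ball x₀ r, ContDiffAt ℝ 1 ψ y ∧ fderiv ℝ ψ y ≠ 0 ∧
        (y ∈ Ω ↔ ψ y < 0) ∧ (y ∈ frontier Ω → ψ y = 0 ∧
          IsOutwardNormal Ω y (‖gradient ψ y‖⁻¹ • gradient ψ y))) ∧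
      (∀ y ∈ Metric.ball x₀ r, ∀ z ∈ Metric.ball x₀ r,
        ‖fderiv ℝ ψ y - fderiv ℝ ψ z‖ ≤ K * ‖y - z‖ ^ α) := by
  obtain ⟨r, ψ, K, hr, hK0, h1, h2⟩ := h.exists_local hΩ hx₀
  refine ⟨r, ψ, K, hr, hK0, fun y hy => ?_, h2⟩
  obtain ⟨a, b, c, e⟩ := h1 y hy
  refine ⟨a, b, c, fun hyf => ⟨e hyf, ?_⟩⟩
  refine isOutwardNormal_of_hasStrictFDerivAt (Metric.isOpen_ball.mem_nhds hy)
    (fun z hz => (h1 z hz).2.2.1) ?_ ?_ (e hyf)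
  · rw [← norm_ne_zero_iff, norm_gradient, norm_ne_zero_iff]; exact b
  · rw [innerSL_gradient]
    exact (a.differentiableAt one_ne_zero).hasFDerivAt

/-! ### Regularity and Hölder flatness of the boundary -/

section Boundary

variable {Ω : Set (Space d)} {α : ℝ} (hΩ : IsOpen Ω) (h : HasHolderBoundary Ω α)
include hΩ h

theorem HasHolderBoundary.isOutwardNormal {x : Space d} (hx : x ∈ frontier Ω) :
    IsOutwardNormal Ω x (normal Ω x) := by
  obtain ⟨r, ψ, K, hr, -, h1, -⟩ := h.exists_local_normal hΩ hx
  have := ((h1 x (Metric.mem_ball_self hr)).2.2.2 hx).2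
  rwa [this.normal_eq]

theorem HasHolderBoundary.norm_normal {x : Space d} (hx : x ∈ frontier Ω) :
    ‖normal Ω x‖ = 1 := (h.isOutwardNormal hΩ hx).1

theorem HasHolderBoundary.continuousOn_normal : ContinuousOn (normal Ω) (frontier Ω) := by
  intro x hx
  obtain ⟨r, ψ, K, hr, -, h1, -⟩ := h.exists_local_normal hΩ hx
  have hcd := (h1 x (Metric.mem_ball_self hr)).1
  have hne := (h1 x (Metric.mem_ball_self hr)).2.1
  have hg : ContinuousAt (gradient ψ) x :=
    (LinearIsometryEquiv.continuous _).continuousAt.comp (hcd.continuousAt_fderiv one_ne_zero)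
  have hne' : ‖gradient ψ x‖ ≠ 0 := by rw [norm_gradient, norm_ne_zero_iff]; exact hne
  have : ContinuousAt (fun y => ‖gradient ψ y‖⁻¹ • gradient ψ y) x := (hg.norm.inv₀ hne').smul hg
  refine this.continuousWithinAt.congr_of_eventuallyEq ?_ ?_
  · filter_upwards [self_mem_nhdsWithin,
      mem_nhdsWithin_of_mem_nhds (Metric.ball_mem_nhds x hr)] with y hy hyr
    exact ((h1 y hyr).2.2.2 hy).2.normal_eq
  · exact ((h1 x (Metric.mem_ball_self hr)).2.2.2 hx).2.normal_eq

/-- The default value `0` off the boundary makes the normal constant there, while on the closed set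
`frontier Ω` it is continuous. -/
theorem HasHolderBoundary.measurable_normal : Measurable (normal Ω) := by
  have hm : MeasurableSet (frontier Ω) := isClosed_frontier.measurableSet
  have : normal Ω = (frontier Ω).indicator (normal Ω) := by
    ext1 x
    by_cases hx : x ∈ frontier Ω
    · rw [indicator_of_mem hx]
    · rw [indicator_of_notMem hx, normal_eq_zero_of_notMem_frontier hx]
  rw [this]
  refine measurable_of_restrict_of_restrict_compl hm ?_ ?_
  · have e : (frontier Ω).domRestrict ((frontier Ω).indicator (normal Ω)) =
        (frontier Ω).domRestrict (normal Ω) := by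
      ext1 x
      exact indicator_of_mem x.2 _
    rw [e]
    exact (continuousOn_iff_continuous_domRestrict.1 (h.continuousOn_normal hΩ)).measurable
  · have e : (frontier Ω)ᶜ.domRestrict ((frontier Ω).indicator (normal Ω)) = fun _ => 0 := by
      ext1 x
      exact indicator_of_notMem x.2 _
    rw [e]
    exact measurable_const

/-- Near a boundary point, the boundary is flat up to first order. -/
theorem HasHolderBoundary.flat {x₀ : Space d} (hx₀ : x₀ ∈ frontier Ω) {δ : ℝ} (hδ : 0 < δ) :
    ∃ r : ℝ, 0 < r ∧ ∀ x ∈ Metric.ball x₀ r ∩ frontier Ω, ∀ y ∈ Metric.ball x₀ r ∩ frontier Ω,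
      |inner ℝ (x - y) (normal Ω x₀)| ≤ δ * ‖x - y‖ := by
  obtain ⟨r, ψ, K, hr, -, h1, -⟩ := h.exists_local_normal hΩ hx₀
  obtain ⟨hcd, hne, -, hn⟩ := h1 x₀ (Metric.mem_ball_self hr)
  have hn := (hn hx₀).2.normal_eq
  have hgpos : 0 < ‖gradient ψ x₀‖ := by rw [norm_gradient]; exact norm_pos_iff.2 hne
  -- Strict differentiability controls `ψ x - ψ y - Dψ(x₀)(x - y)` for all pairs near `x₀`, and `ψ`
  -- vanishes at both boundary points.
  have hst := hcd.hasStrictFDerivAt one_ne_zero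
  have hev := hst.isLittleO.def (mul_pos hδ hgpos)
  obtain ⟨s, hs, hsr⟩ := Metric.eventually_nhds_iff.1 hev
  refine ⟨min r s, lt_min hr hs, fun x hx y hy => ?_⟩
  have hxs := Metric.ball_subset_ball (min_le_right r s) hx.1
  have hys := Metric.ball_subset_ball (min_le_right r s) hy.1
  have hxr := Metric.ball_subset_ball (min_le_left r s) hx.1
  have hyr := Metric.ball_subset_ball (min_le_left r s) hy.1
  have key := hsr (y := (x, y)) (by
    rw [Prod.dist_eq]; exact max_lt hxs hys)
  simp only [((h1 x hxr).2.2.2 hx.2).1, ((h1 y hyr).2.2.2 hy.2).1, sub_self, zero_sub, norm_neg]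
    at key
  rw [← innerSL_gradient, innerSL_apply_apply, Real.norm_eq_abs] at key
  rw [hn, inner_smul_right, abs_mul, abs_of_nonneg (inv_nonneg.2 hgpos.le), real_inner_comm,
    inv_mul_le_iff₀ hgpos]
  linarith

/-- The uniform Hölder flatness of the boundary. -/
theorem HasHolderBoundary.exists_holder (hb : Bornology.IsBounded Ω) (hα : 0 < α) :
    ∃ K : ℝ, 0 < K ∧ ∀ x ∈ frontier Ω, ∀ y ∈ frontier Ω,
      |inner ℝ (x - y) (normal Ω y)| ≤ K * ‖x - y‖ ^ (1 + α) := by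
  have hcomp : IsCompact (frontier Ω) :=
    Metric.isCompact_of_isClosed_isBounded isClosed_frontier
      (hb.closure.subset frontier_subset_closure)
  have hloc : ∀ x₀ ∈ frontier Ω, ∃ r : ℝ, 0 < r ∧ ∃ K : ℝ, 0 ≤ K ∧
      ∀ x ∈ Metric.ball x₀ r ∩ frontier Ω, ∀ y ∈ Metric.ball x₀ r ∩ frontier Ω,
      |inner ℝ (x - y) (normal Ω y)| ≤ K * ‖x - y‖ ^ (1 + α) := by
    intro x₀ hx₀
    obtain ⟨r, ψ, K, hr, hK0, h1, h2⟩ := h.exists_local_normal hΩ hx₀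
    obtain ⟨hcd, hne, -, -⟩ := h1 x₀ (Metric.mem_ball_self hr)
    set c := ‖fderiv ℝ ψ x₀‖ with hc
    have hcpos : 0 < c := norm_pos_iff.2 hne
    have hev : ∀ᶠ y in 𝓝 x₀, c / 2 < ‖fderiv ℝ ψ y‖ :=
      (hcd.continuousAt_fderiv one_ne_zero).norm.eventually
        (Ioi_mem_nhds (by simpa [← hc] using half_lt_self hcpos))
    obtain ⟨s, hs, hsr⟩ := Metric.eventually_nhds_iff.1 hev
    refine ⟨min r s, lt_min hr hs, 2 * K / c, by positivity, fun x hx y hy => ?_⟩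
    have hys := Metric.ball_subset_ball (min_le_right r s) hy.1
    have hxr := Metric.ball_subset_ball (min_le_left r s) hx.1
    have hyr := Metric.ball_subset_ball (min_le_left r s) hy.1
    have hgy := hsr hys
    have hgpos : 0 < ‖gradient ψ y‖ := by rw [norm_gradient]; linarith
    -- On this convex set every point is within `‖x - y‖` of `y`, so `Dψ` differs from `Dψ(y)` by at
    -- most `K ‖x - y‖ ^ α` and the mean value inequality gains the extra power.
    have hconv : Convex ℝ (Metric.ball x₀ r ∩ Metric.closedBall y ‖x - y‖) :=
      (convex_ball _ _).inter (convex_closedBall _ _)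
    have hmv := hconv.norm_image_sub_le_of_norm_hasFDerivWithin_le' (f := ψ) (f' := fderiv ℝ ψ)
      (φ := fderiv ℝ ψ y) (C := K * ‖x - y‖ ^ α) (x := y) (y := x)
      (fun z hz => (((h1 z hz.1).1.differentiableAt one_ne_zero).hasFDerivAt).hasFDerivWithinAt)
      (fun z hz => (h2 z hz.1 y hyr).trans (by
        refine mul_le_mul_of_nonneg_left (Real.rpow_le_rpow (norm_nonneg _) ?_ hα.le) hK0
        simpa [dist_eq_norm] using hz.2))
      ⟨hyr, Metric.mem_closedBall_self (norm_nonneg _)⟩ ⟨hxr, by simp [dist_eq_norm]⟩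
    simp only [((h1 x hxr).2.2.2 hx.2).1, ((h1 y hyr).2.2.2 hy.2).1, sub_self, zero_sub, norm_neg]
      at hmv
    rw [← innerSL_gradient, innerSL_apply_apply, Real.norm_eq_abs] at hmv
    rw [((h1 y hyr).2.2.2 hy.2).2.normal_eq, inner_smul_right, abs_mul,
      abs_of_nonneg (inv_nonneg.2 hgpos.le), real_inner_comm, inv_mul_le_iff₀ hgpos]
    have e : K * ‖x - y‖ ^ α * ‖x - y‖ = K * ‖x - y‖ ^ (1 + α) := by
      rw [mul_assoc, add_comm, Real.rpow_add_one' (norm_nonneg _) (by linarith)]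
    rw [e] at hmv
    refine hmv.trans ?_
    rw [norm_gradient]
    calc K * ‖x - y‖ ^ (1 + α) = (c / 2) * (2 * K / c * ‖x - y‖ ^ (1 + α)) := by
          field_simp
      _ ≤ _ := by
        refine mul_le_mul_of_nonneg_right hgy.le ?_
        have := Real.rpow_nonneg (norm_nonneg (x - y)) (1 + α)
        positivity
  choose! r hr K hK hrK using hloc
  obtain ⟨t, ht, hcov⟩ := hcomp.elim_nhds_subcover (fun x => Metric.ball x (r x))
    (fun x hx => Metric.ball_mem_nhds x (hr x hx))
  -- Two boundary points closer than the Lebesgue number `δ` lie in a common ball of the finite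
  -- cover. For the other pairs `‖x - y‖ ≤ δ ^ (-α) * ‖x - y‖ ^ (1 + α)`, which explains the last
  -- summand of the constant below.
  obtain ⟨δ, hδ, hleb⟩ := lebesgue_number_lemma_of_metric (s := frontier Ω)
    (c := fun i : t => Metric.ball (i : Space d) (r i)) hcomp (fun _ => Metric.isOpen_ball)
    (fun x hx => by
      obtain ⟨i, hi, hxi⟩ := mem_iUnion₂.1 (hcov hx)
      exact mem_iUnion.2 ⟨⟨i, hi⟩, hxi⟩)
  refine ⟨1 + ∑ i ∈ t, K i + δ ^ (-α), ?_, fun x hx y hy => ?_⟩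
  · have : 0 ≤ ∑ i ∈ t, K i := Finset.sum_nonneg fun i hi => hK i (ht i hi)
    have := Real.rpow_nonneg hδ.le (-α)
    linarith
  have hsum : 0 ≤ ∑ i ∈ t, K i := Finset.sum_nonneg fun i hi => hK i (ht i hi)
  have hδα := Real.rpow_nonneg hδ.le (-α)
  have hp := Real.rpow_nonneg (norm_nonneg (x - y)) (1 + α)
  by_cases hxy : dist x y < δ
  · obtain ⟨i, hi⟩ := hleb y hy
    refine (hrK i (ht i i.2) x ⟨hi hxy, hx⟩ y ⟨hi (Metric.mem_ball_self hδ), hy⟩).trans ?_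
    refine mul_le_mul_of_nonneg_right ?_ hp
    have := Finset.single_le_sum (f := K) (fun i hi => hK i (ht i hi)) i.2
    linarith
  · push Not at hxy
    rw [dist_eq_norm] at hxy
    have hn := h.norm_normal hΩ hy
    have h1 : |inner ℝ (x - y) (normal Ω y)| ≤ ‖x - y‖ := by
      have := abs_real_inner_le_norm (x - y) (normal Ω y)
      rwa [hn, mul_one] at this
    have h2 : ‖x - y‖ ≤ δ ^ (-α) * ‖x - y‖ ^ (1 + α) := by
      have h3 : 1 ≤ δ ^ (-α) * ‖x - y‖ ^ α := by
        rw [Real.rpow_neg hδ.le, ← div_eq_inv_mul, one_le_div (Real.rpow_pos_of_pos hδ _)]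
        exact Real.rpow_le_rpow hδ.le hxy hα.le
      rw [add_comm, Real.rpow_add_one' (norm_nonneg _) (by linarith), ← mul_assoc]
      exact le_mul_of_one_le_left (norm_nonneg _) h3
    nlinarith

end Boundary

/-! ### Travel times and exit points -/

section Travel

theorem travelTime_nonneg (Ω : Set (Space d)) (x v : Space d) : 0 ≤ travelTime Ω x v :=
  Real.sInf_nonneg fun _ hs => hs.1.le

/-- In `Ω` the set of exit times is empty and `sInf ∅ = 0`; outside `Ω` it is `Ioi 0`. The two cases
agree only through the default value. -/
theorem travelTime_zero (Ω : Set (Space d)) (x : Space d) : travelTime Ω x 0 = 0 := by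
  by_cases hx : x ∈ Ω
  · have : {s : ℝ | 0 < s ∧ x - s • (0 : Space d) ∉ Ω} = ∅ := by
      ext s; simp [hx]
    rw [travelTime, this, Real.sInf_empty]
  · have : {s : ℝ | 0 < s ∧ x - s • (0 : Space d) ∉ Ω} = Ioi 0 := by
      ext s; simp [hx]
    rw [travelTime, this, csInf_Ioi]

/-- This scaling turns `exp(-λτ)` into a phase in `1/r` along each ray of velocities, while the exit
point stays fixed. -/
theorem travelTime_smul (Ω : Set (Space d)) (x v : Space d) {r : ℝ} (hr : 0 < r) :
    travelTime Ω x (r • v) = r⁻¹ * travelTime Ω x v := by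
  rw [travelTime, travelTime, ← smul_eq_mul, ← Real.sInf_smul_of_nonneg (inv_nonneg.2 hr.le)]
  congr 1
  ext s
  rw [mem_smul_set_iff_inv_smul_mem₀ (inv_ne_zero hr.ne'), inv_inv]
  simp only [mem_ofPred_eq, smul_eq_mul, smul_smul, mul_comm r s, mul_pos_iff_of_pos_right hr]

theorem mem_of_lt_travelTime {Ω : Set (Space d)} {x v : Space d} {s : ℝ} (hs : 0 < s)
    (hsτ : s < travelTime Ω x v) : x - s • v ∈ Ω := by
  by_contra hc
  exact notMem_of_lt_csInf hsτ ⟨0, fun _ h => h.1.le⟩ ⟨hs, hc⟩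

theorem exists_notMem_of_isBounded {Ω : Set (Space d)} (hb : Bornology.IsBounded Ω)
    (x : Space d) {v : Space d} (hv : v ≠ 0) : ∃ s : ℝ, 0 < s ∧ x - s • v ∉ Ω := by
  obtain ⟨R, hR⟩ := hb.subset_closedBall x
  have hv' : 0 < ‖v‖ := norm_pos_iff.2 hv
  refine ⟨(|R| + 1) / ‖v‖, by positivity, fun hc => ?_⟩
  have := hR hc
  rw [Metric.mem_closedBall, dist_eq_norm, sub_sub_cancel_left, norm_neg, norm_smul,
    Real.norm_of_nonneg (by positivity), div_mul_cancel₀ _ hv'.ne'] at this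
  linarith [le_abs_self R]

theorem le_travelTime_iff {Ω : Set (Space d)} (hb : Bornology.IsBounded Ω) {x v : Space d}
    (hv : v ≠ 0) (a : ℝ) :
    a ≤ travelTime Ω x v ↔ ∀ s ∈ Ioo 0 a, x - s • v ∈ Ω := by
  constructor
  · intro h s hs
    exact mem_of_lt_travelTime hs.1 (hs.2.trans_le h)
  · intro h
    refine le_csInf (exists_notMem_of_isBounded hb x hv) fun s hs => ?_
    by_contra hc
    exact hs.2 (h s ⟨hs.1, not_le.1 hc⟩)

/-- For `a > 0`, the superlevel set `{a ≤ τ}` asks that an open segment lie in `Ω`. Exhausting the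
segment by compact ones writes this set, away from zero velocity, as a countable intersection of
sets that are open by compactness. -/
theorem measurable_travelTime {Ω : Set (Space d)} (hΩ : IsOpen Ω) (hb : Bornology.IsBounded Ω) :
    Measurable fun p : Space d × Space d => travelTime Ω p.1 p.2 := by
  refine measurable_of_Ici fun a => ?_
  rcases le_or_gt a 0 with ha | ha
  · convert MeasurableSet.univ
    ext p
    simpa using ha.trans (travelTime_nonneg Ω p.1 p.2)
  have e : (fun p : Space d × Space d => travelTime Ω p.1 p.2) ⁻¹' Ici a =
      {p : Space d × Space d | p.2 ≠ 0} ∩ ⋂ n : ℕ,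
        {p : Space d × Space d | ∀ s ∈ Icc (a / (n + 2)) (a - a / (n + 2)),
          p.1 - s • p.2 ∈ Ω} := by
    ext p
    simp only [mem_preimage, mem_Ici, mem_inter_iff, mem_ofPred_eq, mem_iInter]
    constructor
    · intro h
      have hv : p.2 ≠ 0 := by
        intro h0
        rw [h0, travelTime_zero] at h
        exact absurd ha (not_lt.2 h)
      refine ⟨hv, fun n s hs => (le_travelTime_iff hb hv a).1 h s ⟨?_, ?_⟩⟩
      · exact lt_of_lt_of_le (by positivity) hs.1
      · refine lt_of_le_of_lt hs.2 (sub_lt_self _ (by positivity))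
    · rintro ⟨hv, h⟩
      refine (le_travelTime_iff hb hv a).2 fun s hs => ?_
      have hlim : Tendsto (fun n : ℕ => a / ((n : ℝ) + 2)) atTop (𝓝 0) := by
        have h1 : Tendsto (fun n : ℕ => (n : ℝ) + 2) atTop atTop :=
          tendsto_atTop_add_const_right _ _ tendsto_natCast_atTop_atTop
        exact h1.const_div_atTop a
      have hlim2 : Tendsto (fun n : ℕ => a - a / ((n : ℝ) + 2)) atTop (𝓝 a) := by
        simpa using hlim.const_sub a
      obtain ⟨n, hn1, hn2⟩ := ((hlim.eventually (Iio_mem_nhds hs.1)).and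
        (hlim2.eventually (Ioi_mem_nhds hs.2))).exists
      exact h n s ⟨le_of_lt hn1, le_of_lt hn2⟩
  rw [e]
  refine MeasurableSet.inter ?_ (MeasurableSet.iInter fun n => IsOpen.measurableSet ?_)
  · exact (measurableSet_singleton (0 : Space d)).compl.preimage measurable_snd
  · rw [isOpen_iff_eventually]
    intro p hp
    refine isCompact_Icc.eventually_forall_of_forall_eventually
      (P := fun (p : Space d × Space d) (s : ℝ) => p.1 - s • p.2 ∈ Ω) fun s hs => ?_
    have : Continuous fun z : (Space d × Space d) × ℝ => z.1.1 - z.2 • z.1.2 := by fun_prop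
    exact this.continuousAt.eventually (hΩ.mem_nhds (hp s hs))

/-- The point at which the backward trajectory starting from `x` with velocity `v` leaves `Ω`. -/
def exitPoint (Ω : Set (Space d)) (v x : Space d) : Space d := x - travelTime Ω x v • v

theorem exitPoint_smul (Ω : Set (Space d)) (v x : Space d) {r : ℝ} (hr : 0 < r) :
    exitPoint Ω (r • v) x = exitPoint Ω v x := by
  rw [exitPoint, exitPoint, travelTime_smul Ω x v hr, smul_smul, mul_right_comm,
    inv_mul_cancel₀ hr.ne', one_mul]

theorem measurable_exitPoint {Ω : Set (Space d)} (hΩ : IsOpen Ω) (hb : Bornology.IsBounded Ω) :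
    Measurable fun p : Space d × Space d => exitPoint Ω p.2 p.1 :=
  measurable_fst.sub ((measurable_travelTime hΩ hb).smul measurable_snd)

variable {Ω : Set (Space d)} (hΩ : IsOpen Ω) (hb : Bornology.IsBounded Ω) {x v n : Space d}

theorem travelTime_pos (hb : Bornology.IsBounded Ω) (hn : IsOutwardNormal Ω x n)
    (hv : 0 < inner ℝ v n) : 0 < travelTime Ω x v := by
  have hv0 : v ≠ 0 := by rintro rfl; simp at hv
  have h1 := (hn.2 (-v)).1 (by rw [inner_neg_left]; linarith)
  obtain ⟨ε, hε, h2⟩ := mem_nhdsGT_iff_exists_Ioo_subset.1 h1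
  refine lt_of_lt_of_le hε ((le_travelTime_iff hb hv0 ε).2 fun s hs => ?_)
  have := h2 hs
  simpa [sub_eq_add_neg] using this

include hΩ in
theorem exitPoint_notMem (hτ : 0 < travelTime Ω x v) : exitPoint Ω v x ∉ Ω := by
  intro hc
  have hcont : Continuous fun s : ℝ => x - s • v := by fun_prop
  have hev := hcont.continuousAt.eventually (hΩ.mem_nhds hc)
  obtain ⟨ε, hε, h⟩ := Metric.eventually_nhds_iff.1 hev
  -- Positivity of the travel time excludes the empty set, whose infimum would be the default `0`.
  have hne : {s : ℝ | 0 < s ∧ x - s • v ∉ Ω}.Nonempty := by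
    by_contra hc'
    rw [not_nonempty_iff_eq_empty] at hc'
    rw [travelTime, hc', Real.sInf_empty] at hτ
    exact lt_irrefl _ hτ
  obtain ⟨s, hs, hsl⟩ := exists_lt_of_csInf_lt hne
    (show sInf {s : ℝ | 0 < s ∧ x - s • v ∉ Ω} < travelTime Ω x v + ε from lt_add_of_pos_right _ hε)
  have hle : travelTime Ω x v ≤ s := csInf_le ⟨0, fun _ h => h.1.le⟩ hs
  refine hs.2 (h ?_)
  rw [Real.dist_eq, abs_of_nonneg (by linarith)]
  linarith

theorem exitPoint_add_smul_mem {t : ℝ} (ht : 0 < t) (htτ : t < travelTime Ω x v) :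
    exitPoint Ω v x + t • v ∈ Ω := by
  have h := mem_of_lt_travelTime (Ω := Ω) (x := x) (v := v) (s := travelTime Ω x v - t)
    (by linarith) (by linarith)
  convert h using 1
  rw [exitPoint, sub_smul]
  abel

theorem eventually_exitPoint_add_smul_mem (hτ : 0 < travelTime Ω x v) :
    ∀ᶠ t in 𝓝[>] (0 : ℝ), exitPoint Ω v x + t • v ∈ Ω := by
  filter_upwards [Ioo_mem_nhdsGT hτ] with t ht
  exact exitPoint_add_smul_mem ht.1 ht.2

include hΩ in
theorem exitPoint_mem_frontier (hτ : 0 < travelTime Ω x v) : exitPoint Ω v x ∈ frontier Ω := by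
  rw [hΩ.frontier_eq]
  refine ⟨?_, exitPoint_notMem hΩ hτ⟩
  have hcont : Continuous fun t : ℝ => exitPoint Ω v x + t • v := by fun_prop
  have ht := hcont.tendsto 0
  simp only [zero_smul, add_zero] at ht
  exact mem_closure_of_tendsto (ht.mono_left nhdsWithin_le_nhds)
    (eventually_exitPoint_add_smul_mem hτ)

theorem inner_normal_exitPoint_nonpos (hτ : 0 < travelTime Ω x v)
    (hn : IsOutwardNormal Ω (exitPoint Ω v x) n) : inner ℝ v n ≤ 0 := by
  by_contra hc
  obtain ⟨t, h1, h2⟩ := ((eventually_exitPoint_add_smul_mem hτ).and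
    ((hn.2 v).2 (not_le.1 hc))).exists
  exact h2 h1

/-- Both points lie on the forward ray from the common exit point. If `x'` were farther away, `x`
would be interior to the chord of `x'`, hence in `Ω`. -/
theorem travelTime_le_of_exitPoint_eq {x' : Space d} (hx : x ∉ Ω) (hτ : 0 < travelTime Ω x v)
    (he : exitPoint Ω v x = exitPoint Ω v x') : travelTime Ω x' v ≤ travelTime Ω x v := by
  by_contra hc
  refine hx ?_
  have := exitPoint_add_smul_mem hτ (not_le.1 hc)
  rwa [← he, exitPoint, sub_add_cancel] at this

/-- Backward trajectories issued from different boundary points leave at different points. -/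
theorem eq_of_exitPoint_eq {x' : Space d} (hx : x ∉ Ω) (hx' : x' ∉ Ω)
    (hτ : 0 < travelTime Ω x v) (hτ' : 0 < travelTime Ω x' v)
    (he : exitPoint Ω v x = exitPoint Ω v x') : x = x' := by
  have h := le_antisymm (travelTime_le_of_exitPoint_eq hx' hτ' he.symm)
    (travelTime_le_of_exitPoint_eq hx hτ he)
  rw [exitPoint, exitPoint, h] at he
  exact sub_left_injective he

end Travel

/-! ### Orthogonal projections onto hyperplanes -/

open scoped Pointwise

/-- Linear coordinates on the hyperplane orthogonal to a unit vector `e`. -/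
structure IsHyperplaneChart (e : Space d) (J : Space (d - 1) →ₗᵢ[ℝ] Space d)
    (Q : Space d →L[ℝ] Space (d - 1)) : Prop where
  inner_eq : ∀ x z, inner ℝ (Q x) z = inner ℝ x (J z)
  left_inv : ∀ z, Q (J z) = z
  proj : ∀ x, J (Q x) = x - inner ℝ e x • e
  orth : ∀ z, inner ℝ e (J z) = 0

theorem exists_isHyperplaneChart {e : Space d} (he : ‖e‖ = 1) :
    ∃ J Q, IsHyperplaneChart e J Q := by
  have he0 : e ≠ 0 := by rintro rfl; simp at he
  have hd : 1 ≤ d := by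
    rcases Nat.eq_zero_or_pos d with rfl | h
    · exact absurd (Subsingleton.elim e 0) he0
    · exact h
  have : Fact (Module.finrank ℝ (Space d) = (d - 1) + 1) := ⟨by simp; omega⟩
  let b := OrthonormalBasis.fromOrthogonalSpanSingleton (𝕜 := ℝ) (d - 1) he0
  let J : Space (d - 1) →ₗᵢ[ℝ] Space d :=
    (Submodule.subtypeₗᵢ _).comp b.repr.symm.toLinearIsometry
  let Q := ContinuousLinearMap.adjoint J.toContinuousLinearMap
  have hin : ∀ x z, inner ℝ (Q x) z = inner ℝ x (J z) := fun x z =>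
    ContinuousLinearMap.adjoint_inner_left _ _ _
  have hor : ∀ z, inner ℝ e (J z) = 0 := fun z =>
    Submodule.mem_orthogonal_singleton_iff_inner_right.1 (b.repr.symm z).2
  have hli : ∀ z, Q (J z) = z := fun z => ext_inner_right ℝ fun w => by
    rw [hin, J.inner_map_map]
  refine ⟨J, Q, hin, hli, fun x => ?_, hor⟩
  have hQe : Q e = 0 := ext_inner_right ℝ fun w => by rw [hin, hor, inner_zero_left]
  have hmem : x - inner ℝ e x • e ∈ (Submodule.span ℝ {e})ᗮ := by
    rw [Submodule.mem_orthogonal_singleton_iff_inner_right, inner_sub_right, inner_smul_right,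
      real_inner_self_eq_norm_sq, he]
    ring
  have hJ : J (b.repr ⟨_, hmem⟩) = x - inner ℝ e x • e := by
    simp [J]
  have hQ : Q x = b.repr ⟨_, hmem⟩ := by
    have h1 := hli (b.repr ⟨_, hmem⟩)
    rw [hJ, map_sub, map_smul, hQe, smul_zero, sub_zero] at h1
    exact h1
  rw [hQ, hJ]

/-- For `L = Qe ∘ Jn`, the product `L* L` is the identity minus the rank one operator built on `Qn
e`. Its determinant is `1 - ‖Qn e‖²`, which equals `⟨e, n⟩²` by Pythagoras. -/
theorem IsHyperplaneChart.abs_det {e n : Space d} (he : ‖e‖ = 1)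
    {Je Jn : Space (d - 1) →ₗᵢ[ℝ] Space d} {Qe Qn : Space d →L[ℝ] Space (d - 1)}
    (hE : IsHyperplaneChart e Je Qe) (hN : IsHyperplaneChart n Jn Qn) :
    |(Qe ∘L Jn.toContinuousLinearMap).det| = |inner ℝ e n| := by
  set L := (Qe ∘L Jn.toContinuousLinearMap : Space (d - 1) →L[ℝ] Space (d - 1)) with hL
  have h1 : ((L : Space (d - 1) →ₗ[ℝ] Space (d - 1)).normDet) = |L.det| :=
    LinearMap.normDet_eq_abs_det _
  have h2 := LinearMap.normDet_sq (𝕜 := ℝ) (L : Space (d - 1) →ₗ[ℝ] Space (d - 1))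
  have h3 : (LinearMap.adjoint (L : Space (d - 1) →ₗ[ℝ] Space (d - 1))) ∘ₗ
      (L : Space (d - 1) →ₗ[ℝ] Space (d - 1)) =
      LinearMap.transvection (innerSL ℝ (-(Qn e))).toLinearMap (Qn e) := by
    refine LinearMap.ext fun z => ext_inner_right ℝ fun w => ?_
    simp only [LinearMap.comp_apply, LinearMap.adjoint_inner_left, LinearMap.transvection.apply,
      ContinuousLinearMap.coe_coe, innerSL_apply_apply, inner_add_left, inner_smul_left, hL,
      ContinuousLinearMap.comp_apply, LinearIsometry.coe_toContinuousLinearMap, hE.inner_eq,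
      hE.proj, inner_sub_right, inner_smul_right, Jn.inner_map_map, inner_neg_left, hN.inner_eq]
    simp only [map_neg, conj_trivial, neg_mul]
    rw [real_inner_comm e (Jn z)]
    ring
  have h4 : ‖Qn e‖ ^ 2 = 1 - inner ℝ e n ^ 2 := by
    rw [← real_inner_self_eq_norm_sq, hN.inner_eq, hN.proj, inner_sub_right, inner_smul_right,
      real_inner_self_eq_norm_sq, he, real_inner_comm]
    ring
  rw [h3, LinearMap.transvection.det, h1] at h2
  have h5 : |L.det| ^ 2 = |inner ℝ e n| ^ 2 := by
    rw [sq_abs (inner ℝ e n)]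
    have : (1 : ℝ) + (innerSL ℝ (-(Qn e))) (Qn e) = inner ℝ e n ^ 2 := by
      rw [innerSL_apply_apply, inner_neg_left, real_inner_self_eq_norm_sq, h4]; ring
    rw [← this]
    exact h2
  exact (pow_left_inj₀ (abs_nonneg _) (abs_nonneg _) two_ne_zero).1 h5

theorem LipschitzOnWith.euclideanHausdorffMeasure_image_le {X Y : Type*} [MetricSpace X]
    [MetricSpace Y] [MeasurableSpace X] [BorelSpace X] [MeasurableSpace Y] [BorelSpace Y]
    {K : ℝ≥0} {f : X → Y} {s : Set X} (h : LipschitzOnWith K f s) (n : ℕ) :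
    Measure.euclideanHausdorffMeasure n (f '' s) ≤
      (K : ℝ≥0∞) ^ n * Measure.euclideanHausdorffMeasure n s := by
  have := h.hausdorffMeasure_image_le (d := n) (Nat.cast_nonneg n)
  rw [ENNReal.rpow_natCast] at this
  simp only [Measure.euclideanHausdorffMeasure_def, Measure.smul_apply, ENNReal.smul_def, smul_eq_mul]
  rw [mul_left_comm]
  gcongr

/-! ### Local area formula for projections of the boundary -/

section Area

variable {Ω : Set (Space d)} {α : ℝ}

/-- Near a boundary point, the projection along `e` multiplies surface measure by approximately
`|n · e|`. -/
theorem HasHolderBoundary.local_projection (h : HasHolderBoundary Ω α) (hΩ : IsOpen Ω)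
    {x₀ : Space d} (hx₀ : x₀ ∈ frontier Ω) {e : Space d} (he : ‖e‖ = 1)
    {J : Space (d - 1) →ₗᵢ[ℝ] Space d} {Q : Space d →L[ℝ] Space (d - 1)}
    (hQ : IsHyperplaneChart e J Q) {ε : ℝ} (hε : 0 < ε) :
    ∃ r : ℝ, 0 < r ∧
      (inner ℝ e (normal Ω x₀) ≠ 0 → InjOn Q (Metric.ball x₀ r ∩ frontier Ω)) ∧
      Measure.euclideanHausdorffMeasure (d - 1) (Metric.ball x₀ r ∩ frontier Ω) < ∞ ∧
      ∀ A ⊆ Metric.ball x₀ r ∩ frontier Ω,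
        volume (Q '' A) ≤ ENNReal.ofReal (|inner ℝ e (normal Ω x₀)| + ε) *
          Measure.euclideanHausdorffMeasure (d - 1) A ∧
        ENNReal.ofReal (|inner ℝ e (normal Ω x₀)| - ε) *
          Measure.euclideanHausdorffMeasure (d - 1) A ≤ volume (Q '' A) := by
  set n := normal Ω x₀ with hn_def
  have hn : ‖n‖ = 1 := h.norm_normal hΩ hx₀
  set c := |inner ℝ e n| with hc
  obtain ⟨Jn, Qn, hN⟩ := exists_isHyperplaneChart hn
  set L := (Q ∘L Jn.toContinuousLinearMap : Space (d - 1) →L[ℝ] Space (d - 1)) with hL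
  have hdet : |L.det| = c := hQ.abs_det he hN
  -- choice of the approximation constants
  obtain ⟨δ₁, ⟨hup, hlow⟩, hδ₁⟩ : ∃ δ₁ : ℝ≥0,
      ((∀ (s : Set (Space (d - 1))) (f : Space (d - 1) → Space (d - 1)),
        ApproximatesLinearOn f L s δ₁ →
          volume (f '' s) ≤ ENNReal.ofReal (c + ε) * volume s) ∧
      (∀ (s : Set (Space (d - 1))) (f : Space (d - 1) → Space (d - 1)),
        ApproximatesLinearOn f L s δ₁ →
          ENNReal.ofReal (c - ε / 2) * volume s ≤ volume (f '' s))) ∧ 0 < δ₁ := by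
    have h1 := addHaar_image_le_mul_of_det_lt (volume : Measure (Space (d - 1))) L
      (m := (c + ε).toNNReal) (by
        rw [hdet]
        exact (ENNReal.ofReal_lt_ofReal_iff (by positivity)).2 (by linarith))
    have h2 : ∀ᶠ δ in 𝓝[>] (0 : ℝ≥0), ∀ (s : Set (Space (d - 1)))
        (f : Space (d - 1) → Space (d - 1)), ApproximatesLinearOn f L s δ →
          ENNReal.ofReal (c - ε / 2) * volume s ≤ volume (f '' s) := by
      rcases le_or_gt c (ε / 2) with hcε | hcε
      · refine Eventually.of_forall fun δ s f _ => ?_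
        rw [ENNReal.ofReal_of_nonpos (by linarith), zero_mul]
        exact zero_le
      · exact mul_le_addHaar_image_of_lt_det (volume : Measure (Space (d - 1))) L
          (m := (c - ε / 2).toNNReal) (by
            rw [hdet]
            exact (ENNReal.ofReal_lt_ofReal_iff (by linarith)).2 (by linarith))
    exact ((h1.and h2).and self_mem_nhdsWithin).exists
  -- The flatness `δ` has to serve four purposes: a bi-Lipschitz tangential projection, linear
  -- approximation with constant `2δ ≤ δ₁`, injectivity of `Q` when `c > 0`, and a loss `(1 - δ) ^
  -- (d - 1)` small enough to be absorbed in passing from `ε/2` to `ε`.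
  obtain ⟨δ, hδ, hδhalf, hδ1, hδc, hδε⟩ : ∃ δ : ℝ, 0 < δ ∧ δ ≤ 1 / 2 ∧ 2 * δ ≤ δ₁ ∧
      (0 < c → δ < c) ∧ c - ε ≤ (c - ε / 2) * (1 - δ) ^ (d - 1) := by
    have t1 : ∀ᶠ δ : ℝ in 𝓝 0, δ ≤ 1 / 2 := Iic_mem_nhds (by norm_num)
    have t2 : ∀ᶠ δ : ℝ in 𝓝 0, 2 * δ ≤ δ₁ := by
      have : Tendsto (fun δ : ℝ => 2 * δ) (𝓝 0) (𝓝 0) := by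
        simpa using (continuous_const_mul (2 : ℝ)).tendsto 0
      exact this.eventually (Iic_mem_nhds (by exact_mod_cast hδ₁))
    have t3 : ∀ᶠ δ : ℝ in 𝓝 0, (0 < c → δ < c) := by
      by_cases h0 : 0 < c
      · filter_upwards [Iio_mem_nhds h0] with δ hδ _ using hδ
      · exact Eventually.of_forall fun δ hh => absurd hh h0
    have t4 : ∀ᶠ δ : ℝ in 𝓝 0, c - ε ≤ (c - ε / 2) * (1 - δ) ^ (d - 1) := by
      have hcont : Continuous fun δ : ℝ => (c - ε / 2) * (1 - δ) ^ (d - 1) := by fun_prop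
      have := hcont.tendsto 0
      simp only [sub_zero, one_pow, mul_one] at this
      exact this.eventually (Ici_mem_nhds (by linarith))
    have := ((((t1.and t2).and t3).and t4).filter_mono nhdsWithin_le_nhds).and
      (self_mem_nhdsWithin : Ioi (0 : ℝ) ∈ 𝓝[>] 0)
    obtain ⟨δ, ⟨⟨⟨⟨a, b⟩, c'⟩, d'⟩, e'⟩⟩ := this.exists
    exact ⟨δ, e', a, b, c', d'⟩
  obtain ⟨r, hr, hflat⟩ := h.flat hΩ hx₀ hδ
  set W := Metric.ball x₀ r ∩ frontier Ω with hW
  -- the projection to the tangent plane is bi-Lipschitz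
  have hanti : ∀ x ∈ W, ∀ y ∈ W, (1 - δ) * ‖x - y‖ ≤ ‖Qn x - Qn y‖ := by
    intro x hx y hy
    have h1 : x - y = Jn (Qn x - Qn y) + inner ℝ n (x - y) • n := by
      rw [← map_sub Qn, hN.proj]; abel
    have h2 : ‖x - y‖ ≤ ‖Qn x - Qn y‖ + δ * ‖x - y‖ := by
      calc ‖x - y‖ = ‖Jn (Qn x - Qn y) + inner ℝ n (x - y) • n‖ := by rw [← h1]
        _ ≤ ‖Jn (Qn x - Qn y)‖ + ‖inner ℝ n (x - y) • n‖ := norm_add_le _ _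
        _ ≤ _ := by
          rw [Jn.norm_map, norm_smul, hn, mul_one, Real.norm_eq_abs, real_inner_comm]
          gcongr
          exact hflat x hx y hy
    linarith
  have hcontr : ∀ x y : Space d, ‖Qn x - Qn y‖ ≤ ‖x - y‖ := by
    intro x y
    rw [← map_sub Qn]
    have h1 : ‖Qn (x - y)‖ ^ 2 ≤ ‖Qn (x - y)‖ * ‖x - y‖ := by
      rw [← real_inner_self_eq_norm_sq, hN.inner_eq]
      calc inner ℝ (x - y) (Jn (Qn (x - y))) ≤ ‖x - y‖ * ‖Jn (Qn (x - y))‖ :=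
            real_inner_le_norm _ _
        _ = _ := by rw [Jn.norm_map, mul_comm]
    by_contra hlt
    push Not at hlt
    have := norm_nonneg (x - y)
    nlinarith
  have hinjN : InjOn Qn W := by
    intro x hx y hy hxy
    have := hanti x hx y hy
    rw [hxy, sub_self, norm_zero] at this
    have h0 : ‖x - y‖ ≤ 0 := by nlinarith [norm_nonneg (x - y)]
    exact sub_eq_zero.1 (norm_le_zero_iff.1 h0)
  have hmeas : ∀ A ⊆ W, volume (Qn '' A) ≤ Measure.euclideanHausdorffMeasure (d - 1) A ∧
      Measure.euclideanHausdorffMeasure (d - 1) A ≤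
        ENNReal.ofReal (((1 - δ)⁻¹) ^ (d - 1)) * volume (Qn '' A) := by
    intro A hA
    constructor
    · have hl : LipschitzOnWith 1 Qn A := LipschitzOnWith.of_dist_le_mul fun x _ y _ => by
        rw [dist_eq_norm, dist_eq_norm, NNReal.coe_one, one_mul]; exact hcontr x y
      have := LipschitzOnWith.euclideanHausdorffMeasure_image_le hl (d - 1)
      rwa [ENNReal.coe_one, one_pow, one_mul,
        EuclideanSpace.euclideanHausdorffMeasure_eq_volume] at this
    · have hg := (hinjN.mono hA).leftInvOn_invFunOn
      have hl : LipschitzOnWith ((1 - δ)⁻¹).toNNReal (Function.invFunOn Qn A) (Qn '' A) := by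
        refine LipschitzOnWith.of_dist_le_mul ?_
        rintro _ ⟨x, hx, rfl⟩ _ ⟨y, hy, rfl⟩
        rw [hg hx, hg hy, dist_eq_norm, dist_eq_norm,
          Real.coe_toNNReal _ (inv_nonneg.2 (by linarith)), inv_mul_eq_div, le_div_iff₀ (by linarith),
          mul_comm]
        exact hanti x (hA hx) y (hA hy)
      have := LipschitzOnWith.euclideanHausdorffMeasure_image_le hl (d - 1)
      rw [hg.image_image, EuclideanSpace.euclideanHausdorffMeasure_eq_volume] at this
      refine this.trans (le_of_eq ?_)
      rw [ENNReal.ofReal_pow (inv_nonneg.2 (by linarith))]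
      rfl
  refine ⟨r, hr, fun hne x hx y hy hxy => ?_, ?_, fun A hA => ?_⟩
  · have hcpos : 0 < c := abs_pos.2 hne
    -- Two points with the same projection differ by a multiple of `e`; unless they coincide,
    -- flatness would force `c ≤ δ`.
    have h1 : x - y = inner ℝ e (x - y) • e := by
      have := hQ.proj (x - y)
      rw [map_sub, hxy, sub_self, map_zero] at this
      exact (sub_eq_zero.1 this.symm)
    have h2 := hflat x hx y hy
    have h3 : |inner ℝ (x - y) n| = ‖x - y‖ * c := by
      rw [h1, inner_smul_left, abs_mul, norm_smul, he, mul_one, hc]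
      simp
    rw [h3] at h2
    have h0 : ‖x - y‖ ≤ 0 := by nlinarith [norm_nonneg (x - y), hδc hcpos]
    exact sub_eq_zero.1 (norm_le_zero_iff.1 h0)
  · refine (hmeas W subset_rfl).2.trans_lt (ENNReal.mul_lt_top ENNReal.ofReal_lt_top ?_)
    have : Bornology.IsBounded (Qn '' W) :=
      (LipschitzWith.of_dist_le_mul (K := 1) (f := Qn) fun x y => by
        rw [dist_eq_norm, dist_eq_norm, NNReal.coe_one, one_mul]; exact hcontr x y).isBounded_image
        (Metric.isBounded_ball.subset inter_subset_left)
    exact this.measure_lt_top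
  · have hg := (hinjN.mono hA).leftInvOn_invFunOn
    -- In the tangential coordinate the projection along `e` deviates from `L` only by `⟨n, x - y⟩ •
    -- Q n`. This is at most `δ ‖x - y‖`, thus at most `2δ` times the tangential distance.
    have happ : ApproximatesLinearOn (Q ∘ Function.invFunOn Qn A) L (Qn '' A) δ₁ := by
      rintro _ ⟨x, hx, rfl⟩ _ ⟨y, hy, rfl⟩
      simp only [Function.comp_apply, hg hx, hg hy]
      have h1 : Q x - Q y - L (Qn x - Qn y) = inner ℝ n (x - y) • Q n := by
        rw [← map_sub Qn, hL, ContinuousLinearMap.comp_apply,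
          LinearIsometry.coe_toContinuousLinearMap, hN.proj, map_sub Q (x - y), map_smul, map_sub]
        abel
      have hQn : ‖Q n‖ ≤ 1 := by
        have h2 : ‖Q n‖ ^ 2 ≤ 1 := by
          rw [← real_inner_self_eq_norm_sq, hQ.inner_eq, hQ.proj, inner_sub_right,
            inner_smul_right, real_inner_self_eq_norm_sq, hn, real_inner_comm]
          nlinarith [sq_nonneg (inner ℝ n e)]
        nlinarith [norm_nonneg (Q n)]
      rw [h1, norm_smul, Real.norm_eq_abs, real_inner_comm]
      have h3 := hflat x (hA hx) y (hA hy)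
      have h4 := hanti x (hA hx) y (hA hy)
      have h5 : ‖x - y‖ ≤ 2 * ‖Qn x - Qn y‖ := by nlinarith [norm_nonneg (x - y)]
      calc |inner ℝ (x - y) n| * ‖Q n‖ ≤ (δ * ‖x - y‖) * 1 := by gcongr
        _ ≤ 2 * δ * ‖Qn x - Qn y‖ := by nlinarith
        _ ≤ _ := by gcongr
    have himg : (Q ∘ Function.invFunOn Qn A) '' (Qn '' A) = Q '' A := by
      rw [image_comp, hg.image_image]
    have hu := hup _ _ happ
    have hl := hlow _ _ happ
    rw [himg] at hu hl
    refine ⟨hu.trans (by gcongr; exact (hmeas A hA).1), ?_⟩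
    refine le_trans ?_ hl
    rcases le_or_gt c (ε / 2) with hcε | hcε
    · rw [ENNReal.ofReal_of_nonpos (by linarith), zero_mul]
      exact zero_le
    calc ENNReal.ofReal (c - ε) * Measure.euclideanHausdorffMeasure (d - 1) A
        ≤ ENNReal.ofReal ((c - ε / 2) * (1 - δ) ^ (d - 1)) *
          (ENNReal.ofReal (((1 - δ)⁻¹) ^ (d - 1)) * volume (Qn '' A)) := by
          gcongr
          exact (hmeas A hA).2
      _ = ENNReal.ofReal (c - ε / 2) * volume (Qn '' A) := by
        rw [← mul_assoc, ← ENNReal.ofReal_mul (mul_nonneg (by linarith)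
          (pow_nonneg (by linarith) _)), mul_assoc, ← mul_pow, mul_inv_cancel₀ (by linarith),
          one_pow, mul_one]

end Area

/-! ### Flux through the boundary and its transport along straight lines -/

section Transport

/-- Passes from local to global: by Lindelöf countably many of the balls cover `S`, and making them
disjoint preserves `P` because `P` is hereditary. -/
theorem exists_disjoint_cover {F S : Set (Space d)} (hF : MeasurableSet F) (hS : S ⊆ F)
    {P : Set (Space d) → Prop} (hP0 : P ∅) (hP : ∀ A B, A ⊆ B → P B → P A)
    (hloc : ∀ x ∈ S, ∃ r : ℝ, 0 < r ∧ P (Metric.ball x r ∩ F)) :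
    ∃ W : ℕ → Set (Space d), (∀ i, MeasurableSet (W i)) ∧ Pairwise (fun i j => Disjoint (W i) (W j))
      ∧ (∀ i, W i ⊆ F) ∧ (∀ i, P (W i)) ∧ S ⊆ ⋃ i, W i := by
  choose! r hr hrP using hloc
  obtain ⟨t, hts, htc, hcov⟩ := TopologicalSpace.countable_cover_nhdsWithin
    (s := S) (f := fun x => Metric.ball x (r x))
    (fun x hx => mem_nhdsWithin_of_mem_nhds (Metric.ball_mem_nhds x (hr x hx)))
  rcases t.eq_empty_or_nonempty with rfl | hne
  · refine ⟨fun _ => ∅, fun _ => .empty, fun _ _ _ => disjoint_bot_left, fun _ => empty_subset _,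
      fun _ => hP0, ?_⟩
    simpa using hcov
  obtain ⟨g, rfl⟩ := htc.exists_eq_range hne
  set V : ℕ → Set (Space d) := fun i => Metric.ball (g i) (r (g i)) ∩ F with hV
  have hsub : ∀ i, disjointed V i ⊆ V i := fun i => disjointed_subset V i
  refine ⟨disjointed V, fun i => .disjointed (fun j => measurableSet_ball.inter hF) i,
    disjoint_disjointed V, fun i => (hsub i).trans inter_subset_right,
    fun i => hP _ _ (hsub i) (hrP _ (hts (mem_range_self i))), ?_⟩
  rw [iUnion_disjointed]
  intro x hx
  obtain ⟨y, hy, hxy⟩ := mem_iUnion₂.1 (hcov hx)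
  obtain ⟨i, rfl⟩ := hy
  exact mem_iUnion.2 ⟨i, hxy, hS hx⟩

variable {Ω : Set (Space d)} {α : ℝ}

theorem surfaceMeasure_apply {A : Set (Space d)} (hA : A ⊆ frontier Ω) :
    surfaceMeasure Ω A = Measure.euclideanHausdorffMeasure (d - 1) A :=
  Measure.restrict_eq_self _ hA

theorem isCompact_frontier (hb : Bornology.IsBounded Ω) : IsCompact (frontier Ω) :=
  Metric.isCompact_of_isClosed_isBounded isClosed_frontier
    (hb.closure.subset frontier_subset_closure)

theorem HasHolderBoundary.isFiniteMeasure (h : HasHolderBoundary Ω α) (hΩ : IsOpen Ω)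
    (hb : Bornology.IsBounded Ω) : IsFiniteMeasure (surfaceMeasure Ω) := by
  constructor
  rw [surfaceMeasure, Measure.restrict_apply_univ]
  refine (isCompact_frontier hb).measure_lt_top_of_nhdsWithin fun x hx => ?_
  obtain ⟨J, Q, hQ⟩ := exists_isHyperplaneChart (h.norm_normal hΩ hx)
  obtain ⟨r, hr, -, hfin, -⟩ := h.local_projection hΩ hx (h.norm_normal hΩ hx) hQ one_pos
  exact ⟨_, inter_comm _ _ ▸ inter_mem_nhdsWithin _ (Metric.ball_mem_nhds x hr), hfin⟩

/-- The flux `|v · n(x)| π(dx)` through the boundary, at fixed velocity. -/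
def fluxAt (Ω : Set (Space d)) (v : Space d) : Measure (Space d) :=
  (surfaceMeasure Ω).withDensity fun x => ENNReal.ofReal |inner ℝ v (normal Ω x)|

theorem HasHolderBoundary.measurable_flux (h : HasHolderBoundary Ω α) (hΩ : IsOpen Ω)
    (v : Space d) : Measurable fun x => ENNReal.ofReal |inner ℝ v (normal Ω x)| := by
  have := h.measurable_normal hΩ
  fun_prop

/-- By continuity of the normal, the constant `|e·n(x₀)|` of the local area formula can be replaced
by the variable density of the flux. The error is a multiple of surface measure; being additive, it
survives summation over a countable partition and disappears as `ε → 0`. -/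
theorem HasHolderBoundary.local_flux (h : HasHolderBoundary Ω α) (hΩ : IsOpen Ω)
    {x₀ : Space d} (hx₀ : x₀ ∈ frontier Ω) {e : Space d} (he : ‖e‖ = 1)
    {J : Space (d - 1) →ₗᵢ[ℝ] Space d} {Q : Space d →L[ℝ] Space (d - 1)}
    (hQ : IsHyperplaneChart e J Q) {ε : ℝ} (hε : 0 < ε) :
    ∃ r : ℝ, 0 < r ∧ ∀ A ⊆ Metric.ball x₀ r ∩ frontier Ω, MeasurableSet A →
        volume (Q '' A) ≤ fluxAt Ω e A + ENNReal.ofReal ε * surfaceMeasure Ω A ∧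
        fluxAt Ω e A ≤ volume (Q '' A) + ENNReal.ofReal ε * surfaceMeasure Ω A := by
  obtain ⟨r, hr, -, -, hA⟩ := h.local_projection hΩ hx₀ he hQ (half_pos hε)
  have hcont : ContinuousWithinAt (fun x => |inner ℝ e (normal Ω x)|) (frontier Ω) x₀ :=
    (ContinuousWithinAt.inner (𝕜 := ℝ) continuousWithinAt_const (h.continuousOn_normal hΩ x₀ hx₀)).abs
  set c := |inner ℝ e (normal Ω x₀)| with hc
  have hev := hcont.eventually (Metric.ball_mem_nhds c (half_pos hε))
  obtain ⟨s, hs, hball⟩ := Metric.mem_nhdsWithin_iff.1 hev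
  refine ⟨min r s, lt_min hr hs, fun A hAsub hAm => ?_⟩
  have hAf : A ⊆ frontier Ω := hAsub.trans inter_subset_right
  obtain ⟨h1, h2⟩ := hA A (hAsub.trans (inter_subset_inter_left _
    (Metric.ball_subset_ball (min_le_left r s))))
  rw [← surfaceMeasure_apply hAf] at h1 h2
  have hb : ∀ x ∈ A, |(|inner ℝ e (normal Ω x)| - c)| < ε / 2 := fun x hx => by
    have := hball ⟨Metric.ball_subset_ball (min_le_right r s) (hAsub hx).1, hAf hx⟩
    exact this
  have hflux : fluxAt Ω e A = ∫⁻ x in A, ENNReal.ofReal |inner ℝ e (normal Ω x)| ∂surfaceMeasure Ω :=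
    withDensity_apply _ hAm
  have hlow : ENNReal.ofReal (c - ε / 2) * surfaceMeasure Ω A ≤ fluxAt Ω e A := by
    rw [hflux, ← setLIntegral_const]
    refine setLIntegral_mono' hAm fun x hx => ENNReal.ofReal_le_ofReal ?_
    linarith [(abs_lt.1 (hb x hx)).1]
  have hupp : fluxAt Ω e A ≤ ENNReal.ofReal (c + ε / 2) * surfaceMeasure Ω A := by
    rw [hflux, ← setLIntegral_const]
    refine setLIntegral_mono' hAm fun x hx => ENNReal.ofReal_le_ofReal ?_
    linarith [(abs_lt.1 (hb x hx)).2]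
  have hsplit : ENNReal.ofReal (c + ε / 2) ≤ ENNReal.ofReal (c - ε / 2) + ENNReal.ofReal ε := by
    refine le_trans (ENNReal.ofReal_le_ofReal (by linarith)) ENNReal.ofReal_add_le
  constructor
  · calc volume (Q '' A) ≤ ENNReal.ofReal (c + ε / 2) * surfaceMeasure Ω A := h1
      _ ≤ (ENNReal.ofReal (c - ε / 2) + ENNReal.ofReal ε) * surfaceMeasure Ω A := by gcongr
      _ ≤ _ := by rw [add_mul]; gcongr
  · calc fluxAt Ω e A ≤ ENNReal.ofReal (c + ε / 2) * surfaceMeasure Ω A := hupp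
      _ ≤ (ENNReal.ofReal (c - ε / 2) + ENNReal.ofReal ε) * surfaceMeasure Ω A := by gcongr
      _ ≤ _ := by rw [add_mul]; gcongr

theorem le_of_forall_pos_le_add_mul {a b c : ℝ≥0∞} (hc : c ≠ ∞)
    (h : ∀ ε : ℝ, 0 < ε → a ≤ b + ENNReal.ofReal ε * c) : a ≤ b := by
  have ht : Tendsto (fun ε : ℝ => b + ENNReal.ofReal ε * c) (𝓝[>] 0) (𝓝 (b + 0 * c)) := by
    refine Tendsto.const_add _ (ENNReal.Tendsto.mul_const ?_ (Or.inr hc))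
    have := ENNReal.continuous_ofReal.tendsto 0
    rw [ENNReal.ofReal_zero] at this
    exact this.mono_left nhdsWithin_le_nhds
  rw [zero_mul, add_zero] at ht
  exact ge_of_tendsto ht (by filter_upwards [self_mem_nhdsWithin] with ε hε using h ε hε)

/-- The projection of a piece of the boundary has measure at most its flux. -/
theorem HasHolderBoundary.volume_image_le (h : HasHolderBoundary Ω α) (hΩ : IsOpen Ω)
    (hb : Bornology.IsBounded Ω) {e : Space d} (he : ‖e‖ = 1)
    {J : Space (d - 1) →ₗᵢ[ℝ] Space d} {Q : Space d →L[ℝ] Space (d - 1)}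
    (hQ : IsHyperplaneChart e J Q) {A : Set (Space d)} (hA : MeasurableSet A)
    (hAf : A ⊆ frontier Ω) : volume (Q '' A) ≤ fluxAt Ω e A := by
  have := h.isFiniteMeasure hΩ hb
  refine le_of_forall_pos_le_add_mul (measure_ne_top (surfaceMeasure Ω) A) fun ε hε => ?_
  obtain ⟨W, hWm, hWd, hWf, hWP, hcov⟩ := exists_disjoint_cover (F := frontier Ω) (S := frontier Ω)
    (P := fun V => ∀ A ⊆ V, MeasurableSet A →
        volume (Q '' A) ≤ fluxAt Ω e A + ENNReal.ofReal ε * surfaceMeasure Ω A)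
    isClosed_frontier.measurableSet subset_rfl
    (fun A hA _ => by rw [subset_empty_iff.1 hA]; simp)
    (fun A B hAB hB C hC => hB C (hC.trans hAB))
    (fun x hx => by
      obtain ⟨r, hr, hr'⟩ := h.local_flux hΩ hx he hQ hε
      exact ⟨r, hr, fun A hA hAm => (hr' A hA hAm).1⟩)
  have hAeq : A = ⋃ i, A ∩ W i := by
    rw [← inter_iUnion, inter_eq_left.2 (hAf.trans hcov)]
  have hdis : Pairwise (Function.onFun Disjoint fun i => A ∩ W i) := fun i j hij =>
    (hWd hij).mono inter_subset_right inter_subset_right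
  have hm : ∀ i, MeasurableSet (A ∩ W i) := fun i => hA.inter (hWm i)
  calc volume (Q '' A) = volume (⋃ i, Q '' (A ∩ W i)) := by rw [← image_iUnion, ← hAeq]
    _ ≤ ∑' i, volume (Q '' (A ∩ W i)) := measure_iUnion_le _
    _ ≤ ∑' i, (fluxAt Ω e (A ∩ W i) + ENNReal.ofReal ε * surfaceMeasure Ω (A ∩ W i)) :=
      ENNReal.tsum_le_tsum fun i => hWP i _ inter_subset_right (hm i)
    _ = fluxAt Ω e A + ENNReal.ofReal ε * surfaceMeasure Ω A := by
      rw [ENNReal.tsum_add, ENNReal.tsum_mul_left, ← measure_iUnion hdis hm,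
        ← measure_iUnion hdis hm, ← hAeq]

/-- The flux of a piece of the boundary on which the projection is injective is at most the
measure of its projection. -/
theorem HasHolderBoundary.fluxAt_le (h : HasHolderBoundary Ω α) (hΩ : IsOpen Ω)
    (hb : Bornology.IsBounded Ω) {e : Space d} (he : ‖e‖ = 1)
    {J : Space (d - 1) →ₗᵢ[ℝ] Space d} {Q : Space d →L[ℝ] Space (d - 1)}
    (hQ : IsHyperplaneChart e J Q) {A : Set (Space d)} (hA : MeasurableSet A)
    (hAf : A ⊆ frontier Ω) (hinj : InjOn Q A) : fluxAt Ω e A ≤ volume (Q '' A) := by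
  have := h.isFiniteMeasure hΩ hb
  refine le_of_forall_pos_le_add_mul (measure_ne_top (surfaceMeasure Ω) A) fun ε hε => ?_
  obtain ⟨W, hWm, hWd, hWf, hWP, hcov⟩ := exists_disjoint_cover (F := frontier Ω) (S := frontier Ω)
    (P := fun V => ∀ A ⊆ V, MeasurableSet A →
        fluxAt Ω e A ≤ volume (Q '' A) + ENNReal.ofReal ε * surfaceMeasure Ω A)
    isClosed_frontier.measurableSet subset_rfl
    (fun A hA _ => by rw [subset_empty_iff.1 hA]; simp)
    (fun A B hAB hB C hC => hB C (hC.trans hAB))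
    (fun x hx => by
      obtain ⟨r, hr, hr'⟩ := h.local_flux hΩ hx he hQ hε
      exact ⟨r, hr, fun A hA hAm => (hr' A hA hAm).2⟩)
  have hAeq : A = ⋃ i, A ∩ W i := by
    rw [← inter_iUnion, inter_eq_left.2 (hAf.trans hcov)]
  have hdis : Pairwise (Function.onFun Disjoint fun i => A ∩ W i) := fun i j hij =>
    (hWd hij).mono inter_subset_right inter_subset_right
  have hm : ∀ i, MeasurableSet (A ∩ W i) := fun i => hA.inter (hWm i)
  -- Injectivity of the projection is what makes the measures of the images add up.
  have hdis' : Pairwise (Function.onFun Disjoint fun i => Q '' (A ∩ W i)) := fun i j hij => by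
    have := hdis hij
    rw [Function.onFun, disjoint_iff_inter_eq_empty,
      ← hinj.image_inter inter_subset_left inter_subset_left, disjoint_iff_inter_eq_empty.1 this,
      image_empty]
  have hm' : ∀ i, MeasurableSet (Q '' (A ∩ W i)) := fun i =>
    (hm i).image_of_continuousOn_injOn Q.continuous.continuousOn (hinj.mono inter_subset_left)
  calc fluxAt Ω e A = ∑' i, fluxAt Ω e (A ∩ W i) := by rw [← measure_iUnion hdis hm, ← hAeq]
    _ ≤ ∑' i, (volume (Q '' (A ∩ W i)) + ENNReal.ofReal ε * surfaceMeasure Ω (A ∩ W i)) :=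
      ENNReal.tsum_le_tsum fun i => hWP i _ inter_subset_right (hm i)
    _ = volume (Q '' A) + ENNReal.ofReal ε * surfaceMeasure Ω A := by
      rw [ENNReal.tsum_add, ENNReal.tsum_mul_left, ← measure_iUnion hdis' hm',
        ← measure_iUnion hdis hm, ← hAeq, ← image_iUnion, ← hAeq]

/-- The boundary points from which the velocity `v` points outwards. -/
def outSide (Ω : Set (Space d)) (v : Space d) : Set (Space d) :=
  {x | x ∈ frontier Ω ∧ 0 < inner ℝ v (normal Ω x)}

/-- The boundary points from which the velocity `v` points inwards. -/
def inSide (Ω : Set (Space d)) (v : Space d) : Set (Space d) :=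
  {x | x ∈ frontier Ω ∧ inner ℝ v (normal Ω x) < 0}

theorem HasHolderBoundary.measurable_inner_normal (h : HasHolderBoundary Ω α) (hΩ : IsOpen Ω)
    (v : Space d) : Measurable fun x => inner ℝ v (normal Ω x) := by
  have := h.measurable_normal hΩ
  fun_prop

theorem HasHolderBoundary.measurableSet_outSide (h : HasHolderBoundary Ω α) (hΩ : IsOpen Ω)
    (v : Space d) : MeasurableSet (outSide Ω v) :=
  isClosed_frontier.measurableSet.inter
    (measurableSet_lt measurable_const (h.measurable_inner_normal hΩ v))

theorem HasHolderBoundary.measurableSet_inSide (h : HasHolderBoundary Ω α) (hΩ : IsOpen Ω)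
    (v : Space d) : MeasurableSet (inSide Ω v) :=
  isClosed_frontier.measurableSet.inter
    (measurableSet_lt (h.measurable_inner_normal hΩ v) measurable_const)

theorem HasHolderBoundary.exit_mem (h : HasHolderBoundary Ω α) (hΩ : IsOpen Ω)
    (hb : Bornology.IsBounded Ω) {v x : Space d} (hx : x ∈ outSide Ω v) :
    0 < travelTime Ω x v ∧ exitPoint Ω v x ∈ frontier Ω ∧
      inner ℝ v (normal Ω (exitPoint Ω v x)) ≤ 0 := by
  have hτ := travelTime_pos hb (h.isOutwardNormal hΩ hx.1) hx.2
  have hf := exitPoint_mem_frontier hΩ hτ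
  exact ⟨hτ, hf, inner_normal_exitPoint_nonpos hτ (h.isOutwardNormal hΩ hf)⟩

theorem IsHyperplaneChart.apply_exitPoint {e : Space d} (he : ‖e‖ = 1)
    {J : Space (d - 1) →ₗᵢ[ℝ] Space d} {Q : Space d →L[ℝ] Space (d - 1)}
    (hQ : IsHyperplaneChart e J Q) (x : Space d) : Q (exitPoint Ω e x) = Q x := by
  have hQe : Q e = 0 := by
    have := hQ.proj e
    rw [real_inner_self_eq_norm_sq, he, one_pow, one_smul, sub_self] at this
    exact J.injective (by rw [this, map_zero])
  rw [exitPoint, map_sub, map_smul, hQe, smul_zero, sub_zero]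

/-- A point and its exit point have the same projection orthogonally to `e`. Where the exit points
lie in a piece on which `Q` is injective, `Q` is also injective on the starting points, since
distinct boundary points have distinct exit points. There the outgoing flux is at most the measure
of the common shadow, itself at most the incoming flux. Starting points with a grazing exit point
carry no flux, because their shadow is negligible. -/
theorem HasHolderBoundary.transport_unit (h : HasHolderBoundary Ω α) (hΩ : IsOpen Ω)
    (hb : Bornology.IsBounded Ω) {e : Space d} (he : ‖e‖ = 1) {B : Set (Space d)}
    (hB : MeasurableSet B) :
    fluxAt Ω e (outSide Ω e ∩ exitPoint Ω e ⁻¹' B) ≤ fluxAt Ω e (inSide Ω e ∩ B) := by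
  obtain ⟨J, Q, hQ⟩ := exists_isHyperplaneChart he
  have hexit : Measurable (exitPoint Ω e) :=
    (measurable_exitPoint hΩ hb).comp (measurable_id.prodMk measurable_const)
  have hSo := h.measurableSet_outSide hΩ e
  have hSi := h.measurableSet_inSide hΩ e
  set S := {x | x ∈ frontier Ω ∧ inner ℝ e (normal Ω x) ≠ 0} with hS
  obtain ⟨W, hWm, hWd, hWf, hWP, hcov⟩ := exists_disjoint_cover (F := frontier Ω)
    (S := S) (P := fun V => InjOn Q V)
    isClosed_frontier.measurableSet (fun x hx => hx.1) (injOn_empty _)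
    (fun A B hAB hB => hB.mono hAB)
    (fun x hx => by
      obtain ⟨r, hr, hr', -⟩ := h.local_projection hΩ hx.1 he hQ one_pos
      exact ⟨r, hr, hr' hx.2⟩)
  have hcovo : outSide Ω e ⊆ ⋃ i, W i := fun x hx => hcov ⟨hx.1, hx.2.ne'⟩
  have hcovi : inSide Ω e ⊆ ⋃ i, W i := fun x hx => hcov ⟨hx.1, hx.2.ne⟩
  have hpiece : ∀ A : Set (Space d), MeasurableSet A → A ⊆ outSide Ω e →
      fluxAt Ω e A ≤ ∑' i, volume (Q '' (A ∩ W i)) := by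
    intro A hA hAo
    have hAeq : A = ⋃ i, A ∩ W i := by rw [← inter_iUnion, inter_eq_left.2 (hAo.trans hcovo)]
    calc fluxAt Ω e A = fluxAt Ω e (⋃ i, A ∩ W i) := by rw [← hAeq]
      _ ≤ ∑' i, fluxAt Ω e (A ∩ W i) := measure_iUnion_le _
      _ ≤ _ := ENNReal.tsum_le_tsum fun i => h.fluxAt_le hΩ hb he hQ (hA.inter (hWm i))
        (inter_subset_left.trans fun x hx => (hAo hx).1) ((hWP i).mono inter_subset_right)
  -- trajectories ending at non-grazing points
  have hreg : ∀ j, fluxAt Ω e (outSide Ω e ∩ exitPoint Ω e ⁻¹' (inSide Ω e ∩ B ∩ W j)) ≤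
      fluxAt Ω e (inSide Ω e ∩ B ∩ W j) := by
    intro j
    have hCm : MeasurableSet (inSide Ω e ∩ B ∩ W j) := (hSi.inter hB).inter (hWm j)
    set A := outSide Ω e ∩ exitPoint Ω e ⁻¹' (inSide Ω e ∩ B ∩ W j) with hA
    have hAm : MeasurableSet A := hSo.inter (hexit hCm)
    have hinjA : InjOn Q A := by
      intro x hx y hy hxy
      have hτ := fun z (hz : z ∈ A) => (h.exit_mem hΩ hb hz.1).1
      have hnm : ∀ z ∈ A, z ∉ Ω := fun z hz => by
        have := hz.1.1
        rw [hΩ.frontier_eq] at this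
        exact this.2
      refine eq_of_exitPoint_eq (hnm x hx) (hnm y hy) (hτ x hx) (hτ y hy) ?_
      refine hWP j hx.2.2 hy.2.2 ?_
      rw [hQ.apply_exitPoint he, hQ.apply_exitPoint he, hxy]
    calc fluxAt Ω e A ≤ volume (Q '' A) :=
          h.fluxAt_le hΩ hb he hQ hAm (fun x hx => hx.1.1) hinjA
      _ ≤ volume (Q '' (inSide Ω e ∩ B ∩ W j)) := by
          refine measure_mono ?_
          rintro _ ⟨x, hx, rfl⟩
          exact ⟨exitPoint Ω e x, hx.2, hQ.apply_exitPoint he x⟩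
      _ ≤ _ := h.volume_image_le hΩ hb he hQ hCm (fun x hx => hx.1.1.1)
  -- trajectories ending at grazing points
  set G := {x | x ∈ frontier Ω ∧ inner ℝ e (normal Ω x) = 0} with hG
  have hGm : MeasurableSet G := isClosed_frontier.measurableSet.inter
    (measurableSet_eq_fun (h.measurable_inner_normal hΩ e) measurable_const)
  -- A form of Sard's theorem: the flux dominates the measure of the shadow, and its density
  -- vanishes on `G`.
  have hQG : volume (Q '' G) = 0 := by
    refine le_antisymm ((h.volume_image_le hΩ hb he hQ hGm fun x hx => hx.1).trans ?_) zero_le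
    rw [fluxAt, withDensity_apply _ hGm, setLIntegral_congr_fun (g := fun _ => 0) hGm
      (fun x hx => by simp [hx.2])]
    simp
  have hgraz : fluxAt Ω e (outSide Ω e ∩ exitPoint Ω e ⁻¹' G) = 0 := by
    refine le_antisymm ((hpiece _ (hSo.inter (hexit hGm)) inter_subset_left).trans ?_) zero_le
    refine le_of_eq (ENNReal.tsum_eq_zero.2 fun i => measure_mono_null ?_ hQG)
    rintro _ ⟨x, hx, rfl⟩
    exact ⟨exitPoint Ω e x, hx.1.2, hQ.apply_exitPoint he x⟩
  have hsub : outSide Ω e ∩ exitPoint Ω e ⁻¹' B ⊆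
      (⋃ j, outSide Ω e ∩ exitPoint Ω e ⁻¹' (inSide Ω e ∩ B ∩ W j)) ∪
        (outSide Ω e ∩ exitPoint Ω e ⁻¹' G) := by
    rintro x ⟨hx, hxB⟩
    obtain ⟨-, hf, hle⟩ := h.exit_mem hΩ hb hx
    rcases hle.lt_or_eq with hlt | heq
    · obtain ⟨j, hj⟩ := mem_iUnion.1 (hcovi (show exitPoint Ω e x ∈ inSide Ω e from ⟨hf, hlt⟩))
      exact Or.inl (mem_iUnion.2 ⟨j, hx, ⟨⟨hf, hlt⟩, hxB⟩, hj⟩)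
    · exact Or.inr ⟨hx, hf, heq⟩
  have hBeq : inSide Ω e ∩ B = ⋃ j, inSide Ω e ∩ B ∩ W j := by
    rw [← inter_iUnion, inter_eq_left.2 (inter_subset_left.trans hcovi)]
  calc fluxAt Ω e (outSide Ω e ∩ exitPoint Ω e ⁻¹' B)
      ≤ fluxAt Ω e (⋃ j, outSide Ω e ∩ exitPoint Ω e ⁻¹' (inSide Ω e ∩ B ∩ W j)) +
        fluxAt Ω e (outSide Ω e ∩ exitPoint Ω e ⁻¹' G) :=
        (measure_mono hsub).trans (measure_union_le _ _)
    _ ≤ ∑' j, fluxAt Ω e (inSide Ω e ∩ B ∩ W j) := by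
      rw [hgraz, add_zero]
      exact (measure_iUnion_le _).trans (ENNReal.tsum_le_tsum hreg)
    _ = fluxAt Ω e (inSide Ω e ∩ B) := by
      rw [← measure_iUnion (fun i j hij => (hWd hij).mono inter_subset_right inter_subset_right)
        (fun j => (hSi.inter hB).inter (hWm j)), ← hBeq]

theorem fluxAt_smul (Ω : Set (Space d)) {r : ℝ} (hr : 0 < r) (v : Space d) :
    fluxAt Ω (r • v) = ENNReal.ofReal r • fluxAt Ω v := by
  rw [fluxAt, fluxAt, ← withDensity_smul' _ _ ENNReal.ofReal_ne_top]
  congr 1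
  ext1 x
  rw [Pi.smul_apply, smul_eq_mul, inner_smul_left, abs_mul, ENNReal.ofReal_mul (abs_nonneg _)]
  simp [abs_of_pos hr]

/-- Free transport across `Ω` at fixed velocity does not increase the flux. -/
theorem HasHolderBoundary.transport (h : HasHolderBoundary Ω α) (hΩ : IsOpen Ω)
    (hb : Bornology.IsBounded Ω) (v : Space d) :
    ((fluxAt Ω v).restrict (outSide Ω v)).map (exitPoint Ω v) ≤
      (fluxAt Ω v).restrict (inSide Ω v) := by
  have hexit : Measurable (exitPoint Ω v) :=
    (measurable_exitPoint hΩ hb).comp (measurable_id.prodMk measurable_const)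
  refine Measure.le_iff.2 fun B hB => ?_
  rw [Measure.map_apply hexit hB, Measure.restrict_apply (hexit hB), Measure.restrict_apply hB,
    inter_comm, inter_comm B]
  rcases eq_or_ne v 0 with rfl | hv
  · have : outSide Ω (0 : Space d) = ∅ := by ext x; simp [outSide]
    rw [this, empty_inter, measure_empty]
    exact zero_le
  have hr : 0 < ‖v‖ := norm_pos_iff.2 hv
  set e := ‖v‖⁻¹ • v with he_def
  have he : ‖e‖ = 1 := by rw [he_def, norm_smul, norm_inv, norm_norm, inv_mul_cancel₀ hr.ne']
  have hve : v = ‖v‖ • e := by rw [he_def, smul_smul, mul_inv_cancel₀ hr.ne', one_smul]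
  have h1 : outSide Ω v = outSide Ω e := by
    ext x
    rw [hve]
    simp only [outSide, mem_ofPred_eq, inner_smul_left, conj_trivial, mul_pos_iff_of_pos_left hr]
  have h2 : inSide Ω v = inSide Ω e := by
    ext x
    rw [hve]
    simp only [inSide, mem_ofPred_eq, inner_smul_left, conj_trivial, ← neg_pos (a := ‖v‖ * _),
      ← mul_neg, mul_pos_iff_of_pos_left hr, neg_pos]
  have h3 : exitPoint Ω v = exitPoint Ω e := by
    ext1 x
    rw [hve, exitPoint_smul Ω e x hr]
  rw [h1, h2, h3, hve, fluxAt_smul Ω hr, Measure.smul_apply, Measure.smul_apply, smul_eq_mul,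
    smul_eq_mul]
  exact mul_le_mul_right (h.transport_unit hΩ hb he hB) _

end Transport

/-! ### Polar coordinates and rotation invariant measures -/

section Polar

theorem map_val_volumeIoiPow (n : ℕ) :
    (Measure.volumeIoiPow n).map (Subtype.val : Ioi (0 : ℝ) → ℝ) =
      (volume.restrict (Ioi (0 : ℝ))).withDensity fun r => ENNReal.ofReal (r ^ n) := by
  have hm : Measurable fun r : ℝ => ENNReal.ofReal (r ^ n) := by fun_prop
  refine Measure.ext_of_lintegral _ fun f hf => ?_
  rw [lintegral_map hf measurable_subtype_coe, Measure.volumeIoiPow,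
    lintegral_withDensity_eq_lintegral_mul _ (by fun_prop) (by fun_prop),
    lintegral_withDensity_eq_lintegral_mul _ hm hf]
  exact lintegral_subtype_comap measurableSet_Ioi
    (fun r : ℝ => ((fun r : ℝ => ENNReal.ofReal (r ^ n)) * f) r)

/-- Polar coordinates `(σ, r) ↦ r σ`. -/
def polarMap (p : Metric.sphere (0 : Space d) 1 × ℝ) : Space d := p.2 • (p.1 : Space d)

@[fun_prop]
theorem measurable_polarMap : Measurable (polarMap (d := d)) := by
  unfold polarMap
  fun_prop

theorem volume_eq_map_polarMap (hd : 1 ≤ d) :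
    (volume : Measure (Space d)) = ((volume : Measure (Space d)).toSphere.prod
      ((volume.restrict (Ioi (0 : ℝ))).withDensity fun r => ENNReal.ofReal (r ^ (d - 1)))).map
        polarMap := by
  have : Nontrivial (Space d) := by
    have : NeZero d := ⟨by omega⟩
    infer_instance
  have hmp := (volume : Measure (Space d)).measurePreserving_homeomorphUnitSphereProd
  have hfin : Module.finrank ℝ (Space d) = d := by simp
  rw [hfin] at hmp
  have h0 : (volume : Measure (Space d)) = volume.restrict {0}ᶜ := by
    rw [Measure.restrict_eq_self_of_ae_mem]
    exact compl_mem_ae_iff.2 (measure_singleton 0)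
  have hs : MeasurableSet ({0}ᶜ : Set (Space d)) := (measurableSet_singleton 0).compl
  rw [← map_val_volumeIoiPow]
  have e1 : (volume : Measure (Space d)).toSphere.prod
      ((Measure.volumeIoiPow (d - 1)).map (Subtype.val : Ioi (0 : ℝ) → ℝ)) =
      ((volume : Measure (Space d)).toSphere.prod (Measure.volumeIoiPow (d - 1))).map
        (Prod.map id Subtype.val) := by
    rw [← Measure.map_prod_map _ _ measurable_id measurable_subtype_coe, Measure.map_id]
  rw [e1, ← hmp.map_eq, Measure.map_map measurable_polarMap (by fun_prop),
    Measure.map_map (measurable_polarMap.comp (by fun_prop))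
      (homeomorphUnitSphereProd (Space d)).measurable]
  have e2 : (polarMap ∘ Prod.map id Subtype.val) ∘ (homeomorphUnitSphereProd (Space d)) =
      Subtype.val := by
    ext1 v
    have hv : ‖(v : Space d)‖ ≠ 0 := norm_ne_zero_iff.2 v.2
    simp [polarMap, smul_smul, mul_inv_cancel₀ hv]
  rw [e2, map_comap_subtype_coe hs, ← h0]

theorem norm_polarMap {p : Metric.sphere (0 : Space d) 1 × ℝ} (hp : 0 < p.2) :
    ‖polarMap p‖ = p.2 := by
  rw [polarMap, norm_smul, Real.norm_of_nonneg hp.le, norm_eq_of_mem_sphere, mul_one]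

theorem polar_withDensity (hd : 1 ≤ d) {f : ℝ → ℝ≥0∞} (hf : Measurable f) :
    (volume : Measure (Space d)).withDensity (fun v => f ‖v‖) =
      ((volume : Measure (Space d)).toSphere.prod
      ((volume.restrict (Ioi (0 : ℝ))).withDensity
        fun r => ENNReal.ofReal (r ^ (d - 1)) * f r)).map polarMap := by
  have hm : Measurable fun r : ℝ => ENNReal.ofReal (r ^ (d - 1)) := by fun_prop
  refine Measure.ext_of_lintegral _ fun g hg => ?_
  have hgp : Measurable fun p => g (polarMap p) := hg.comp measurable_polarMap
  rw [lintegral_withDensity_eq_lintegral_mul _ (by fun_prop) hg, volume_eq_map_polarMap hd,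
    lintegral_map (by fun_prop) measurable_polarMap, lintegral_map hg measurable_polarMap,
    ← volume_eq_map_polarMap hd, lintegral_prod _ (by fun_prop), lintegral_prod _ (by fun_prop)]
  refine lintegral_congr fun σ => ?_
  rw [lintegral_withDensity_eq_lintegral_mul _ hm (by fun_prop),
    lintegral_withDensity_eq_lintegral_mul _ (by fun_prop) (by fun_prop)]
  refine setLIntegral_congr_fun measurableSet_Ioi fun r hr => ?_
  simp only [Pi.mul_apply, norm_polarMap (p := (σ, r)) hr, mul_assoc]

theorem map_norm_withDensity (hd : 1 ≤ d) {f : ℝ → ℝ≥0∞} (hf : Measurable f) :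
    ((volume : Measure (Space d)).withDensity (fun v => f ‖v‖)).map (fun v => ‖v‖) =
      (volume.restrict (Ioi (0 : ℝ))).withDensity fun r =>
        (volume : Measure (Space d)).toSphere univ * (ENNReal.ofReal (r ^ (d - 1)) * f r) := by
  have hm : Measurable fun r : ℝ => ENNReal.ofReal (r ^ (d - 1)) := by fun_prop
  refine Measure.ext_of_lintegral _ fun g hg => ?_
  have hgm : Measurable fun p : Metric.sphere (0 : Space d) 1 × ℝ => g ‖polarMap p‖ := by fun_prop
  rw [lintegral_map hg measurable_norm, polar_withDensity hd hf,
    lintegral_map (by fun_prop) measurable_polarMap,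
    lintegral_prod _ hgm.aemeasurable,
    lintegral_withDensity_eq_lintegral_mul _ (by fun_prop) hg]
  have : ∀ σ : Metric.sphere (0 : Space d) 1,
      ∫⁻ r, g ‖polarMap (σ, r)‖ ∂((volume.restrict (Ioi (0 : ℝ))).withDensity
        fun r => ENNReal.ofReal (r ^ (d - 1)) * f r) =
      ∫⁻ r in Ioi (0 : ℝ), ENNReal.ofReal (r ^ (d - 1)) * f r * g r := fun σ => by
    have hgσ : Measurable fun r => g ‖polarMap (σ, r)‖ := hgm.comp measurable_prodMk_left
    rw [lintegral_withDensity_eq_lintegral_mul _ (by fun_prop) hgσ]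
    refine setLIntegral_congr_fun measurableSet_Ioi fun r hr => ?_
    simp only [Pi.mul_apply, norm_polarMap (p := (σ, r)) hr]
  simp only [this, lintegral_const]
  rw [mul_comm, ← lintegral_const_mul _ (by fun_prop)]
  refine lintegral_congr fun r => ?_
  simp only [Pi.mul_apply, mul_assoc]

theorem exists_isometry_apply_eq {a b : Space d} (h : ‖a‖ = ‖b‖) :
    ∃ T : Space d ≃ₗᵢ[ℝ] Space d, T a = b :=
  ⟨_, Submodule.reflection_sub h⟩

theorem charFun_map_isometry {μ : Measure (Space d)}
    (h : ∀ T : Space d ≃ₗᵢ[ℝ] Space d, μ.map T = μ) (T : Space d ≃ₗᵢ[ℝ] Space d) (t : Space d) :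
    charFun μ (T t) = charFun μ t := by
  conv_lhs => rw [charFun_apply, ← h T]
  rw [integral_map T.continuous.measurable.aemeasurable, charFun_apply]
  · simp only [T.inner_map_map]
  · exact Continuous.aestronglyMeasurable (by fun_prop)

/-- The rotation invariant measure on the unit sphere, as a measure on the whole space. -/
def directionMeasure (d : ℕ) : Measure (Space d) :=
  (volume.restrict (Metric.ball (0 : Space d) 1)).map fun v => ‖v‖⁻¹ • v

instance : IsFiniteMeasure (directionMeasure d) := by
  have : IsFiniteMeasure (volume.restrict (Metric.ball (0 : Space d) 1)) :=
    ⟨by rw [Measure.restrict_apply_univ]; exact measure_ball_lt_top⟩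
  unfold directionMeasure
  infer_instance

theorem directionMeasure_map (T : Space d ≃ₗᵢ[ℝ] Space d) :
    (directionMeasure d).map T = directionMeasure d := by
  have hm : Measurable fun v : Space d => ‖v‖⁻¹ • v := by fun_prop
  have hT : Measurable T := T.continuous.measurable
  have h1 : (volume.restrict (Metric.ball (0 : Space d) 1)).map T =
      volume.restrict (Metric.ball (0 : Space d) 1) := by
    have := (T.measurePreserving.restrict_preimage
      (measurableSet_ball (x := (0 : Space d)) (ε := 1))).map_eq
    have h2 : T ⁻¹' Metric.ball (0 : Space d) 1 = Metric.ball (0 : Space d) 1 := by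
      ext v; simp
    rwa [h2] at this
  rw [directionMeasure, Measure.map_map hT hm]
  conv_rhs => rw [← h1, Measure.map_map hm hT]
  congr 1
  ext1 v
  simp

theorem directionMeasure_norm (hd : 1 ≤ d) : ∀ᵐ ω ∂(directionMeasure d), ‖ω‖ = 1 := by
  have : Nontrivial (Space d) := by
    have : NeZero d := ⟨by omega⟩
    infer_instance
  have hm : Measurable fun v : Space d => ‖v‖⁻¹ • v := by fun_prop
  rw [directionMeasure, ae_map_iff hm.aemeasurable (measurableSet_eq_fun measurable_norm
    measurable_const)]
  refine ae_restrict_of_ae ?_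
  filter_upwards [compl_mem_ae_iff.2 (measure_singleton (μ := volume) (0 : Space d))] with v hv
  have hv' : ‖v‖ ≠ 0 := norm_ne_zero_iff.2 hv
  rw [norm_smul, norm_inv, norm_norm, inv_mul_cancel₀ hv']

theorem directionMeasure_univ_pos : 0 < (directionMeasure d).real univ := by
  have hm : Measurable fun v : Space d => ‖v‖⁻¹ • v := by fun_prop
  rw [measureReal_def, directionMeasure, Measure.map_apply hm .univ, preimage_univ,
    Measure.restrict_apply_univ]
  exact ENNReal.toReal_pos (Metric.measure_ball_pos _ _ one_pos).ne' measure_ball_lt_top.ne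

/-- The characteristic function of a rotation invariant measure depends on its radial law only. -/
theorem charFun_eq_integral_radial (hd : 1 ≤ d) {μ : Measure (Space d)} [IsFiniteMeasure μ]
    (h : ∀ T : Space d ≃ₗᵢ[ℝ] Space d, μ.map T = μ) {e : Space d} (he : ‖e‖ = 1) (t : Space d) :
    (directionMeasure d).real univ • charFun μ t =
      ∫ s, charFun (directionMeasure d) ((‖t‖ * s) • e) ∂(μ.map fun v => ‖v‖) := by
  have hmeas : Measurable (charFun (directionMeasure d)) := measurable_charFun
  have hmeas' : Measurable fun s : ℝ => charFun (directionMeasure d) ((‖t‖ * s) • e) := by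
    fun_prop
  rw [integral_map measurable_norm.aemeasurable hmeas'.aestronglyMeasurable]
  -- Rotation invariance allows `(‖t‖‖x‖) e` to be replaced by `‖t‖ x`, and the exponent is then
  -- symmetric in `x` and `ω`. After Fubini the inner integral is `charFun μ` at `‖t‖ ω`, which
  -- equals its value at `t` because `μ` is invariant.
  have h1 : ∀ x : Space d, charFun (directionMeasure d) ((‖t‖ * ‖x‖) • e) =
      ∫ ω, Complex.exp ((inner ℝ x (‖t‖ • ω) : ℝ) * Complex.I) ∂(directionMeasure d) := by
    intro x
    obtain ⟨T, hT⟩ := exists_isometry_apply_eq (a := (‖t‖ * ‖x‖) • e) (b := ‖t‖ • x)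
      (by rw [norm_smul, norm_smul, he]; simp)
    rw [← charFun_map_isometry directionMeasure_map T, hT, charFun_apply]
    refine integral_congr_ae (Eventually.of_forall fun ω => ?_)
    simp only [inner_smul_right, real_inner_comm]
  simp only [h1]
  rw [integral_integral_swap]
  · have h2 : ∀ᵐ ω ∂(directionMeasure d),
        ∫ x, Complex.exp ((inner ℝ x (‖t‖ • ω) : ℝ) * Complex.I) ∂μ = charFun μ t := by
      filter_upwards [directionMeasure_norm hd] with ω hω
      obtain ⟨T, hT⟩ := exists_isometry_apply_eq (a := t) (b := ‖t‖ • ω)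
        (by rw [norm_smul, norm_norm, hω, mul_one])
      rw [← charFun_map_isometry h T, hT, charFun_apply]
    rw [integral_congr_ae h2, integral_const]
  · refine Integrable.of_bound (C := 1) (Continuous.aestronglyMeasurable ?_)
      (Eventually.of_forall fun p => ?_)
    · unfold Function.uncurry
      fun_prop
    · simp only [Function.uncurry, Complex.norm_exp_ofReal_mul_I, le_refl]

/-- The right-hand side of `charFun_eq_integral_radial` involves only the radial law, and the mass
of `directionMeasure` is nonzero, so the characteristic functions coincide. -/
theorem ext_of_invariant_of_isFiniteMeasure (hd : 1 ≤ d) {μ ν : Measure (Space d)}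
    [IsFiniteMeasure μ] [IsFiniteMeasure ν]
    (hμ : ∀ T : Space d ≃ₗᵢ[ℝ] Space d, μ.map T = μ)
    (hν : ∀ T : Space d ≃ₗᵢ[ℝ] Space d, ν.map T = ν)
    (h : μ.map (fun v => ‖v‖) = ν.map fun v => ‖v‖) : μ = ν := by
  have : Nontrivial (Space d) := by
    have : NeZero d := ⟨by omega⟩
    infer_instance
  obtain ⟨e, he⟩ := exists_norm_eq (Space d) zero_le_one
  refine Measure.ext_of_charFun (funext fun t => ?_)
  have h1 := charFun_eq_integral_radial hd hμ he t
  rw [h, ← charFun_eq_integral_radial hd hν he t] at h1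
  exact smul_right_injective ℂ directionMeasure_univ_pos.ne' h1

theorem map_withDensity_norm {μ : Measure (Space d)}
    (hμ : ∀ T : Space d ≃ₗᵢ[ℝ] Space d, μ.map T = μ) {g : ℝ → ℝ≥0∞} (hg : Measurable g)
    (T : Space d ≃ₗᵢ[ℝ] Space d) :
    (μ.withDensity fun v => g ‖v‖).map T = μ.withDensity fun v => g ‖v‖ := by
  have hT : Measurable T := T.continuous.measurable
  refine Measure.ext_of_lintegral _ fun f hf => ?_
  rw [lintegral_map hf hT, lintegral_withDensity_eq_lintegral_mul _ (by fun_prop) (by fun_prop),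
    lintegral_withDensity_eq_lintegral_mul _ (by fun_prop) hf]
  conv_rhs => rw [← hμ T, lintegral_map (by fun_prop) hT]
  simp

/-- A rotation invariant measure is determined by its radial law. -/
theorem ext_of_invariant (hd : 1 ≤ d) {μ ν : Measure (Space d)}
    (hμ : ∀ T : Space d ≃ₗᵢ[ℝ] Space d, μ.map T = μ)
    (hν : ∀ T : Space d ≃ₗᵢ[ℝ] Space d, ν.map T = ν)
    (h : μ.map (fun v => ‖v‖) = ν.map fun v => ‖v‖) [SigmaFinite (μ.map fun v => ‖v‖)] :
    μ = ν := by
  -- A positive integrable weight depending on `‖v‖` alone reduces the claim to finite measures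
  -- without destroying invariance; it is removed at the end by its inverse.
  obtain ⟨g, hgpos, hg, hgint⟩ := exists_pos_lintegral_lt_of_sigmaFinite
    (μ.map fun v => ‖v‖) one_ne_zero
  set G : ℝ → ℝ≥0∞ := fun r => (g r : ℝ≥0∞) with hG
  have hGm : Measurable G := by fun_prop
  have hfin : ∀ ρ : Measure (Space d), ρ.map (fun v => ‖v‖) = μ.map (fun v => ‖v‖) →
      IsFiniteMeasure (ρ.withDensity fun v => G ‖v‖) := fun ρ hρ => by
    refine isFiniteMeasure_withDensity (ne_of_lt ?_)
    rw [← lintegral_map hGm measurable_norm, hρ]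
    exact hgint.trans ENNReal.one_lt_top
  have := hfin μ rfl
  have := hfin ν h.symm
  have key : (μ.withDensity fun v => G ‖v‖) = ν.withDensity fun v => G ‖v‖ := by
    refine ext_of_invariant_of_isFiniteMeasure hd (map_withDensity_norm hμ hGm)
      (map_withDensity_norm hν hGm) ?_
    refine Measure.ext_of_lintegral _ fun f hf => ?_
    rw [lintegral_map hf measurable_norm, lintegral_map hf measurable_norm,
      lintegral_withDensity_eq_lintegral_mul _ (by fun_prop) (by fun_prop),
      lintegral_withDensity_eq_lintegral_mul _ (by fun_prop) (by fun_prop)]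
    have e : ((fun v : Space d => G ‖v‖) * fun a => f ‖a‖) = fun v => (G * f) ‖v‖ := rfl
    rw [e, ← lintegral_map (hGm.mul hf) measurable_norm, h,
      lintegral_map (hGm.mul hf) measurable_norm]
  have hinv : ∀ ρ : Measure (Space d),
      ((ρ.withDensity fun v => G ‖v‖).withDensity fun v => (G ‖v‖)⁻¹) = ρ := fun ρ =>
    withDensity_inv_same (by fun_prop)
      (Eventually.of_forall fun v => by simp [hG, (hgpos ‖v‖).ne'])
      (Eventually.of_forall fun v => by simp [hG])
  rw [← hinv μ, key, hinv ν]

end Polar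

/-! ### Negative powers of a linear form on the sphere -/

section SphereIntegral

theorem integrable_abs_rpow_indicator {s : ℝ} (hs : -1 < s) :
    Integrable ((Icc (-1 : ℝ) 1).indicator fun t => |t| ^ s) := by
  rw [integrable_indicator_iff measurableSet_Icc]
  have h1 : IntervalIntegrable (fun t : ℝ => |t| ^ s) volume 0 1 := by
    refine (intervalIntegral.intervalIntegrable_rpow' hs).congr fun t ht => ?_
    rw [uIoc_of_le zero_le_one] at ht
    simp only [abs_of_pos ht.1]
  have h2 : IntervalIntegrable (fun t : ℝ => |t| ^ s) volume (-1) 0 := by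
    have := ((IntervalIntegrable.iff_comp_neg (by simp)).1 h1).symm
    simpa using this
  have := (h2.trans h1)
  rwa [intervalIntegrable_iff_integrableOn_Icc_of_le (by norm_num)] at this

theorem lintegral_ball_inner_rpow (hd : 1 ≤ d) (s : ℝ) {n : Space d}
    (hn : ‖n‖ = 1) :
    ∫⁻ v in Metric.ball (0 : Space d) 1, ENNReal.ofReal (|inner ℝ v n| ^ s) =
      ∫⁻ v in Metric.ball (0 : Space d) 1,
        ENNReal.ofReal (|(v : Space d).ofLp ⟨0, hd⟩| ^ s) := by
  set e : Space d := EuclideanSpace.single ⟨0, hd⟩ 1 with he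
  obtain ⟨T, hT⟩ := exists_isometry_apply_eq (a := n) (b := e) (by simp [he, hn])
  have hball : T ⁻¹' Metric.ball (0 : Space d) 1 = Metric.ball (0 : Space d) 1 := by
    ext v; simp
  have hmp := T.measurePreserving.restrict_preimage
      (measurableSet_ball (x := (0 : Space d)) (ε := 1))
  rw [hball] at hmp
  conv_rhs => rw [← hmp.map_eq]
  rw [lintegral_map (by fun_prop) T.continuous.measurable]
  refine lintegral_congr fun v => ?_
  have : inner ℝ v n = (T v).ofLp ⟨0, hd⟩ := by
    rw [← T.inner_map_map, hT, he, EuclideanSpace.inner_single_right]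
    simp
  rw [this]

/-- The ball lies in the cube `[-1, 1]^d`, on which the integrand is a product of functions of one
coordinate each; `s > -1` makes the only singular factor integrable. -/
theorem lintegral_ball_coord_lt_top (hd : 1 ≤ d) {s : ℝ} (hs : -1 < s) :
    ∫⁻ v in Metric.ball (0 : Space d) 1,
        ENNReal.ofReal (|(v : Space d).ofLp ⟨0, hd⟩| ^ s) < ∞ := by
  set f : Fin d → ℝ → ℝ := fun i => if i = ⟨0, hd⟩ then (Icc (-1 : ℝ) 1).indicator fun t => |t| ^ s
    else (Icc (-1 : ℝ) 1).indicator fun _ => 1 with hf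
  have hfi : ∀ i, Integrable (f i) := fun i => by
    by_cases hi : i = ⟨0, hd⟩
    · simp only [hf, hi, if_true]
      exact integrable_abs_rpow_indicator hs
    · simp only [hf, hi, if_false]
      rw [integrable_indicator_iff measurableSet_Icc]
      exact integrableOn_const (by simp)
  have hprod : Integrable (fun x : Fin d → ℝ => ∏ i, f i (x i)) := by
    rw [volume_pi]
    exact Integrable.fintype_prod hfi
  have hprod' : Integrable (fun v : Space d => ∏ i, f i (v.ofLp i)) := by
    exact ((EuclideanSpace.volume_preserving_symm_measurableEquiv_toLp (Fin d)).integrable_comp_emb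
      (MeasurableEquiv.measurableEmbedding _)).2 hprod
  refine lt_of_le_of_lt ?_ hprod'.lintegral_lt_top
  rw [← lintegral_indicator measurableSet_ball]
  refine lintegral_mono fun v => ?_
  by_cases hv : v ∈ Metric.ball (0 : Space d) 1
  · rw [indicator_of_mem hv]
    refine ENNReal.ofReal_le_ofReal (le_of_eq ?_)
    have hvi : ∀ i, v.ofLp i ∈ Icc (-1 : ℝ) 1 := fun i => by
      rw [mem_ball_zero_iff] at hv
      have := (PiLp.norm_apply_le v i).trans hv.le
      rwa [Real.norm_eq_abs, abs_le] at this
    rw [Finset.prod_eq_single ⟨0, hd⟩]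
    · simp [hf, indicator_of_mem (hvi _)]
    · intro i _ hi
      simp [hf, hi, indicator_of_mem (hvi _)]
    · simp
  · rw [indicator_of_notMem hv]
    exact zero_le

/-- In polar coordinates the integral of `|v·n|^s` over the unit ball is the sphere integral times
the radial factor `R > 0`. The ball integral is independent of `n` by rotation and finite. -/
theorem exists_sphere_bound (hd : 1 ≤ d) {s : ℝ} (hs : -1 < s) :
    ∃ C : ℝ≥0, ∀ n : Space d, ‖n‖ = 1 →
      ∫⁻ σ : Metric.sphere (0 : Space d) 1, ENNReal.ofReal (|inner ℝ (σ : Space d) n| ^ s)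
        ∂(volume : Measure (Space d)).toSphere ≤ C := by
  have hfin := lintegral_ball_coord_lt_top hd hs
  set L := ∫⁻ v in Metric.ball (0 : Space d) 1,
        ENNReal.ofReal (|(v : Space d).ofLp ⟨0, hd⟩| ^ s) with hL
  set R := ∫⁻ r in Ioo (0 : ℝ) 1, ENNReal.ofReal (r ^ (d - 1)) * ENNReal.ofReal (r ^ s) with hR
  have hRpos : R ≠ 0 := by
    rw [hR, ← pos_iff_ne_zero, setLIntegral_pos_iff (by fun_prop)]
    have : Function.support (fun r : ℝ => ENNReal.ofReal (r ^ (d - 1)) * ENNReal.ofReal (r ^ s)) ∩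
        Ioo 0 1 = Ioo 0 1 := by
      rw [inter_eq_right]
      intro r hr
      have h1 : 0 < r ^ (d - 1) := pow_pos hr.1 _
      have h2 : 0 < r ^ s := Real.rpow_pos_of_pos hr.1 _
      simp [h1, h2]
    rw [this]
    simp
  have key : ∀ n : Space d, ‖n‖ = 1 →
      (∫⁻ σ : Metric.sphere (0 : Space d) 1, ENNReal.ofReal (|inner ℝ (σ : Space d) n| ^ s)
        ∂(volume : Measure (Space d)).toSphere) * R = L := by
    intro n hn
    have hsm : Measurable fun σ : Metric.sphere (0 : Space d) 1 =>
      ENNReal.ofReal (|inner ℝ (σ : Space d) n| ^ s) := by fun_prop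
    have hbm : Measurable ((Metric.ball (0 : Space d) 1).indicator
        fun v => ENNReal.ofReal (|inner ℝ v n| ^ s)) :=
      Measurable.indicator (by fun_prop) measurableSet_ball
    have hbp : Measurable fun p => (Metric.ball (0 : Space d) 1).indicator
        (fun v => ENNReal.ofReal (|inner ℝ v n| ^ s)) (polarMap p) := hbm.comp measurable_polarMap
    rw [hL, ← lintegral_ball_inner_rpow hd s hn, ← lintegral_indicator measurableSet_ball]
    rw [volume_eq_map_polarMap hd, lintegral_map hbm measurable_polarMap,
      ← volume_eq_map_polarMap hd, lintegral_prod _ hbp.aemeasurable,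
      ← lintegral_mul_const _ hsm]
    refine lintegral_congr fun σ => ?_
    have hbσ : Measurable fun r => (Metric.ball (0 : Space d) 1).indicator
        (fun v => ENNReal.ofReal (|inner ℝ v n| ^ s)) (polarMap (σ, r)) :=
      hbp.comp measurable_prodMk_left
    rw [lintegral_withDensity_eq_lintegral_mul _ (by fun_prop) hbσ, hR, ← lintegral_const_mul _ (by fun_prop),
      ← lintegral_indicator measurableSet_Ioo, ← lintegral_indicator measurableSet_Ioi]
    refine lintegral_congr fun r => ?_
    by_cases hr : 0 < r
    · rw [indicator_of_mem (show r ∈ Ioi (0 : ℝ) from hr), Pi.mul_apply]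
      have hnp := norm_polarMap (p := (σ, r)) hr
      by_cases hr1 : r < 1
      · rw [indicator_of_mem (show r ∈ Ioo (0 : ℝ) 1 from ⟨hr, hr1⟩),
          indicator_of_mem (by rw [mem_ball_zero_iff, hnp]; exact hr1), polarMap, inner_smul_left,
          abs_mul, Real.mul_rpow (abs_nonneg _) (abs_nonneg _),
          ENNReal.ofReal_mul (Real.rpow_nonneg (abs_nonneg _) _)]
        simp only [conj_trivial, abs_of_pos hr]
        ring
      · rw [indicator_of_notMem (fun hh => hr1 hh.2),
          indicator_of_notMem (by rw [mem_ball_zero_iff, hnp]; exact hr1), mul_zero]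
    · rw [indicator_of_notMem (fun hh => hr hh.1), indicator_of_notMem (show r ∉ Ioi (0 : ℝ) from hr)]
  refine ⟨(L / R).toNNReal, fun n hn => ?_⟩
  have hLR : L / R ≠ ∞ := (ENNReal.div_lt_top hfin.ne hRpos).ne
  rw [ENNReal.coe_toNNReal hLR]
  rw [ENNReal.le_div_iff_mul_le (Or.inl hRpos) (Or.inr hfin.ne), key n hn]

end SphereIntegral
-- Density and support of the velocity measure
section VelocityMeasure

variable {m : Measure (Space d)} {w : ℝ → ℝ}

/-- A rotation invariant measure with radial law `|S^{d-1}| r^{d-1} w(r) dr` has the density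
`w(|v|)` with respect to Lebesgue measure. -/
theorem eq_withDensity_of_radial (hd : 1 ≤ d) (hm : ∀ T : Space d ≃ₗᵢ[ℝ] Space d, m.map T = m)
    (hw : Measurable w)
    (hr : m.map (fun v => ‖v‖) = (volume.restrict (Ioi (0 : ℝ))).withDensity fun r =>
      (volume : Measure (Space d)).toSphere univ * ENNReal.ofReal (r ^ (d - 1) * w r)) :
    m = (volume : Measure (Space d)).withDensity fun v => ENNReal.ofReal (w ‖v‖) := by
  have hW : Measurable fun r => ENNReal.ofReal (w r) := by fun_prop
  have hvol : ∀ T : Space d ≃ₗᵢ[ℝ] Space d, (volume : Measure (Space d)).map T = volume :=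
    fun T => T.measurePreserving.map_eq
  have hlaw := map_norm_withDensity hd hW
  have hsf : SigmaFinite (m.map fun v => ‖v‖) := by
    rw [hr]
    exact SigmaFinite.withDensity_of_ne_top (Eventually.of_forall fun r =>
      ENNReal.mul_ne_top (measure_ne_top _ _) ENNReal.ofReal_ne_top)
  have := map_withDensity_norm hvol hW
  refine ext_of_invariant hd hm this ?_
  rw [hr]
  refine Eq.trans ?_ hlaw.symm
  refine withDensity_congr_ae ?_
  filter_upwards [ae_restrict_mem measurableSet_Ioi] with r hr
  rw [ENNReal.ofReal_mul (pow_nonneg (le_of_lt hr) _)]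

end VelocityMeasure

section VelocityFacts

variable {Ω : Set (Space d)} {m : Measure (Space d)} {w : ℝ → ℝ}
  {k : Space d → Space d → Space d → ℝ}

theorem measurable_indicator_of_differentiableAt {f : ℝ → ℝ}
    (hf : ∀ r : ℝ, 0 < r → DifferentiableAt ℝ f r) : Measurable ((Ioi (0 : ℝ)).indicator f) := by
  refine measurable_of_restrict_of_restrict_compl (measurableSet_Ioi (a := (0 : ℝ))) ?_ ?_
  · have e : (Ioi (0 : ℝ)).domRestrict ((Ioi (0 : ℝ)).indicator f) =
        (Ioi (0 : ℝ)).domRestrict f := by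
      ext1 x
      exact indicator_of_mem x.2 _
    rw [e]
    exact (continuousOn_iff_continuous_domRestrict.1
      fun r hr => (hf r hr).continuousAt.continuousWithinAt).measurable
  · have e : (Ioi (0 : ℝ))ᶜ.domRestrict ((Ioi (0 : ℝ)).indicator f) = fun _ => 0 := by
      ext1 x
      exact indicator_of_notMem x.2 _
    rw [e]
    exact measurable_const

/-- The profile is unconstrained outside `(0, ∞)`; cutting it off there makes it a measurable
function without changing the radial law. -/
theorem RegularKernel.eq_withDensity (hk : RegularKernel Ω m w k) (hm : IsVelocityMeasure m)
    (hd : 1 ≤ d) : m = (volume : Measure (Space d)).withDensity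
      fun v => ENNReal.ofReal ((Ioi (0 : ℝ)).indicator w ‖v‖) := by
  refine eq_withDensity_of_radial hd hm.invariant
    (measurable_indicator_of_differentiableAt hk.profile_diff) ?_
  rw [hk.radial]
  refine withDensity_congr_ae ?_
  filter_upwards [ae_restrict_mem measurableSet_Ioi] with r hr
  rw [indicator_of_mem hr]

theorem RegularKernel.sigmaFinite (hk : RegularKernel Ω m w k) (hm : IsVelocityMeasure m)
    (hd : 1 ≤ d) : SigmaFinite m := by
  rw [hk.eq_withDensity hm hd]
  infer_instance

/-- Since the profile is positive on `(0, ∞)`, Lebesgue measure is absolutely continuous with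
respect to `m`. Consequently the sets of incoming and outgoing velocities are cones, and every ray
from the origin remains in one of them. -/
theorem RegularKernel.support_eq_univ (hk : RegularKernel Ω m w k) (hm : IsVelocityMeasure m)
    (hd : 1 ≤ d) : m.support = univ := by
  have : Nontrivial (Space d) := by
    have : NeZero d := ⟨by omega⟩
    infer_instance
  have hac : (volume : Measure (Space d)) ≪ m := by
    rw [hk.eq_withDensity hm hd]
    have hmeas := measurable_indicator_of_differentiableAt hk.profile_diff
    refine withDensity_absolutelyContinuous' (by fun_prop) ?_
    filter_upwards [compl_mem_ae_iff.2 (measure_singleton (μ := volume) (0 : Space d))] with v hv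
    have hv' : 0 < ‖v‖ := norm_pos_iff.2 hv
    rw [indicator_of_mem (show ‖v‖ ∈ Ioi (0 : ℝ) from hv')]
    simpa using hk.profile_pos _ hv'
  have := hac.isOpenPosMeasure
  exact Measure.support_eq_univ

theorem RegularKernel.eq_map_polarMap (hk : RegularKernel Ω m w k) (hm : IsVelocityMeasure m)
    (hd : 1 ≤ d) : m = ((volume : Measure (Space d)).toSphere.prod
      ((volume.restrict (Ioi (0 : ℝ))).withDensity
        fun r => ENNReal.ofReal (r ^ (d - 1) * (Ioi (0 : ℝ)).indicator w r))).map polarMap := by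
  have hmeas := measurable_indicator_of_differentiableAt hk.profile_diff
  conv_lhs => rw [hk.eq_withDensity hm hd]
  rw [polar_withDensity hd (f := fun r => ENNReal.ofReal ((Ioi (0 : ℝ)).indicator w r))
    (by fun_prop)]
  congr 2
  refine withDensity_congr_ae ?_
  filter_upwards [ae_restrict_mem measurableSet_Ioi] with r hr
  rw [ENNReal.ofReal_mul (pow_nonneg (le_of_lt hr) _)]

end VelocityFacts

/-! ### Operators on L¹ given by pointwise formulas -/

section LOne

variable {X Y : Type*} [MeasurableSpace X] [MeasurableSpace Y] {μ : Measure X} {ν : Measure Y}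

theorem enorm_lp_one (f : Lp ℂ 1 μ) : ‖f‖ₑ = ∫⁻ x, ‖f x‖ₑ ∂μ := by
  rw [Lp.enorm_def, eLpNorm_one_eq_lintegral_enorm]

theorem integrable_lp_one (f : Lp ℂ 1 μ) : Integrable f μ :=
  memLp_one_iff_integrable.1 (Lp.memLp f)

/-- An operator given a.e. by a pointwise formula, which satisfies an `L¹` bound. -/
theorem norm_le_of_lintegral_le {Φ : (X → ℂ) → Y → ℂ} {C : ℝ} (hC : 0 ≤ C)
    (hbound : ∀ f : X → ℂ, Measurable f → Integrable f μ →
      ∫⁻ y, ‖Φ f y‖ₑ ∂ν ≤ ENNReal.ofReal C * ∫⁻ x, ‖f x‖ₑ ∂μ)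
    (T : Lp ℂ 1 μ →L[ℂ] Lp ℂ 1 ν) (hT : ∀ f : Lp ℂ 1 μ, ∀ᵐ y ∂ν, T f y = Φ f y) :
    ‖T‖ ≤ C := by
  refine T.opNorm_le_bound hC fun f => ?_
  have h1 : ‖T f‖ₑ ≤ ENNReal.ofReal C * ‖f‖ₑ := by
    rw [enorm_lp_one, enorm_lp_one, lintegral_congr_ae
      (show (fun y => ‖T f y‖ₑ) =ᵐ[ν] fun y => ‖Φ f y‖ₑ by
        filter_upwards [hT f] with y hy; rw [hy])]
    exact hbound f (Lp.stronglyMeasurable f).measurable (integrable_lp_one f)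
  rw [← ofReal_norm, ← ofReal_norm, ← ENNReal.ofReal_mul hC] at h1
  exact (ENNReal.ofReal_le_ofReal_iff (by positivity)).1 h1

/-- `Φ` acts on functions rather than on classes. The L¹ bound applied to a difference shows that
a.e. equal functions have a.e. equal images, so `Φ` descends to L¹; uniqueness is then immediate. -/
theorem existsUnique_clm {Φ : (X → ℂ) → Y → ℂ} {C : ℝ≥0}
    (hmeas : ∀ f : X → ℂ, Measurable f → Integrable f μ → AEStronglyMeasurable (Φ f) ν)
    (hbound : ∀ f : X → ℂ, Measurable f → Integrable f μ →
      ∫⁻ y, ‖Φ f y‖ₑ ∂ν ≤ C * ∫⁻ x, ‖f x‖ₑ ∂μ)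
    (hadd : ∀ f g : X → ℂ, Measurable f → Integrable f μ → Measurable g → Integrable g μ →
      Φ (f + g) =ᵐ[ν] Φ f + Φ g)
    (hsmul : ∀ (c : ℂ) (f : X → ℂ), Measurable f → Integrable f μ → Φ (c • f) =ᵐ[ν] c • Φ f) :
    ∃! T : Lp ℂ 1 μ →L[ℂ] Lp ℂ 1 ν, ∀ f : Lp ℂ 1 μ, ∀ᵐ y ∂ν, T f y = Φ f y := by
  have hm : ∀ f : Lp ℂ 1 μ, Measurable f := fun f => (Lp.stronglyMeasurable f).measurable
  have hcongr : ∀ f g : X → ℂ, Measurable f → Integrable f μ → Measurable g → Integrable g μ →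
      f =ᵐ[μ] g → Φ f =ᵐ[ν] Φ g := by
    intro f g hf hfi hg hgi hfg
    have h1 := hadd g (f - g) hg hgi (hf.sub hg) (hfi.sub hgi)
    rw [add_sub_cancel] at h1
    have h2 : ∫⁻ y, ‖Φ (f - g) y‖ₑ ∂ν = 0 := by
      refine le_antisymm ((hbound (f - g) (hf.sub hg) (hfi.sub hgi)).trans ?_) zero_le
      rw [lintegral_congr_ae (g := fun _ => 0), lintegral_zero, mul_zero]
      filter_upwards [hfg] with x hx
      simp [hx]
    rw [lintegral_eq_zero_iff' (hmeas _ (hf.sub hg) (hfi.sub hgi)).enorm] at h2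
    filter_upwards [h1, h2] with y hy1 hy2
    rw [hy1, Pi.add_apply]
    simpa using hy2
  have hint : ∀ f : Lp ℂ 1 μ, Integrable (Φ f) ν := fun f => by
    refine ⟨hmeas f (hm f) (integrable_lp_one f), ?_⟩
    refine (hbound f (hm f) (integrable_lp_one f)).trans_lt
      (ENNReal.mul_lt_top ENNReal.coe_lt_top ?_)
    exact (integrable_lp_one f).2
  let L : Lp ℂ 1 μ →ₗ[ℂ] Lp ℂ 1 ν :=
    { toFun := fun f => (hint f).toL1 _
      map_add' := fun f g => by
        rw [← Integrable.toL1_add _ _ (hint f) (hint g), Integrable.toL1_eq_toL1_iff]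
        refine EventuallyEq.trans ?_
          (hadd f g (hm f) (integrable_lp_one f) (hm g) (integrable_lp_one g))
        exact hcongr _ _ (hm _) (integrable_lp_one _) ((hm f).add (hm g))
          ((integrable_lp_one f).add (integrable_lp_one g)) (Lp.coeFn_add f g)
      map_smul' := fun c f => by
        rw [RingHom.id_apply, ← Integrable.toL1_smul' _ (hint f) c, Integrable.toL1_eq_toL1_iff]
        refine EventuallyEq.trans ?_ (hsmul c f (hm f) (integrable_lp_one f))
        exact hcongr _ _ (hm _) (integrable_lp_one _) ((hm f).const_smul c)
          ((integrable_lp_one f).smul c) (Lp.coeFn_smul c f) }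
  have hL : ∀ f : Lp ℂ 1 μ, ∀ᵐ y ∂ν, L f y = Φ f y := fun f => Integrable.coeFn_toL1 (hint f)
  have hLb : ∀ f, ‖L f‖ ≤ C * ‖f‖ := fun f => by
    have h1 : ‖L f‖ₑ ≤ C * ‖f‖ₑ := by
      rw [enorm_lp_one, enorm_lp_one, lintegral_congr_ae
        (show (fun y => ‖L f y‖ₑ) =ᵐ[ν] fun y => ‖Φ f y‖ₑ by
          filter_upwards [hL f] with y hy; rw [hy])]
      exact hbound f (hm f) (integrable_lp_one f)
    rw [← ofReal_norm, ← ofReal_norm, ← ENNReal.ofReal_coe_nnreal,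
      ← ENNReal.ofReal_mul C.coe_nonneg] at h1
    exact (ENNReal.ofReal_le_ofReal_iff (by positivity)).1 h1
  refine ⟨L.mkContinuous C hLb, hL, fun T hT => ?_⟩
  refine ContinuousLinearMap.ext fun f => Lp.ext ?_
  filter_upwards [hT f, hL f] with y h1 h2
  rw [h1]
  exact h2.symm

end LOne

/-! ### The trace measures as densities over surface measure times `m` -/

section TraceMeasures

variable {Ω : Set (Space d)} {α : ℝ} (h : HasHolderBoundary Ω α) (hΩ : IsOpen Ω)
  (hb : Bornology.IsBounded Ω) {m : Measure (Space d)}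
include h hΩ

theorem HasHolderBoundary.measurable_inner_normal_prod :
    Measurable fun p : Space d × Space d => inner ℝ p.2 (normal Ω p.1) := by
  have := h.measurable_normal hΩ
  fun_prop

theorem HasHolderBoundary.measurableSet_gammaPlus : MeasurableSet (gammaPlus Ω m) :=
  (isClosed_frontier.measurableSet.preimage measurable_fst).inter
    ((Measure.isClosed_support.measurableSet.preimage measurable_snd).inter
      (measurableSet_lt measurable_const (h.measurable_inner_normal_prod hΩ)))

theorem HasHolderBoundary.measurableSet_gammaMinus : MeasurableSet (gammaMinus Ω m) :=
  (isClosed_frontier.measurableSet.preimage measurable_fst).inter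
    ((Measure.isClosed_support.measurableSet.preimage measurable_snd).inter
      (measurableSet_lt (h.measurable_inner_normal_prod hΩ) measurable_const))

theorem HasHolderBoundary.measurableSet_kernelDomain : MeasurableSet (kernelDomain Ω m) :=
  ((h.measurableSet_gammaMinus hΩ (m := m)).preimage
    (measurable_fst.prodMk (measurable_fst.comp measurable_snd))).inter
    ((h.measurableSet_gammaPlus hΩ (m := m)).preimage
    (measurable_fst.prodMk (measurable_snd.comp measurable_snd))) |>.congr (by
      ext p
      simp only [kernelDomain, gammaMinus, gammaPlus, mem_inter_iff, mem_preimage, mem_ofPred_eq]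
      tauto)

omit h hΩ in
/-- The density of `μ₊` with respect to `π ⊗ m`. -/
def outWeight (Ω : Set (Space d)) (m : Measure (Space d)) (x v : Space d) : ℝ≥0∞ :=
  (gammaPlus Ω m).indicator (fun p => ENNReal.ofReal |inner ℝ p.2 (normal Ω p.1)|) (x, v)

omit h hΩ in
/-- The density of `μ₋` with respect to `π ⊗ m`. -/
def inWeight (Ω : Set (Space d)) (m : Measure (Space d)) (x v : Space d) : ℝ≥0∞ :=
  (gammaMinus Ω m).indicator (fun p => ENNReal.ofReal |inner ℝ p.2 (normal Ω p.1)|) (x, v)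

theorem HasHolderBoundary.measurable_outWeight :
    Measurable fun p : Space d × Space d => outWeight Ω m p.1 p.2 := by
  have := h.measurable_inner_normal_prod hΩ
  exact Measurable.indicator (by fun_prop) (h.measurableSet_gammaPlus hΩ)

theorem HasHolderBoundary.measurable_inWeight :
    Measurable fun p : Space d × Space d => inWeight Ω m p.1 p.2 := by
  have := h.measurable_inner_normal_prod hΩ
  exact Measurable.indicator (by fun_prop) (h.measurableSet_gammaMinus hΩ)

theorem HasHolderBoundary.muPlus_eq : muPlus Ω m =
    ((surfaceMeasure Ω).prod m).withDensity fun p => outWeight Ω m p.1 p.2 := by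
  rw [muPlus, fluxMeasure, restrict_withDensity (h.measurableSet_gammaPlus hΩ),
    ← withDensity_indicator (h.measurableSet_gammaPlus hΩ)]
  rfl

theorem HasHolderBoundary.muMinus_eq : muMinus Ω m =
    ((surfaceMeasure Ω).prod m).withDensity fun p => inWeight Ω m p.1 p.2 := by
  rw [muMinus, fluxMeasure, restrict_withDensity (h.measurableSet_gammaMinus hΩ),
    ← withDensity_indicator (h.measurableSet_gammaMinus hΩ)]
  rfl

theorem HasHolderBoundary.lintegral_muPlus {F : Space d × Space d → ℝ≥0∞} (hF : Measurable F)
    [SFinite m] : ∫⁻ p, F p ∂muPlus Ω m =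
      ∫⁻ x, ∫⁻ v, outWeight Ω m x v * F (x, v) ∂m ∂surfaceMeasure Ω := by
  have hw := h.measurable_outWeight hΩ (m := m)
  rw [h.muPlus_eq hΩ, lintegral_withDensity_eq_lintegral_mul _ hw hF,
    lintegral_prod _ (hw.mul hF).aemeasurable]
  rfl

theorem HasHolderBoundary.lintegral_muMinus {F : Space d × Space d → ℝ≥0∞} (hF : Measurable F)
    [SFinite m] : ∫⁻ p, F p ∂muMinus Ω m =
      ∫⁻ x, ∫⁻ v, inWeight Ω m x v * F (x, v) ∂m ∂surfaceMeasure Ω := by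
  have hw := h.measurable_inWeight hΩ (m := m)
  rw [h.muMinus_eq hΩ, lintegral_withDensity_eq_lintegral_mul _ hw hF,
    lintegral_prod _ (hw.mul hF).aemeasurable]
  rfl

end TraceMeasures

/-! ### The diffuse operator as a contraction -/

section CleanKernel

variable {Ω : Set (Space d)} {α : ℝ} {m : Measure (Space d)} {w : ℝ → ℝ}
  {k : Space d → Space d → Space d → ℝ}

/-- The kernel, extended by zero outside its domain. -/
def zeroExt (Ω : Set (Space d)) (m : Measure (Space d)) (k : Space d → Space d → Space d → ℝ)
    (x v v' : Space d) : ℝ :=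
  (kernelDomain Ω m).indicator (fun p => k p.1 p.2.1 p.2.2) (x, v, v')

theorem zeroExt_of_mem {x v v' : Space d} (hx : x ∈ frontier Ω) (hv : v ∈ incoming Ω m x)
    (hv' : v' ∈ outgoing Ω m x) : zeroExt Ω m k x v v' = k x v v' :=
  indicator_of_mem (show (x, v, v') ∈ kernelDomain Ω m from ⟨hx, hv, hv'⟩) _

theorem mem_of_zeroExt_ne_zero {x v v' : Space d} (h : zeroExt Ω m k x v v' ≠ 0) :
    x ∈ frontier Ω ∧ v ∈ incoming Ω m x ∧ v' ∈ outgoing Ω m x := by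
  by_contra hc
  exact h (indicator_of_notMem (show (x, v, v') ∉ kernelDomain Ω m from hc) _)

theorem RegularKernel.zeroExt_nonneg (hk : RegularKernel Ω m w k) (x v v' : Space d) :
    0 ≤ zeroExt Ω m k x v v' :=
  indicator_nonneg (fun p hp => hk.nonneg p hp) _

variable (h : HasHolderBoundary Ω α) (hΩ : IsOpen Ω)
include h hΩ

theorem RegularKernel.measurable_zeroExt (hk : RegularKernel Ω m w k) :
    Measurable fun p : Space d × Space d × Space d => zeroExt Ω m k p.1 p.2.1 p.2.2 := by
  refine measurable_of_restrict_of_restrict_compl (h.measurableSet_kernelDomain hΩ (m := m)) ?_ ?_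
  · have e : (kernelDomain Ω m).domRestrict (fun p => zeroExt Ω m k p.1 p.2.1 p.2.2) =
        fun p : kernelDomain Ω m => k p.1.1 p.1.2.1 p.1.2.2 := by
      ext1 p
      exact indicator_of_mem p.2 (fun p : Space d × Space d × Space d => k p.1 p.2.1 p.2.2)
    rw [e]
    exact hk.measurable
  · have e : (kernelDomain Ω m)ᶜ.domRestrict (fun p => zeroExt Ω m k p.1 p.2.1 p.2.2) =
        fun _ => 0 := by
      ext1 p
      exact indicator_of_notMem p.2 (fun p : Space d × Space d × Space d => k p.1 p.2.1 p.2.2)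
    rw [e]
    exact measurable_const

omit h hΩ in
/-- Each outgoing particle is re-emitted with total probability at most one. -/
theorem RegularKernel.lintegral_inWeight_le (hk : RegularKernel Ω m w k) (x v' : Space d) :
    ∫⁻ v, inWeight Ω m x v * ENNReal.ofReal (zeroExt Ω m k x v v') ∂m ≤ 1 := by
  by_cases hp : x ∈ frontier Ω ∧ v' ∈ outgoing Ω m x
  · have hin : MeasurableSet (incoming Ω m x) :=
      Measure.isClosed_support.measurableSet.inter
        (measurableSet_lt (f := fun v => inner ℝ v (normal Ω x)) (by fun_prop) measurable_const)
    have h1 := hk.normalized x hp.1 v' hp.2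
    -- A non-integrable function has Bochner integral `0`, whereas the normalization gives `1`.
    have hint : Integrable (fun v => k x v v' * |inner ℝ v (normal Ω x)|)
        (m.restrict (incoming Ω m x)) := by
      by_contra hc
      rw [integral_undef hc] at h1
      exact zero_ne_one h1
    have hnn : 0 ≤ᵐ[m.restrict (incoming Ω m x)]
        fun v => k x v v' * |inner ℝ v (normal Ω x)| := by
      filter_upwards [ae_restrict_mem hin] with v hv
      exact mul_nonneg (hk.nonneg (x, v, v') ⟨hp.1, hv, hp.2⟩) (abs_nonneg _)
    have h2 := ofReal_integral_eq_lintegral_ofReal hint hnn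
    rw [h1, ENNReal.ofReal_one] at h2
    rw [h2, ← lintegral_indicator hin]
    refine lintegral_mono fun v => ?_
    by_cases hv : v ∈ incoming Ω m x
    · rw [indicator_of_mem hv, zeroExt_of_mem hp.1 hv hp.2, inWeight,
        indicator_of_mem (show (x, v) ∈ gammaMinus Ω m from ⟨hp.1, hv⟩), mul_comm,
        ENNReal.ofReal_mul (hk.nonneg (x, v, v') ⟨hp.1, hv, hp.2⟩)]
    · rw [indicator_of_notMem hv, inWeight,
        indicator_of_notMem (show (x, v) ∉ gammaMinus Ω m from fun hh => hv hh.2), zero_mul]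
  · have : ∀ v, zeroExt Ω m k x v v' = 0 := fun v => by
      by_contra hc
      obtain ⟨a, -, c⟩ := mem_of_zeroExt_ne_zero hc
      exact hp ⟨a, c⟩
    simp [this]

omit h hΩ in
/-- The pointwise formula for the diffuse operator. -/
def diffuse (Ω : Set (Space d)) (m : Measure (Space d)) (k : Space d → Space d → Space d → ℝ)
    (ψ : Space d × Space d → ℂ) (p : Space d × Space d) : ℂ :=
  ∫ v', ((zeroExt Ω m k p.1 p.2 v' * |inner ℝ v' (normal Ω p.1)| : ℝ) : ℂ) * ψ (p.1, v') ∂m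

omit h hΩ in
theorem RegularKernel.enorm_integrand (hk : RegularKernel Ω m w k) (x v v' : Space d) (z : ℂ) :
    ‖((zeroExt Ω m k x v v' * |inner ℝ v' (normal Ω x)| : ℝ) : ℂ) * z‖ₑ =
      ENNReal.ofReal (zeroExt Ω m k x v v') * (outWeight Ω m x v' * ‖z‖ₑ) := by
  by_cases h0 : zeroExt Ω m k x v v' = 0
  · simp [h0]
  · obtain ⟨a, -, c⟩ := mem_of_zeroExt_ne_zero h0
    rw [outWeight, indicator_of_mem (show (x, v') ∈ gammaPlus Ω m from ⟨a, c⟩), enorm_mul,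
      ← ofReal_norm, Complex.norm_real, Real.norm_eq_abs, abs_mul, abs_abs,
      abs_of_nonneg (hk.zeroExt_nonneg x v v'), ENNReal.ofReal_mul (hk.zeroExt_nonneg x v v'),
      mul_assoc]

omit h hΩ in
theorem integral_outgoing_eq_diffuse (ψ : Space d × Space d → ℂ) {p : Space d × Space d}
    (hp : p ∈ gammaMinus Ω m) :
    ∫ v' in outgoing Ω m p.1,
        ((k p.1 p.2 v' * |inner ℝ v' (normal Ω p.1)| : ℝ) : ℂ) * ψ (p.1, v') ∂m =
      diffuse Ω m k ψ p := by
  have hout : MeasurableSet (outgoing Ω m p.1) :=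
    Measure.isClosed_support.measurableSet.inter
      (measurableSet_lt (g := fun v => inner ℝ v (normal Ω p.1)) measurable_const (by fun_prop))
  rw [← integral_indicator hout, diffuse]
  congr 1
  ext1 v'
  by_cases hv' : v' ∈ outgoing Ω m p.1
  · rw [indicator_of_mem hv', zeroExt_of_mem hp.1 hp.2 hv']
  · have : zeroExt Ω m k p.1 p.2 v' = 0 := by
      by_contra hc
      exact hv' (mem_of_zeroExt_ne_zero hc).2.2
    rw [indicator_of_notMem hv', this]
    simp

theorem isDiffuseOperator_iff {H : LOnePlus Ω m →L[ℂ] LOneMinus Ω m} :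
    IsDiffuseOperator Ω m k H ↔
      ∀ ψ : LOnePlus Ω m, ∀ᵐ p ∂(muMinus Ω m), H ψ p = diffuse Ω m k ψ p := by
  have hmem : ∀ᵐ p ∂(muMinus Ω m), p ∈ gammaMinus Ω m :=
    ae_restrict_mem (h.measurableSet_gammaMinus hΩ)
  refine forall_congr' fun ψ => ⟨fun hh => ?_, fun hh => ?_⟩
  · filter_upwards [hh, hmem] with p h1 h2
    rw [h1, integral_outgoing_eq_diffuse _ h2]
  · filter_upwards [hh, hmem] with p h1 h2
    rw [h1, ← integral_outgoing_eq_diffuse _ h2]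

theorem RegularKernel.measurable_ofReal_zeroExt (hk : RegularKernel Ω m w k) :
    Measurable fun p : (Space d × Space d) × Space d =>
      ENNReal.ofReal (zeroExt Ω m k p.1.1 p.1.2 p.2) := by
  have := hk.measurable_zeroExt h hΩ
  have h2 : Measurable fun p : (Space d × Space d) × Space d => (p.1.1, p.1.2, p.2) := by fun_prop
  exact (this.comp h2).ennreal_ofReal

/-- By Tonelli the emitted velocity is integrated first, and the normalization bounds that integral
by one. This mass bound yields the contraction property of `H` and all the absolute convergence
needed later. -/
theorem RegularKernel.lintegral_diffuse_le (hk : RegularKernel Ω m w k) [SFinite m]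
    {F : Space d × Space d → ℝ≥0∞} (hF : Measurable F) :
    ∫⁻ p, ∫⁻ v', ENNReal.ofReal (zeroExt Ω m k p.1 p.2 v') *
      (outWeight Ω m p.1 v' * F (p.1, v')) ∂m ∂muMinus Ω m ≤ ∫⁻ p, F p ∂muPlus Ω m := by
  have hz := hk.measurable_ofReal_zeroExt h hΩ
  have hout := h.measurable_outWeight hΩ (m := m)
  have hin := h.measurable_inWeight hΩ (m := m)
  have hout' : Measurable fun q : (Space d × Space d) × Space d =>
      outWeight Ω m q.1.1 q.2 * F (q.1.1, q.2) :=
    (hout.mul hF).comp ((measurable_fst.comp measurable_fst).prodMk measurable_snd)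
  have hG : Measurable fun q : (Space d × Space d) × Space d =>
      ENNReal.ofReal (zeroExt Ω m k q.1.1 q.1.2 q.2) *
      (outWeight Ω m q.1.1 q.2 * F (q.1.1, q.2)) := hz.mul hout'
  have hGi : Measurable fun p : Space d × Space d =>
      ∫⁻ v', ENNReal.ofReal (zeroExt Ω m k p.1 p.2 v') *
        (outWeight Ω m p.1 v' * F (p.1, v')) ∂m := hG.lintegral_prod_right'
  rw [h.lintegral_muMinus hΩ hGi, h.lintegral_muPlus hΩ hF]
  refine lintegral_mono fun x => ?_
  have hpair : Measurable fun q : Space d × Space d => ((x, q.1), q.2) := by fun_prop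
  have hinx : Measurable fun q : Space d × Space d => inWeight Ω m x q.1 :=
    hin.comp (measurable_const.prodMk measurable_fst)
  have hGx : Measurable fun q : Space d × Space d =>
      ENNReal.ofReal (zeroExt Ω m k x q.1 q.2) * (outWeight Ω m x q.2 * F (x, q.2)) :=
    hG.comp hpair
  have hzx : Measurable fun q : Space d × Space d =>
      ENNReal.ofReal (zeroExt Ω m k x q.1 q.2) := hz.comp hpair
  have hinz : Measurable fun q : Space d × Space d =>
      inWeight Ω m x q.1 * ENNReal.ofReal (zeroExt Ω m k x q.1 q.2) := hinx.mul hzx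
  have hsl : ∀ v' : Space d, Measurable fun v : Space d =>
      inWeight Ω m x v * ENNReal.ofReal (zeroExt Ω m k x v v') := fun v' => by
    have hpr : Measurable fun v : Space d => (v, v') := by fun_prop
    have hc := hinz.comp hpr
    exact hc
  have hswap : ∫⁻ v, ∫⁻ v', inWeight Ω m x v * (ENNReal.ofReal (zeroExt Ω m k x v v') *
        (outWeight Ω m x v' * F (x, v'))) ∂m ∂m =
      ∫⁻ v', ∫⁻ v, inWeight Ω m x v * (ENNReal.ofReal (zeroExt Ω m k x v v') *
        (outWeight Ω m x v' * F (x, v'))) ∂m ∂m :=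
    lintegral_lintegral_swap (f := fun v v' => inWeight Ω m x v *
      (ENNReal.ofReal (zeroExt Ω m k x v v') * (outWeight Ω m x v' * F (x, v'))))
      (hinx.mul hGx).aemeasurable
  calc ∫⁻ v, inWeight Ω m x v * ∫⁻ v', ENNReal.ofReal (zeroExt Ω m k x v v') *
        (outWeight Ω m x v' * F (x, v')) ∂m ∂m
      = ∫⁻ v, ∫⁻ v', inWeight Ω m x v * (ENNReal.ofReal (zeroExt Ω m k x v v') *
        (outWeight Ω m x v' * F (x, v'))) ∂m ∂m := lintegral_congr fun v =>
        (lintegral_const_mul _ (hGx.comp measurable_prodMk_left)).symm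
    _ = ∫⁻ v', ∫⁻ v, inWeight Ω m x v * (ENNReal.ofReal (zeroExt Ω m k x v v') *
        (outWeight Ω m x v' * F (x, v'))) ∂m ∂m := hswap
    _ = ∫⁻ v', (∫⁻ v, inWeight Ω m x v * ENNReal.ofReal (zeroExt Ω m k x v v') ∂m) *
        (outWeight Ω m x v' * F (x, v')) ∂m := lintegral_congr fun v' => by
      have e1 := lintegral_mul_const (μ := m) (outWeight Ω m x v' * F (x, v')) (hsl v')
      have e2 : ∀ v, inWeight Ω m x v * (ENNReal.ofReal (zeroExt Ω m k x v v') *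
          (outWeight Ω m x v' * F (x, v'))) = inWeight Ω m x v *
          ENNReal.ofReal (zeroExt Ω m k x v v') * (outWeight Ω m x v' * F (x, v')) :=
        fun v => (mul_assoc _ _ _).symm
      exact (lintegral_congr e2).trans e1
    _ ≤ ∫⁻ v', outWeight Ω m x v' * F (x, v') ∂m := lintegral_mono fun v' =>
      mul_le_of_le_one_left zero_le (hk.lintegral_inWeight_le x v')

theorem RegularKernel.stronglyMeasurable_diffuse (hk : RegularKernel Ω m w k) [SFinite m]
    {ψ : Space d × Space d → ℂ} (hψ : Measurable ψ) : StronglyMeasurable (diffuse Ω m k ψ) := by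
  have hz := hk.measurable_zeroExt h hΩ
  have hn := h.measurable_normal hΩ
  have hz' : Measurable fun q : (Space d × Space d) × Space d =>
      zeroExt Ω m k q.1.1 q.1.2 q.2 := by
    have h2 : Measurable fun p : (Space d × Space d) × Space d => (p.1.1, p.1.2, p.2) := by
      fun_prop
    exact hz.comp h2
  have hG : Measurable fun q : (Space d × Space d) × Space d =>
      ((zeroExt Ω m k q.1.1 q.1.2 q.2 * |inner ℝ q.2 (normal Ω q.1.1)| : ℝ) : ℂ) *
        ψ (q.1.1, q.2) := by fun_prop
  exact hG.stronglyMeasurable.integral_prod_right'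

theorem RegularKernel.lintegral_enorm_diffuse_le (hk : RegularKernel Ω m w k) [SFinite m]
    {ψ : Space d × Space d → ℂ} (hψ : Measurable ψ) :
    ∫⁻ p, ‖diffuse Ω m k ψ p‖ₑ ∂muMinus Ω m ≤ ∫⁻ p, ‖ψ p‖ₑ ∂muPlus Ω m := by
  refine le_trans (lintegral_mono fun p => ?_) (hk.lintegral_diffuse_le h hΩ hψ.enorm)
  refine (enorm_integral_le_lintegral_enorm _).trans (le_of_eq ?_)
  simp only [hk.enorm_integrand]

/-- Needed for additivity of the pointwise formula, since the Bochner integral is additive only on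
integrable functions. -/
theorem RegularKernel.ae_integrable_diffuse (hk : RegularKernel Ω m w k) [SFinite m]
    {ψ : Space d × Space d → ℂ} (hψ : Measurable ψ) (hψi : Integrable ψ (muPlus Ω m)) :
    ∀ᵐ p ∂muMinus Ω m, Integrable (fun v' =>
      ((zeroExt Ω m k p.1 p.2 v' * |inner ℝ v' (normal Ω p.1)| : ℝ) : ℂ) * ψ (p.1, v')) m := by
  have hz := hk.measurable_zeroExt h hΩ
  have hlt := (hk.lintegral_diffuse_le h hΩ hψ.enorm).trans_lt hψi.2
  have hz2 := hk.measurable_ofReal_zeroExt h hΩ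
  have hout := h.measurable_outWeight hΩ (m := m)
  have hout' : Measurable fun q : (Space d × Space d) × Space d =>
      outWeight Ω m q.1.1 q.2 * ‖ψ (q.1.1, q.2)‖ₑ :=
    (hout.mul hψ.enorm).comp ((measurable_fst.comp measurable_fst).prodMk measurable_snd)
  have hG : Measurable fun q : (Space d × Space d) × Space d =>
      ENNReal.ofReal (zeroExt Ω m k q.1.1 q.1.2 q.2) *
      (outWeight Ω m q.1.1 q.2 * ‖ψ (q.1.1, q.2)‖ₑ) := hz2.mul hout'
  filter_upwards [ae_lt_top hG.lintegral_prod_right' hlt.ne] with p hp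
  refine ⟨Measurable.aestronglyMeasurable ?_, ?_⟩
  · have hzp : Measurable fun v' => zeroExt Ω m k p.1 p.2 v' :=
      hz.comp (measurable_const.prodMk (measurable_const.prodMk measurable_id))
    fun_prop
  · rw [hasFiniteIntegral_iff_enorm]
    simp only [hk.enorm_integrand]
    exact hp

theorem RegularKernel.existsUnique_diffuse (hk : RegularKernel Ω m w k) [SFinite m] :
    ∃! H : LOnePlus Ω m →L[ℂ] LOneMinus Ω m, IsDiffuseOperator Ω m k H := by
  simp only [isDiffuseOperator_iff h hΩ]
  refine existsUnique_clm (C := 1)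
    (fun f hf _ => (hk.stronglyMeasurable_diffuse h hΩ hf).aestronglyMeasurable)
    (fun f hf _ => ?_) (fun f g hf hfi hg hgi => ?_) (fun c f hf hfi => ?_)
  · rw [ENNReal.coe_one, one_mul]
    exact hk.lintegral_enorm_diffuse_le h hΩ hf
  · filter_upwards [hk.ae_integrable_diffuse h hΩ hf hfi,
      hk.ae_integrable_diffuse h hΩ hg hgi] with p h1 h2
    simp only [diffuse, Pi.add_apply, mul_add]
    exact integral_add h1 h2
  · refine Eventually.of_forall fun p => ?_
    simp only [diffuse, Pi.smul_apply, smul_eq_mul]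
    rw [← integral_const_mul]
    congr 1
    ext1 v'
    ring

theorem RegularKernel.norm_diffuse_le (hk : RegularKernel Ω m w k) [SFinite m]
    {H : LOnePlus Ω m →L[ℂ] LOneMinus Ω m} (hH : IsDiffuseOperator Ω m k H) : ‖H‖ ≤ 1 := by
  refine norm_le_of_lintegral_le zero_le_one (fun f hf _ => ?_) H
    ((isDiffuseOperator_iff h hΩ).1 hH)
  rw [ENNReal.ofReal_one, one_mul]
  exact hk.lintegral_enorm_diffuse_le h hΩ hf

end CleanKernel

/-! ### The transfer operator as a contraction -/

section Transfer

variable {Ω : Set (Space d)} {α : ℝ} {m : Measure (Space d)}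
  (h : HasHolderBoundary Ω α) (hΩ : IsOpen Ω) (hb : Bornology.IsBounded Ω)
include h hΩ

/-- Transport along backward trajectories, on phase space. -/
def exitMap (Ω : Set (Space d)) (p : Space d × Space d) : Space d × Space d :=
  (exitPoint Ω p.2 p.1, p.2)

omit h in
include hb in
theorem measurable_exitMap : Measurable (exitMap Ω) :=
  (measurable_exitPoint hΩ hb).prodMk measurable_snd

theorem HasHolderBoundary.lintegral_outWeight_mul {v : Space d} (hv : v ∈ m.support)
    {F : Space d → ℝ≥0∞} (hF : Measurable F) :
    ∫⁻ x, outWeight Ω m x v * F x ∂surfaceMeasure Ω =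
      ∫⁻ x, F x ∂(fluxAt Ω v).restrict (outSide Ω v) := by
  have hm := h.measurable_flux hΩ v
  rw [fluxAt, restrict_withDensity (h.measurableSet_outSide hΩ v),
    lintegral_withDensity_eq_lintegral_mul _ hm hF,
    ← lintegral_indicator (h.measurableSet_outSide hΩ v)]
  refine lintegral_congr fun x => ?_
  by_cases hx : x ∈ outSide Ω v
  · rw [indicator_of_mem hx, outWeight,
      indicator_of_mem (show (x, v) ∈ gammaPlus Ω m from ⟨hx.1, hv, hx.2⟩)]
    rfl
  · rw [indicator_of_notMem hx, outWeight,
      indicator_of_notMem (show (x, v) ∉ gammaPlus Ω m from fun hh => hx ⟨hh.1, hh.2.2⟩), zero_mul]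

theorem HasHolderBoundary.lintegral_inWeight_mul {v : Space d} (hv : v ∈ m.support)
    {F : Space d → ℝ≥0∞} (hF : Measurable F) :
    ∫⁻ x, inWeight Ω m x v * F x ∂surfaceMeasure Ω =
      ∫⁻ x, F x ∂(fluxAt Ω v).restrict (inSide Ω v) := by
  have hm := h.measurable_flux hΩ v
  rw [fluxAt, restrict_withDensity (h.measurableSet_inSide hΩ v),
    lintegral_withDensity_eq_lintegral_mul _ hm hF,
    ← lintegral_indicator (h.measurableSet_inSide hΩ v)]
  refine lintegral_congr fun x => ?_
  by_cases hx : x ∈ inSide Ω v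
  · rw [indicator_of_mem hx, inWeight,
      indicator_of_mem (show (x, v) ∈ gammaMinus Ω m from ⟨hx.1, hv, hx.2⟩)]
    rfl
  · rw [indicator_of_notMem hx, inWeight,
      indicator_of_notMem (show (x, v) ∉ gammaMinus Ω m from fun hh => hx ⟨hh.1, hh.2.2⟩), zero_mul]

omit h hΩ in
theorem outWeight_eq_zero {x v : Space d} (hv : v ∉ m.support) : outWeight Ω m x v = 0 :=
  indicator_of_notMem (fun hh => hv hh.2.1) _

include hb

theorem HasHolderBoundary.lintegral_transport_le (v : Space d) {F : Space d → ℝ≥0∞}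
    (hF : Measurable F) :
    ∫⁻ x, outWeight Ω m x v * F (exitPoint Ω v x) ∂surfaceMeasure Ω ≤
      ∫⁻ x, inWeight Ω m x v * F x ∂surfaceMeasure Ω := by
  have hexit : Measurable (exitPoint Ω v) :=
    (measurable_exitPoint hΩ hb).comp (measurable_id.prodMk measurable_const)
  by_cases hv : v ∈ m.support
  · rw [h.lintegral_outWeight_mul hΩ hv (F := fun x => F (exitPoint Ω v x)) (hF.comp hexit),
      h.lintegral_inWeight_mul hΩ hv hF, ← lintegral_map hF hexit]
    exact lintegral_mono' (h.transport hΩ hb v) le_rfl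
  · simp [outWeight_eq_zero hv]

theorem HasHolderBoundary.lintegral_exitMap_le [SFinite m] {F : Space d × Space d → ℝ≥0∞}
    (hF : Measurable F) :
    ∫⁻ p, F (exitMap Ω p) ∂muPlus Ω m ≤ ∫⁻ p, F p ∂muMinus Ω m := by
  have := h.isFiniteMeasure hΩ hb
  have hT := measurable_exitMap hΩ hb
  have hFT : Measurable fun p => F (exitMap Ω p) := hF.comp hT
  have h1 := (h.measurable_outWeight hΩ (m := m)).mul hFT
  have h2 := (h.measurable_inWeight hΩ (m := m)).mul hF
  rw [h.lintegral_muPlus hΩ hFT, h.lintegral_muMinus hΩ hF,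
    lintegral_lintegral_swap h1.aemeasurable,
    lintegral_lintegral_swap (f := fun x v => inWeight Ω m x v * F (x, v)) h2.aemeasurable]
  refine lintegral_mono fun v => ?_
  exact h.lintegral_transport_le hΩ hb v (F := fun x => F (x, v)) (hF.comp measurable_prodMk_right)

theorem HasHolderBoundary.map_exitMap_le [SFinite m] :
    (muPlus Ω m).map (exitMap Ω) ≤ muMinus Ω m := by
  have hT := measurable_exitMap hΩ hb
  refine Measure.le_iff.2 fun B hB => ?_
  have hB1 : Measurable (B.indicator fun _ => (1 : ℝ≥0∞)) := measurable_const.indicator hB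
  have := h.lintegral_exitMap_le hΩ hb (m := m) hB1
  rwa [← lintegral_map hB1 hT, lintegral_indicator hB, lintegral_indicator hB, setLIntegral_one,
    setLIntegral_one] at this

/-- Lets a.e. identities on `Γ₋` be pulled back to `Γ₊`, so that the formulas for `H` and `M_λ` can
be composed. -/
theorem HasHolderBoundary.quasiMeasurePreserving_exitMap [SFinite m] :
    Measure.QuasiMeasurePreserving (exitMap Ω) (muPlus Ω m) (muMinus Ω m) :=
  ⟨measurable_exitMap hΩ hb, Measure.absolutelyContinuous_of_le (h.map_exitMap_le hΩ hb)⟩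

omit h hΩ hb in
/-- The pointwise formula for the transfer operator. -/
def transfer (Ω : Set (Space d)) (lam : ℂ) (u : Space d × Space d → ℂ)
    (p : Space d × Space d) : ℂ :=
  Complex.exp (-lam * (travelTime Ω p.1 p.2 : ℂ)) * u (exitMap Ω p)

omit h in
theorem measurable_transfer (lam : ℂ) {u : Space d × Space d → ℂ} (hu : Measurable u) :
    Measurable (transfer Ω lam u) := by
  have := measurable_travelTime hΩ hb
  have := measurable_exitMap hΩ hb
  unfold transfer
  fun_prop

omit h hΩ hb in
theorem norm_exp_travelTime_le {lam : ℂ} (hlam : 0 ≤ lam.re) (x v : Space d) :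
    ‖Complex.exp (-lam * (travelTime Ω x v : ℂ))‖ ≤ 1 := by
  rw [Complex.norm_exp, Real.exp_le_one_iff]
  simp only [neg_mul, Complex.neg_re, Complex.mul_re, Complex.ofReal_re, Complex.ofReal_im,
    mul_zero, sub_zero, Left.neg_nonpos_iff]
  exact mul_nonneg hlam (travelTime_nonneg _ _ _)

theorem HasHolderBoundary.lintegral_enorm_transfer_le [SFinite m] {lam : ℂ} (hlam : 0 ≤ lam.re)
    {u : Space d × Space d → ℂ} (hu : Measurable u) :
    ∫⁻ p, ‖transfer Ω lam u p‖ₑ ∂muPlus Ω m ≤ ∫⁻ p, ‖u p‖ₑ ∂muMinus Ω m := by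
  refine le_trans (lintegral_mono fun p => ?_) (h.lintegral_exitMap_le hΩ hb hu.enorm)
  rw [transfer, enorm_mul]
  refine mul_le_of_le_one_left zero_le ?_
  rw [← ofReal_norm]
  exact ENNReal.ofReal_le_one.2 (norm_exp_travelTime_le hlam _ _)

theorem HasHolderBoundary.existsUnique_transfer [SFinite m] {lam : ℂ} (hlam : 0 ≤ lam.re) :
    ∃! M : LOneMinus Ω m →L[ℂ] LOnePlus Ω m, IsTransferOperator Ω m lam M := by
  refine existsUnique_clm (Φ := transfer Ω lam) (C := 1)
    (fun f hf _ => (measurable_transfer hΩ hb lam hf).aestronglyMeasurable)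
    (fun f hf _ => ?_) (fun f g _ _ _ _ => Eventually.of_forall fun p => ?_)
    (fun c f _ _ => Eventually.of_forall fun p => ?_)
  · rw [ENNReal.coe_one, one_mul]
    exact h.lintegral_enorm_transfer_le hΩ hb hlam hf
  · simp only [transfer, Pi.add_apply, mul_add]
  · simp only [transfer, Pi.smul_apply, smul_eq_mul]
    ring

theorem HasHolderBoundary.norm_transfer_le [SFinite m] {lam : ℂ} (hlam : 0 ≤ lam.re)
    {M : LOneMinus Ω m →L[ℂ] LOnePlus Ω m} (hM : IsTransferOperator Ω m lam M) : ‖M‖ ≤ 1 := by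
  refine norm_le_of_lintegral_le (Φ := transfer Ω lam) zero_le_one (fun f hf _ => ?_) M hM
  rw [ENNReal.ofReal_one, one_mul]
  exact h.lintegral_enorm_transfer_le hΩ hb hlam hf

end Transfer

/-! ### Integration by parts in the speed -/

section OneDim

/-- The substitution `r = exp t` turns the hypotheses into integrability on the line of both `P ∘
exp` and its derivative, and the integral of such a derivative is zero. Integrability of `P/r` thus
replaces the study of boundary values at `0` and `∞`. -/
theorem integral_Ioi_deriv_eq_zero {P P' : ℝ → ℂ} (hP : ∀ r : ℝ, 0 < r → HasDerivAt P (P' r) r)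
    (hP' : IntegrableOn P' (Ioi 0)) (hPi : IntegrableOn (fun r => (r⁻¹ : ℝ) • P r) (Ioi 0)) :
    ∫ r in Ioi (0 : ℝ), P' r = 0 := by
  have himg : Real.exp '' univ = Ioi 0 := by rw [image_univ, Real.range_exp]
  have hder : ∀ t ∈ (univ : Set ℝ), HasDerivWithinAt Real.exp (Real.exp t) univ t := fun t _ =>
    (Real.hasDerivAt_exp t).hasDerivWithinAt
  have hinj : InjOn Real.exp univ := Real.exp_injective.injOn
  rw [← himg] at hP' hPi ⊢
  rw [integral_image_eq_integral_abs_deriv_smul .univ hder hinj, setIntegral_univ]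
  rw [integrableOn_image_iff_integrableOn_abs_deriv_smul .univ hder hinj, integrableOn_univ] at hP' hPi
  refine integral_eq_zero_of_hasDerivAt_of_integrable (f := fun t => P (Real.exp t))
    (fun t => ?_) hP' ?_
  · have := (hP _ (Real.exp_pos t)).scomp t (Real.hasDerivAt_exp t)
    rwa [abs_of_pos (Real.exp_pos t)]
  · refine hPi.congr (Eventually.of_forall fun t => ?_)
    simp only
    rw [abs_of_pos (Real.exp_pos t), smul_smul, mul_inv_cancel₀ (Real.exp_pos t).ne', one_smul]

/-- Integration by parts in an oscillatory integral with phase `1/r`. -/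
theorem enorm_integral_oscillatory_le {F F' : ℝ → ℝ}
    (hF : ∀ r : ℝ, 0 < r → HasDerivAt F (F' r) r) {lam : ℂ} (hlam : 0 ≤ lam.re) (hlam0 : lam ≠ 0)
    {τ : ℝ} (hτ : 0 < τ) :
    ‖∫ r in Ioi (0 : ℝ), ((r⁻¹ ^ 2 * F r : ℝ) : ℂ) * Complex.exp (-lam * ((r⁻¹ * τ : ℝ) : ℂ))‖ₑ ≤
      ENNReal.ofReal (1 / (‖lam‖ * τ)) *
        ((∫⁻ r in Ioi (0 : ℝ), ‖F' r‖ₑ) + ∫⁻ r in Ioi (0 : ℝ), ‖r⁻¹ * F r‖ₑ) := by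
  have hl : 0 < ‖lam‖ := norm_pos_iff.2 hlam0
  have hc : 0 < 1 / (‖lam‖ * τ) := by positivity
  set e : ℝ → ℂ := fun r => Complex.exp (-lam * ((r⁻¹ * τ : ℝ) : ℂ)) with he
  have hem : Measurable e := by fun_prop
  have hen : ∀ r : ℝ, 0 < r → ‖e r‖ ≤ 1 := fun r hr => by
    rw [he, Complex.norm_exp, Real.exp_le_one_iff, Complex.mul_re, Complex.ofReal_re,
      Complex.ofReal_im, mul_zero, sub_zero, Complex.neg_re]
    have : 0 < r⁻¹ * τ := by positivity
    nlinarith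
  -- If the integrand is not integrable, its integral is `0` by convention; if a term on the right
  -- is infinite, there is nothing to prove.
  by_cases hint : IntegrableOn (fun r => ((r⁻¹ ^ 2 * F r : ℝ) : ℂ) * e r) (Ioi 0)
  swap
  · rw [integral_undef hint, enorm_zero]; exact zero_le
  by_cases hfin1 : ∫⁻ r in Ioi (0 : ℝ), ‖F' r‖ₑ = ∞
  · rw [hfin1, top_add, ENNReal.mul_top (by simpa using hc)]; exact le_top
  by_cases hfin2 : ∫⁻ r in Ioi (0 : ℝ), ‖r⁻¹ * F r‖ₑ = ∞
  · rw [hfin2, add_top, ENNReal.mul_top (by simpa using hc)]; exact le_top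
  have hFm : AEStronglyMeasurable F (volume.restrict (Ioi 0)) :=
    ContinuousOn.aestronglyMeasurable
      (fun r hr => (hF r hr).continuousAt.continuousWithinAt) measurableSet_Ioi
  have hF'm : AEStronglyMeasurable F' (volume.restrict (Ioi 0)) := by
    refine (measurable_deriv F).aestronglyMeasurable.congr ?_
    filter_upwards [ae_restrict_mem measurableSet_Ioi] with r hr
    exact (hF r hr).deriv
  have hF'e : IntegrableOn (fun r => (F' r : ℂ) * e r) (Ioi 0) := by
    have h1 : IntegrableOn F' (Ioi 0) := ⟨hF'm, lt_top_iff_ne_top.2 hfin1⟩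
    refine Integrable.mul_bdd (c := 1) h1.ofReal hem.aestronglyMeasurable ?_
    filter_upwards [ae_restrict_mem measurableSet_Ioi] with r hr using hen r hr
  -- The phase satisfies `e' = λτ r⁻² e`, so the oscillatory integrand is `(λτ)⁻¹` times `F e'`.
  have hP : ∀ r : ℝ, 0 < r → HasDerivAt (fun r => (F r : ℂ) * e r)
      ((F' r : ℂ) * e r + (lam * τ) * (((r⁻¹ ^ 2 * F r : ℝ) : ℂ) * e r)) r := by
    intro r hr
    have h1 : HasDerivAt (fun r => (F r : ℂ)) (F' r : ℂ) r := (hF r hr).ofReal_comp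
    have h2 : HasDerivAt (fun r : ℝ => ((r⁻¹ * τ : ℝ) : ℂ)) ((-(r ^ 2)⁻¹ * τ : ℝ) : ℂ) r :=
      ((hasDerivAt_inv hr.ne').mul_const τ).ofReal_comp
    have h3 : HasDerivAt e (e r * (-lam * ((-(r ^ 2)⁻¹ * τ : ℝ) : ℂ))) r :=
      (h2.const_mul (-lam)).cexp
    refine (h1.mul h3).congr_deriv ?_
    push_cast
    ring
  have h0 := integral_Ioi_deriv_eq_zero hP (hF'e.add (hint.const_mul _)) (by
    have h1 : IntegrableOn (fun r => r⁻¹ * F r) (Ioi 0) :=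
      ⟨(by fun_prop : Measurable fun r : ℝ => r⁻¹).aestronglyMeasurable.mul hFm,
        lt_top_iff_ne_top.2 hfin2⟩
    have h2 : IntegrableOn (fun r => ((r⁻¹ * F r : ℝ) : ℂ) * e r) (Ioi 0) := by
      refine Integrable.mul_bdd (c := 1) h1.ofReal hem.aestronglyMeasurable ?_
      filter_upwards [ae_restrict_mem measurableSet_Ioi] with r hr using hen r hr
    refine h2.congr (Eventually.of_forall fun r => ?_)
    simp only [Complex.real_smul]
    push_cast
    ring)
  rw [integral_add hF'e (hint.const_mul _), integral_const_mul] at h0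
  have hlt : lam * (τ : ℂ) ≠ 0 := mul_ne_zero hlam0 (by exact_mod_cast hτ.ne')
  have hI : ∫ r in Ioi (0 : ℝ), ((r⁻¹ ^ 2 * F r : ℝ) : ℂ) * e r =
      -(lam * τ)⁻¹ * ∫ r in Ioi (0 : ℝ), (F' r : ℂ) * e r := by
    rw [eq_comm, neg_mul, neg_eq_iff_eq_neg, inv_mul_eq_iff_eq_mul₀ hlt]
    linear_combination h0
  rw [hI, enorm_mul, ← ofReal_norm (-(lam * (τ : ℂ))⁻¹), norm_neg, norm_inv, norm_mul,
    Complex.norm_real, Real.norm_of_nonneg hτ.le, one_div]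
  refine mul_le_mul_right ?_ _
  -- Only the integral of `|F'|` is left to estimate. The second summand matters through its
  -- finiteness, which removed the boundary terms.
  refine (enorm_integral_le_lintegral_enorm _).trans (le_trans ?_ le_self_add)
  refine setLIntegral_mono' measurableSet_Ioi fun r hr => ?_
  rw [enorm_mul, ← ofReal_norm (e r), ← ofReal_norm ((F' r : ℝ) : ℂ), Complex.norm_real,
    ofReal_norm]
  exact mul_le_of_le_one_right zero_le (ENNReal.ofReal_le_one.2 (hen r hr))

end OneDim

/-! ### Moving the radial integral innermost -/

section Fubini

variable {A B E : Type*} [MeasurableSpace A] [MeasurableSpace B] [MeasurableSpace E]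
  {a : Measure A} {b : Measure B} {m : Measure E} [SFinite a] [SFinite b] [SFinite m]

/-- Absolute values are taken in the directions `x` and in `w` only, so the cancellation in the
radial variable `r` is preserved. -/
theorem enorm_integral_prod_le {G : (A × B) × E → ℂ} (hG : Integrable G ((a.prod b).prod m)) :
    ‖∫ q, ∫ w, G (q, w) ∂m ∂(a.prod b)‖ₑ ≤
      ∫⁻ x, ∫⁻ w, ‖∫ r, G ((x, r), w) ∂b‖ₑ ∂m ∂a := by
  have h1 : Integrable (fun q => ∫ w, G (q, w) ∂m) (a.prod b) := hG.integral_prod_left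
  rw [integral_prod _ h1]
  refine (enorm_integral_le_lintegral_enorm _).trans (lintegral_mono_ae ?_)
  have h2 : Integrable (fun z : A × (B × E) => G ((z.1, z.2.1), z.2.2)) (a.prod (b.prod m)) := by
    have hmp := (measurePreserving_prodAssoc a b m).symm
    exact hmp.integrable_comp_of_integrable hG
  filter_upwards [h2.prod_right_ae] with x hx
  rw [integral_integral_swap hx]
  exact enorm_integral_le_lintegral_enorm _

end Fubini

/-! ### Derivatives of the kernel along rays and their majorant -/

section RadialDerivative

/-- Joint measurability of a one-sided derivative with respect to the last variable. -/
theorem measurable_indicator_deriv {A : Type*} [MeasurableSpace A] {f : A × ℝ → ℝ}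
    (hf : Measurable f) (hd : ∀ a, ∀ r : ℝ, 0 < r → DifferentiableAt ℝ (fun r => f (a, r)) r) :
    Measurable fun p : A × ℝ => (Ioi (0 : ℝ)).indicator (deriv fun r => f (p.1, r)) p.2 := by
  have hI : MeasurableSet {p : A × ℝ | 0 < p.2} := measurableSet_lt measurable_const measurable_snd
  refine measurable_of_tendsto_metrizable (f := fun (n : ℕ) (p : A × ℝ) =>
    {p : A × ℝ | 0 < p.2}.indicator
      (fun p => ((n : ℝ) + 1) * (f (p.1, p.2 + ((n : ℝ) + 1)⁻¹) - f p)) p) (fun n => ?_) ?_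
  · exact Measurable.indicator (by fun_prop) hI
  · refine tendsto_pi_nhds.2 fun p => ?_
    by_cases hp : 0 < p.2
    · rw [indicator_of_mem (show p.2 ∈ Ioi (0 : ℝ) from hp)]
      have h1 := (hd p.1 p.2 hp).hasDerivAt.tendsto_slope_zero
      have h2 : Tendsto (fun n : ℕ => ((n : ℝ) + 1)⁻¹) atTop (𝓝[≠] 0) := by
        refine tendsto_nhdsWithin_iff.2 ⟨?_, Eventually.of_forall fun n => ?_⟩
        · simpa [one_div] using tendsto_one_div_add_atTop_nhds_zero_nat (𝕜 := ℝ)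
        · have : (0 : ℝ) < (n : ℝ) + 1 := by positivity
          exact (inv_pos.2 this).ne'
      refine (h1.comp h2).congr fun n => ?_
      rw [indicator_of_mem (show p ∈ {p : A × ℝ | 0 < p.2} from hp)]
      simp
    · rw [indicator_of_notMem (show p.2 ∉ Ioi (0 : ℝ) from hp)]
      refine tendsto_const_nhds.congr fun n => ?_
      rw [indicator_of_notMem (show p ∉ {p : A × ℝ | 0 < p.2} from hp)]

end RadialDerivative

section RadialKernel

variable {Ω : Set (Space d)} {α : ℝ} {m : Measure (Space d)} {w : ℝ → ℝ}
  {k : Space d → Space d → Space d → ℝ}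

theorem smul_mem_outgoing (hV : m.support = univ) {x v : Space d} {r : ℝ} (hr : 0 < r) :
    r • v ∈ outgoing Ω m x ↔ v ∈ outgoing Ω m x := by
  simp only [outgoing, hV, mem_univ, true_and, mem_ofPred_eq, inner_smul_left, conj_trivial,
    mul_pos_iff_of_pos_left hr]

theorem smul_mem_incoming (hV : m.support = univ) {x v : Space d} {r : ℝ} (hr : 0 < r) :
    r • v ∈ incoming Ω m x ↔ v ∈ incoming Ω m x := by
  simp only [incoming, hV, mem_univ, true_and, mem_ofPred_eq, inner_smul_left, conj_trivial,
    ← neg_pos (a := r * _), ← mul_neg, mul_pos_iff_of_pos_left hr, neg_pos]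

/-- The radial derivative of the kernel in its last argument. -/
def radialDerivThree (Ω : Set (Space d)) (m : Measure (Space d))
    (k : Space d → Space d → Space d → ℝ) (x v σ : Space d) (r : ℝ) : ℝ :=
  (Ioi (0 : ℝ)).indicator (deriv fun r => zeroExt Ω m k x v (r • σ)) r

/-- The radial derivative of the kernel in its second argument. -/
def radialDerivTwo (Ω : Set (Space d)) (m : Measure (Space d))
    (k : Space d → Space d → Space d → ℝ) (y u σ : Space d) (r : ℝ) : ℝ :=
  (Ioi (0 : ℝ)).indicator (deriv fun r => zeroExt Ω m k y (r • σ) u) r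

theorem hasDerivAt_comp_smul {f : Space d → ℝ} {σ : Space d} {r : ℝ}
    (hf : DifferentiableAt ℝ f (r • σ)) :
    HasDerivAt (fun r : ℝ => f (r • σ)) (fderiv ℝ f (r • σ) σ) r := by
  have h1 : HasDerivAt (fun r : ℝ => r • σ) σ r := by
    simpa using (hasDerivAt_id r).smul_const σ
  exact hf.hasFDerivAt.comp_hasDerivAt r h1

theorem abs_fderiv_apply_le {f : Space d → ℝ} {σ z : Space d} (hσ : ‖σ‖ = 1) :
    |fderiv ℝ f z σ| ≤ ‖gradient f z‖ := by
  have := (fderiv ℝ f z).le_opNorm σ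
  rwa [hσ, mul_one, Real.norm_eq_abs, ← norm_gradient] at this

theorem RegularKernel.hasDerivAt_three_of_mem (hk : RegularKernel Ω m w k)
    (hV : m.support = univ) {x v σ : Space d} (hx : x ∈ frontier Ω) (hv : v ∈ incoming Ω m x)
    (hσ : σ ∈ outgoing Ω m x) {r : ℝ} (hr : 0 < r) :
    HasDerivAt (fun r : ℝ => zeroExt Ω m k x v (r • σ))
      (fderiv ℝ (fun u => k x v u) (r • σ) σ) r := by
  have h1 := hasDerivAt_comp_smul
    (hk.diff_three (x, v, r • σ) ⟨hx, hv, (smul_mem_outgoing hV hr).2 hσ⟩)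
  refine h1.congr_of_eventuallyEq ?_
  filter_upwards [Ioi_mem_nhds hr] with s hs
  exact zeroExt_of_mem hx hv ((smul_mem_outgoing hV hs).2 hσ)

theorem RegularKernel.hasDerivAt_two_of_mem (hk : RegularKernel Ω m w k)
    (hV : m.support = univ) {y u σ : Space d} (hy : y ∈ frontier Ω) (hu : u ∈ outgoing Ω m y)
    (hσ : σ ∈ incoming Ω m y) {r : ℝ} (hr : 0 < r) :
    HasDerivAt (fun r : ℝ => zeroExt Ω m k y (r • σ) u)
      (fderiv ℝ (fun v => k y v u) (r • σ) σ) r := by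
  have h1 := hasDerivAt_comp_smul
    (hk.diff_two (y, r • σ, u) ⟨hy, (smul_mem_incoming hV hr).2 hσ, hu⟩)
  refine h1.congr_of_eventuallyEq ?_
  filter_upwards [Ioi_mem_nhds hr] with s hs
  exact zeroExt_of_mem hy ((smul_mem_incoming hV hs).2 hσ) hu

/-- Incoming and outgoing velocities form cones, so a whole ray lies either inside or outside the
domain of the kernel. The extension by zero therefore creates no jump along it. -/
theorem RegularKernel.differentiableAt_three (hk : RegularKernel Ω m w k)
    (hV : m.support = univ) (x v σ : Space d) {r : ℝ} (hr : 0 < r) :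
    DifferentiableAt ℝ (fun r : ℝ => zeroExt Ω m k x v (r • σ)) r := by
  by_cases hc : x ∈ frontier Ω ∧ v ∈ incoming Ω m x ∧ σ ∈ outgoing Ω m x
  · exact (hk.hasDerivAt_three_of_mem hV hc.1 hc.2.1 hc.2.2 hr).differentiableAt
  · refine (differentiableAt_const (0 : ℝ)).congr_of_eventuallyEq ?_
    filter_upwards [Ioi_mem_nhds hr] with s hs
    by_contra h0
    obtain ⟨a, b, c⟩ := mem_of_zeroExt_ne_zero h0
    exact hc ⟨a, b, (smul_mem_outgoing hV hs).1 c⟩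

theorem RegularKernel.differentiableAt_two (hk : RegularKernel Ω m w k)
    (hV : m.support = univ) (y u σ : Space d) {r : ℝ} (hr : 0 < r) :
    DifferentiableAt ℝ (fun r : ℝ => zeroExt Ω m k y (r • σ) u) r := by
  by_cases hc : y ∈ frontier Ω ∧ σ ∈ incoming Ω m y ∧ u ∈ outgoing Ω m y
  · exact (hk.hasDerivAt_two_of_mem hV hc.1 hc.2.2 hc.2.1 hr).differentiableAt
  · refine (differentiableAt_const (0 : ℝ)).congr_of_eventuallyEq ?_
    filter_upwards [Ioi_mem_nhds hr] with s hs
    by_contra h0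
    obtain ⟨a, b, c⟩ := mem_of_zeroExt_ne_zero h0
    exact hc ⟨a, (smul_mem_incoming hV hs).1 b, c⟩

/-- The density bounding the terms of `bound_two`. -/
def majTwo (Ω : Set (Space d)) (m : Measure (Space d)) (w : ℝ → ℝ)
    (k : Space d → Space d → Space d → ℝ) (y u σ : Space d) (r : ℝ) : ℝ≥0∞ :=
  ENNReal.ofReal (r ^ (d + 1) *
    (r * (Ioi (0 : ℝ)).indicator w r * |radialDerivTwo Ω m k y u σ r| +
      zeroExt Ω m k y (r • σ) u * (r * |deriv w r| + (Ioi (0 : ℝ)).indicator w r)))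

/-- The weight appearing in `bound_three`. -/
def majThree (Ω : Set (Space d)) (m : Measure (Space d)) (w : ℝ → ℝ)
    (k : Space d → Space d → Space d → ℝ) (y u σ : Space d) (r : ℝ) : ℝ≥0∞ :=
  ENNReal.ofReal (r ^ (d + 2) * (Ioi (0 : ℝ)).indicator w r * zeroExt Ω m k y (r • σ) u)

/-- The majorant of the radial derivative of the iterated kernel. -/
def majorant (Ω : Set (Space d)) (m : Measure (Space d)) (w : ℝ → ℝ)
    (k : Space d → Space d → Space d → ℝ) (x y v σ u : Space d) (r : ℝ) : ℝ≥0∞ :=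
  (d + 3 : ℕ) * (ENNReal.ofReal (zeroExt Ω m k x v (r • σ)) * majTwo Ω m w k y u σ r) +
    majThree Ω m w k y u σ r * ENNReal.ofReal |radialDerivThree Ω m k x v σ r|

theorem RegularKernel.lintegral_majTwo_le (hk : RegularKernel Ω m w k) (hV : m.support = univ) :
    ∃ B : ℝ≥0, ∀ y ∈ frontier Ω, ∀ u ∈ outgoing Ω m y, ∀ σ : Space d, ‖σ‖ = 1 →
      σ ∈ incoming Ω m y → ∫⁻ r in Ioi (0 : ℝ), majTwo Ω m w k y u σ r ≤ B := by
  obtain ⟨B, hB⟩ := hk.bound_two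
  refine ⟨B, fun y hy u hu σ hσ hσi => le_trans ?_ (hB y hy u hu σ hσ hσi.2)⟩
  refine setLIntegral_mono' measurableSet_Ioi fun r hr => ENNReal.ofReal_le_ofReal ?_
  have hr' : 0 < r := hr
  have hw := (hk.profile_pos r hr).le
  have h1 : |radialDerivTwo Ω m k y u σ r| ≤ ‖gradient (fun v => k y v u) (r • σ)‖ := by
    rw [radialDerivTwo, indicator_of_mem hr, (hk.hasDerivAt_two_of_mem hV hy hu hσi hr).deriv]
    exact abs_fderiv_apply_le hσ
  rw [indicator_of_mem hr, zeroExt_of_mem hy ((smul_mem_incoming hV hr).2 hσi) hu]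
  gcongr

theorem RegularKernel.lintegral_majThree_le (hk : RegularKernel Ω m w k) (hV : m.support = univ) :
    ∃ B : ℝ≥0, ∀ x ∈ frontier Ω, ∀ y ∈ frontier Ω, ∀ u ∈ outgoing Ω m y, ∀ σ : Space d, ‖σ‖ = 1 →
      σ ∈ outgoing Ω m x → σ ∈ incoming Ω m y →
      ∫⁻ r in Ioi (0 : ℝ), majThree Ω m w k y u σ r *
        ∫⁻ v, inWeight Ω m x v * ENNReal.ofReal |radialDerivThree Ω m k x v σ r| ∂m ≤ B := by
  obtain ⟨B, hB⟩ := hk.bound_three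
  refine ⟨B, fun x hx y hy u hu σ hσ hσo hσi =>
    le_trans ?_ (hB x hx y hy u hu σ hσ hσo.2 hσi.2)⟩
  have hin : MeasurableSet (incoming Ω m x) :=
    Measure.isClosed_support.measurableSet.inter
      (measurableSet_lt (f := fun v => inner ℝ v (normal Ω x)) (by fun_prop) measurable_const)
  refine setLIntegral_mono' measurableSet_Ioi fun r hr => ?_
  rw [majThree, indicator_of_mem hr, zeroExt_of_mem hy ((smul_mem_incoming hV hr).2 hσi) hu]
  refine mul_le_mul_right ?_ _
  rw [← lintegral_indicator hin]
  refine lintegral_mono fun v => ?_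
  by_cases hv : v ∈ incoming Ω m x
  · rw [indicator_of_mem hv, inWeight, indicator_of_mem (show (x, v) ∈ gammaMinus Ω m from ⟨hx, hv⟩),
      mul_comm, ENNReal.ofReal_mul (norm_nonneg _)]
    refine mul_le_mul_left (ENNReal.ofReal_le_ofReal ?_) _
    rw [radialDerivThree, indicator_of_mem hr,
      (hk.hasDerivAt_three_of_mem hV hx hv hσo hr).deriv]
    exact abs_fderiv_apply_le hσ
  · rw [inWeight, indicator_of_notMem (show (x, v) ∉ gammaMinus Ω m from fun hh => hv hh.2), zero_mul]
    exact zero_le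

section Measurability

variable (h : HasHolderBoundary Ω α) (hΩ : IsOpen Ω) {A : Type*} [MeasurableSpace A]
include h hΩ

theorem RegularKernel.measurable_zeroExt_comp (hk : RegularKernel Ω m w k) {a b c : A → Space d}
    (ha : Measurable a) (hb : Measurable b) (hc : Measurable c) :
    Measurable fun z => zeroExt Ω m k (a z) (b z) (c z) := by
  have := (hk.measurable_zeroExt h hΩ).comp (ha.prodMk (hb.prodMk hc))
  exact this

theorem RegularKernel.measurable_radialDerivThree_comp (hk : RegularKernel Ω m w k)
    (hV : m.support = univ) {a b c : A → Space d} {r : A → ℝ}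
    (ha : Measurable a) (hb : Measurable b) (hc : Measurable c) (hr : Measurable r) :
    Measurable fun z => radialDerivThree Ω m k (a z) (b z) (c z) (r z) := by
  have h1 : Measurable fun p : (Space d × Space d × Space d) × ℝ =>
      zeroExt Ω m k p.1.1 p.1.2.1 (p.2 • p.1.2.2) :=
    hk.measurable_zeroExt_comp h hΩ (by fun_prop) (by fun_prop) (by fun_prop)
  have h2 := (measurable_indicator_deriv h1
    fun p r hr => hk.differentiableAt_three hV p.1 p.2.1 p.2.2 hr).comp
    ((ha.prodMk (hb.prodMk hc)).prodMk hr)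
  exact h2

theorem RegularKernel.measurable_radialDerivTwo_comp (hk : RegularKernel Ω m w k)
    (hV : m.support = univ) {a b c : A → Space d} {r : A → ℝ}
    (ha : Measurable a) (hb : Measurable b) (hc : Measurable c) (hr : Measurable r) :
    Measurable fun z => radialDerivTwo Ω m k (a z) (b z) (c z) (r z) := by
  have h1 : Measurable fun p : (Space d × Space d × Space d) × ℝ =>
      zeroExt Ω m k p.1.1 (p.2 • p.1.2.2) p.1.2.1 :=
    hk.measurable_zeroExt_comp h hΩ (by fun_prop) (by fun_prop) (by fun_prop)
  have h2 := (measurable_indicator_deriv h1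
    fun p r hr => hk.differentiableAt_two hV p.1 p.2.1 p.2.2 hr).comp
    ((ha.prodMk (hb.prodMk hc)).prodMk hr)
  exact h2

theorem RegularKernel.measurable_majTwo_comp (hk : RegularKernel Ω m w k)
    (hV : m.support = univ) {y u σ : A → Space d} {r : A → ℝ}
    (hy : Measurable y) (hu : Measurable u) (hσ : Measurable σ) (hr : Measurable r) :
    Measurable fun z => majTwo Ω m w k (y z) (u z) (σ z) (r z) := by
  have h1 := hk.measurable_radialDerivTwo_comp h hΩ hV hy hu hσ hr
  have h2 : Measurable fun z => zeroExt Ω m k (y z) (r z • σ z) (u z) :=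
    hk.measurable_zeroExt_comp h hΩ hy (hr.smul hσ) hu
  have h3 := measurable_indicator_of_differentiableAt hk.profile_diff
  have h4 := measurable_deriv w
  have h5 : Measurable fun z => (Ioi (0 : ℝ)).indicator w (r z) := h3.comp hr
  have h6 : Measurable fun z => deriv w (r z) := h4.comp hr
  have h7 : Measurable fun z => |deriv w (r z)| := continuous_abs.measurable.comp h6
  have h8 : Measurable fun z => |radialDerivTwo Ω m k (y z) (u z) (σ z) (r z)| :=
    continuous_abs.measurable.comp h1
  have h9 := ((hr.pow_const (d + 1)).mul (((hr.mul h5).mul h8).add (h2.mul ((hr.mul h7).add h5))))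
  exact h9.ennreal_ofReal

theorem RegularKernel.measurable_majThree_comp (hk : RegularKernel Ω m w k)
    {y u σ : A → Space d} {r : A → ℝ}
    (hy : Measurable y) (hu : Measurable u) (hσ : Measurable σ) (hr : Measurable r) :
    Measurable fun z => majThree Ω m w k (y z) (u z) (σ z) (r z) := by
  have h2 : Measurable fun z => zeroExt Ω m k (y z) (r z • σ z) (u z) :=
    hk.measurable_zeroExt_comp h hΩ hy (hr.smul hσ) hu
  have h3 := measurable_indicator_of_differentiableAt hk.profile_diff
  have h5 : Measurable fun z => (Ioi (0 : ℝ)).indicator w (r z) := h3.comp hr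
  have h9 := (((hr.pow_const (d + 2)).mul h5).mul h2)
  exact h9.ennreal_ofReal

theorem RegularKernel.measurable_majorant_comp (hk : RegularKernel Ω m w k)
    (hV : m.support = univ) {x y v σ u : A → Space d} {r : A → ℝ} (hx : Measurable x)
    (hy : Measurable y) (hv : Measurable v) (hσ : Measurable σ) (hu : Measurable u)
    (hr : Measurable r) :
    Measurable fun z => majorant Ω m w k (x z) (y z) (v z) (σ z) (u z) (r z) := by
  have h1 := hk.measurable_majTwo_comp h hΩ hV hy hu hσ hr
  have h2 := hk.measurable_majThree_comp h hΩ hy hu hσ hr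
  have h3 : Measurable fun z => zeroExt Ω m k (x z) (v z) (r z • σ z) :=
    hk.measurable_zeroExt_comp h hΩ hx hv (hr.smul hσ)
  have h4 := hk.measurable_radialDerivThree_comp h hΩ hV hx hv hσ hr
  have h5 : Measurable fun z => |radialDerivThree Ω m k (x z) (v z) (σ z) (r z)| :=
    continuous_abs.measurable.comp h4
  have h6 := ((h3.ennreal_ofReal.mul h1).const_mul ((d + 3 : ℕ) : ℝ≥0∞)).add
    (h2.mul h5.ennreal_ofReal)
  exact h6

theorem HasHolderBoundary.measurable_inWeight_comp {a b : A → Space d} (ha : Measurable a)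
    (hb : Measurable b) : Measurable fun z => inWeight Ω m (a z) (b z) := by
  have := (h.measurable_inWeight hΩ (m := m)).comp (ha.prodMk hb)
  exact this

theorem HasHolderBoundary.measurable_outWeight_comp {a b : A → Space d} (ha : Measurable a)
    (hb : Measurable b) : Measurable fun z => outWeight Ω m (a z) (b z) := by
  have := (h.measurable_outWeight hΩ (m := m)).comp (ha.prodMk hb)
  exact this

/-- The majorant is integrable, uniformly with respect to the parameters. -/
theorem RegularKernel.lintegral_majorant_le (hk : RegularKernel Ω m w k) (hV : m.support = univ)
    [SFinite m] :
    ∃ C : ℝ≥0, ∀ x ∈ frontier Ω, ∀ y ∈ frontier Ω, ∀ u ∈ outgoing Ω m y, ∀ σ : Space d, ‖σ‖ = 1 →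
      σ ∈ outgoing Ω m x → σ ∈ incoming Ω m y →
      ∫⁻ v, inWeight Ω m x v * (∫⁻ r in Ioi (0 : ℝ), majorant Ω m w k x y v σ u r) ∂m ≤ C := by
  obtain ⟨B, hB⟩ := hk.lintegral_majTwo_le hV
  obtain ⟨B', hB'⟩ := hk.lintegral_majThree_le hV
  refine ⟨(d + 3 : ℕ) * B + B', fun x hx y hy u hu σ hσ hσo hσi => ?_⟩
  have hMaj : Measurable fun q : Space d × ℝ => majorant Ω m w k x y q.1 σ u q.2 :=
    hk.measurable_majorant_comp h hΩ hV measurable_const measurable_const measurable_fst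
      measurable_const measurable_const measurable_snd
  have hin : Measurable fun v => inWeight Ω m x v :=
    h.measurable_inWeight_comp hΩ measurable_const measurable_id
  have hin2 : Measurable fun q : Space d × ℝ => inWeight Ω m x q.1 :=
    h.measurable_inWeight_comp hΩ measurable_const measurable_fst
  have h2 : Measurable fun r => majTwo Ω m w k y u σ r :=
    hk.measurable_majTwo_comp h hΩ hV measurable_const measurable_const measurable_const
      measurable_id
  have h3 : Measurable fun r => majThree Ω m w k y u σ r :=
    hk.measurable_majThree_comp h hΩ measurable_const measurable_const measurable_const
      measurable_id
  have hz : ∀ r : ℝ, Measurable fun v => zeroExt Ω m k x v (r • σ) := fun r =>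
    hk.measurable_zeroExt_comp h hΩ measurable_const measurable_id measurable_const
  have hd3 : ∀ r : ℝ, Measurable fun v => |radialDerivThree Ω m k x v σ r| := fun r =>
    (continuous_abs.measurable.comp (hk.measurable_radialDerivThree_comp h hΩ hV measurable_const
      measurable_id measurable_const measurable_const) :)
  -- The emitted velocity `v` is integrated before the speed. In the first part of the majorant
  -- normalization then removes `k(x,v,rσ)`, leaving the quantity in `bound_two`; the second part
  -- becomes the quantity in `bound_three`.
  have hswap := lintegral_lintegral_swap (μ := m) (ν := volume.restrict (Ioi (0 : ℝ)))
    (f := fun v r => inWeight Ω m x v * majorant Ω m w k x y v σ u r) (hin2.mul hMaj).aemeasurable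
  have hpull : ∀ v, inWeight Ω m x v * ∫⁻ r in Ioi (0 : ℝ), majorant Ω m w k x y v σ u r =
      ∫⁻ r in Ioi (0 : ℝ), inWeight Ω m x v * majorant Ω m w k x y v σ u r := fun v => by
    have hs := hMaj.comp (measurable_prodMk_left (x := v))
    exact (lintegral_const_mul _ hs).symm
  have hinner : ∀ r, ∫⁻ v, inWeight Ω m x v * majorant Ω m w k x y v σ u r ∂m ≤
      (d + 3 : ℕ) * majTwo Ω m w k y u σ r + majThree Ω m w k y u σ r *
        ∫⁻ v, inWeight Ω m x v * ENNReal.ofReal |radialDerivThree Ω m k x v σ r| ∂m := fun r => by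
    have e : ∀ v, inWeight Ω m x v * majorant Ω m w k x y v σ u r =
        ((d + 3 : ℕ) * majTwo Ω m w k y u σ r) *
          (inWeight Ω m x v * ENNReal.ofReal (zeroExt Ω m k x v (r • σ))) +
        majThree Ω m w k y u σ r *
          (inWeight Ω m x v * ENNReal.ofReal |radialDerivThree Ω m k x v σ r|) := fun v => by
      rw [majorant]; ring
    have m1 : Measurable fun v => inWeight Ω m x v *
        ENNReal.ofReal (zeroExt Ω m k x v (r • σ)) := hin.mul (hz r).ennreal_ofReal
    have m2 : Measurable fun v => inWeight Ω m x v *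
        ENNReal.ofReal |radialDerivThree Ω m k x v σ r| := hin.mul (hd3 r).ennreal_ofReal
    calc ∫⁻ v, inWeight Ω m x v * majorant Ω m w k x y v σ u r ∂m
        = ((d + 3 : ℕ) * majTwo Ω m w k y u σ r) *
          (∫⁻ v, inWeight Ω m x v * ENNReal.ofReal (zeroExt Ω m k x v (r • σ)) ∂m) +
        majThree Ω m w k y u σ r *
          ∫⁻ v, inWeight Ω m x v * ENNReal.ofReal |radialDerivThree Ω m k x v σ r| ∂m := by
          rw [lintegral_congr e, lintegral_add_left (m1.const_mul _)]
          congr 1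
          · exact lintegral_const_mul _ m1
          · exact lintegral_const_mul _ m2
      _ ≤ _ := by
          exact add_le_add_left
            (mul_le_of_le_one_right zero_le (hk.lintegral_inWeight_le x (r • σ))) _
  calc ∫⁻ v, inWeight Ω m x v * (∫⁻ r in Ioi (0 : ℝ), majorant Ω m w k x y v σ u r) ∂m
      = ∫⁻ r in Ioi (0 : ℝ), ∫⁻ v, inWeight Ω m x v * majorant Ω m w k x y v σ u r ∂m := by
        rw [lintegral_congr hpull]; exact hswap
    _ ≤ ∫⁻ r in Ioi (0 : ℝ), ((d + 3 : ℕ) * majTwo Ω m w k y u σ r + majThree Ω m w k y u σ r *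
        ∫⁻ v, inWeight Ω m x v * ENNReal.ofReal |radialDerivThree Ω m k x v σ r| ∂m) :=
        lintegral_mono hinner
    _ = (d + 3 : ℕ) * (∫⁻ r in Ioi (0 : ℝ), majTwo Ω m w k y u σ r) +
        ∫⁻ r in Ioi (0 : ℝ), majThree Ω m w k y u σ r *
        ∫⁻ v, inWeight Ω m x v * ENNReal.ofReal |radialDerivThree Ω m k x v σ r| ∂m := by
        rw [lintegral_add_left (h2.const_mul _)]
        congr 1
        exact lintegral_const_mul _ h2
    _ ≤ _ := by
        push_cast
        gcongr
        · have := hB y hy u hu σ hσ hσi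
          exact this
        · exact hB' x hx y hy u hu σ hσ hσo hσi

end Measurability

/-- The oscillatory radial integral in the iterated kernel. -/
theorem RegularKernel.enorm_radial_integral_le (hk : RegularKernel Ω m w k)
    (hV : m.support = univ) {lam : ℂ} (hlam : 0 ≤ lam.re) (hlam0 : lam ≠ 0) (x y v σ u : Space d)
    {τ : ℝ} (hτ : 0 < τ) :
    ‖∫ r in Ioi (0 : ℝ), ((r⁻¹ ^ 2 * (r ^ (d + 2) * w r * (zeroExt Ω m k x v (r • σ) *
        zeroExt Ω m k y (r • σ) u)) : ℝ) : ℂ) * Complex.exp (-lam * ((r⁻¹ * τ : ℝ) : ℂ))‖ₑ ≤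
      ENNReal.ofReal (1 / (‖lam‖ * τ)) *
        ∫⁻ r in Ioi (0 : ℝ), majorant Ω m w k x y v σ u r := by
  have hF : ∀ r : ℝ, 0 < r → HasDerivAt (fun r => r ^ (d + 2) * w r *
      (zeroExt Ω m k x v (r • σ) * zeroExt Ω m k y (r • σ) u))
      ((((d + 2 : ℕ) : ℝ) * r ^ (d + 1) * w r + r ^ (d + 2) * deriv w r) *
        (zeroExt Ω m k x v (r • σ) * zeroExt Ω m k y (r • σ) u) + r ^ (d + 2) * w r *
        (radialDerivThree Ω m k x v σ r * zeroExt Ω m k y (r • σ) u +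
          zeroExt Ω m k x v (r • σ) * radialDerivTwo Ω m k y u σ r)) r := fun r hr => by
    have h1 := (hk.differentiableAt_three hV x v σ hr).hasDerivAt
    have h2 := (hk.differentiableAt_two hV y u σ hr).hasDerivAt
    have h3 := (hasDerivAt_pow (d + 2) r).mul (hk.profile_diff r hr).hasDerivAt
    rw [radialDerivThree, radialDerivTwo, indicator_of_mem (show r ∈ Ioi (0 : ℝ) from hr),
      indicator_of_mem (show r ∈ Ioi (0 : ℝ) from hr)]
    exact h3.mul (h1.mul h2)
  refine (enorm_integral_oscillatory_le hF hlam hlam0 hτ).trans (mul_le_mul_right ?_ _)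
  refine (le_lintegral_add _ _).trans (setLIntegral_mono' measurableSet_Ioi fun r hr => ?_)
  have hr' : 0 < r := hr
  have hw := hk.profile_pos r hr
  rw [majorant, majTwo, majThree, indicator_of_mem hr]
  set a := zeroExt Ω m k x v (r • σ) with ha
  set b := zeroExt Ω m k y (r • σ) u with hb
  set p := radialDerivThree Ω m k x v σ r
  set q := radialDerivTwo Ω m k y u σ r
  have ha0 : 0 ≤ a := hk.zeroExt_nonneg _ _ _
  have hb0 : 0 ≤ b := hk.zeroExt_nonneg _ _ _
  rw [← ofReal_norm, ← ofReal_norm, ← ENNReal.ofReal_natCast, ← ENNReal.ofReal_mul ha0,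
    ← ENNReal.ofReal_mul (by positivity), ← ENNReal.ofReal_mul (by positivity),
    ← ENNReal.ofReal_add (norm_nonneg _) (norm_nonneg _),
    ← ENNReal.ofReal_add (by positivity) (by positivity)]
  refine ENNReal.ofReal_le_ofReal ?_
  rw [Real.norm_eq_abs, Real.norm_eq_abs]
  have e1 : |r⁻¹ * (r ^ (d + 2) * w r * (a * b))| = r ^ (d + 1) * w r * (a * b) := by
    rw [abs_of_nonneg (by positivity)]
    field_simp
    ring
  have e2 : |(((d + 2 : ℕ) : ℝ) * r ^ (d + 1) * w r + r ^ (d + 2) * deriv w r) * (a * b) +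
      r ^ (d + 2) * w r * (p * b + a * q)| ≤
      (((d + 2 : ℕ) : ℝ) * r ^ (d + 1) * w r + r ^ (d + 2) * |deriv w r|) * (a * b) +
      r ^ (d + 2) * w r * (|p| * b + a * |q|) := by
    refine (abs_add_le _ _).trans (add_le_add ?_ ?_)
    · rw [abs_mul, abs_of_nonneg (mul_nonneg ha0 hb0)]
      refine mul_le_mul_of_nonneg_right ((abs_add_le _ _).trans ?_) (mul_nonneg ha0 hb0)
      rw [abs_of_nonneg (by positivity : (0 : ℝ) ≤ ((d + 2 : ℕ) : ℝ) * r ^ (d + 1) * w r),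
        abs_mul, abs_of_nonneg (by positivity : (0 : ℝ) ≤ r ^ (d + 2))]
    · rw [abs_mul, abs_of_nonneg (by positivity : (0 : ℝ) ≤ r ^ (d + 2) * w r)]
      refine mul_le_mul_of_nonneg_left ((abs_add_le _ _).trans ?_) (by positivity)
      rw [abs_mul, abs_mul, abs_of_nonneg ha0, abs_of_nonneg hb0]
  rw [e1]
  refine (add_le_add_left e2 _).trans ?_
  have h1 : 0 ≤ r ^ (d + 2) * |deriv w r| * (a * b) := by positivity
  have h2 : 0 ≤ r ^ (d + 2) * w r * (a * |q|) := by positivity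
  have hd0 : (0 : ℝ) ≤ d := Nat.cast_nonneg d
  push_cast
  have e3 : r ^ (d + 2) = r ^ (d + 1) * r := pow_succ r (d + 1)
  rw [e3] at h1 h2 ⊢
  -- The factor `d + 3` consists of `d + 2` from differentiating `r ^ (d + 2)` and `1` from the term
  -- `|F|/r`; the other terms need only coefficient one.
  nlinarith [mul_nonneg hd0 h1, mul_nonneg hd0 h2]

end RadialKernel

/-! ### Short chords -/

section GrazingBound

variable {Ω : Set (Space d)} {α : ℝ} {m : Measure (Space d)} {w : ℝ → ℝ}
  {k : Space d → Space d → Space d → ℝ}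
  (h : HasHolderBoundary Ω α) (hΩ : IsOpen Ω) (hb : Bornology.IsBounded Ω)
include h hΩ hb

/-- Short chords are nearly tangential. -/
theorem HasHolderBoundary.exists_inv_travelTime_le (hα : 0 < α) :
    ∃ K : ℝ, 0 ≤ K ∧ ∀ x ∈ frontier Ω, ∀ σ : Space d, ‖σ‖ = 1 → 0 < inner ℝ σ (normal Ω x) →
      inner ℝ σ (normal Ω (exitPoint Ω σ x)) < 0 →
      1 / travelTime Ω x σ ≤ K * |inner ℝ σ (normal Ω (exitPoint Ω σ x))| ^ (-α⁻¹) := by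
  obtain ⟨K, -, hK⟩ := h.exists_holder hΩ hb hα
  refine ⟨(max K 1) ^ α⁻¹, by positivity, fun x hx σ hσ hσx hσy => ?_⟩
  obtain ⟨hτ, hy, -⟩ := h.exit_mem hΩ hb (show x ∈ outSide Ω σ from ⟨hx, hσx⟩)
  set τ := travelTime Ω x σ with hτd
  set y := exitPoint Ω σ x with hyd
  -- On this chord Hölder flatness at `y` reads `τ |σ·n(y)| ≤ K τ ^ (1 + α)`. Dividing by `τ` and
  -- taking the power `1/α` bounds `τ` from below.
  have e : x - y = τ • σ := by rw [hyd, exitPoint, ← hτd]; abel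
  have h1 := hK x hx y hy
  have ha : 0 < |inner ℝ σ (normal Ω y)| := abs_pos.2 hσy.ne
  rw [e, inner_smul_left, conj_trivial, abs_mul, norm_smul, hσ, mul_one, Real.norm_of_nonneg hτ.le,
    abs_of_pos hτ, Real.rpow_add hτ, Real.rpow_one] at h1
  have h2 : |inner ℝ σ (normal Ω y)| ≤ max K 1 * τ ^ α := by
    have : τ * |inner ℝ σ (normal Ω y)| ≤ τ * (K * τ ^ α) := by linarith
    exact (le_of_mul_le_mul_left this hτ).trans
      (mul_le_mul_of_nonneg_right (le_max_left _ _) (by positivity))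
  have h3 := Real.rpow_le_rpow ha.le h2 (inv_nonneg.2 hα.le)
  rw [Real.mul_rpow (by positivity) (by positivity), ← Real.rpow_mul hτ.le,
    mul_inv_cancel₀ hα.ne', Real.rpow_one] at h3
  rw [Real.rpow_neg ha.le, ← div_eq_mul_inv, div_le_div_iff₀ hτ (by positivity), one_mul]
  exact h3

end GrazingBound

/-! ### The iterated operator: absolute convergence and the radial estimate -/

section Iterated

variable {Ω : Set (Space d)} {α : ℝ} {m : Measure (Space d)} {w : ℝ → ℝ}
  {k : Space d → Space d → Space d → ℝ}

/-- The integrand of the iterated operator: emission, free flight, and emission again. -/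
def iterIntegrand (Ω : Set (Space d)) (m : Measure (Space d)) (k : Space d → Space d → Space d → ℝ)
    (lam : ℂ) (ψ : Space d × Space d → ℂ) (x v v' u : Space d) : ℂ :=
  ((zeroExt Ω m k x v v' * |inner ℝ v' (normal Ω x)| : ℝ) : ℂ) *
    (Complex.exp (-lam * (travelTime Ω x v' : ℂ)) *
      (((zeroExt Ω m k (exitPoint Ω v' x) v' u *
        |inner ℝ u (normal Ω (exitPoint Ω v' x))| : ℝ) : ℂ) * ψ (exitPoint Ω v' x, u)))

theorem diffuse_transfer_diffuse (lam : ℂ) (ψ : Space d × Space d → ℂ) (p : Space d × Space d) :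
    diffuse Ω m k (transfer Ω lam (diffuse Ω m k ψ)) p =
      ∫ v', ∫ u, iterIntegrand Ω m k lam ψ p.1 p.2 v' u ∂m ∂m := by
  simp only [iterIntegrand, integral_const_mul]
  rfl

theorem RegularKernel.enorm_iterIntegrand_le (hk : RegularKernel Ω m w k) {lam : ℂ}
    (hlam : 0 ≤ lam.re) (ψ : Space d × Space d → ℂ) (x v v' u : Space d) :
    ‖iterIntegrand Ω m k lam ψ x v v' u‖ₑ ≤
      ENNReal.ofReal (zeroExt Ω m k x v v') * (outWeight Ω m x v' *
        (ENNReal.ofReal (zeroExt Ω m k (exitPoint Ω v' x) v' u) *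
          (outWeight Ω m (exitPoint Ω v' x) u * ‖ψ (exitPoint Ω v' x, u)‖ₑ))) := by
  rw [iterIntegrand, hk.enorm_integrand, enorm_mul, hk.enorm_integrand]
  refine mul_le_mul_right (mul_le_mul_right (mul_le_of_le_one_left zero_le ?_) _) _
  rw [← ofReal_norm]
  exact ENNReal.ofReal_le_one.2 (norm_exp_travelTime_le hlam _ _)

variable (h : HasHolderBoundary Ω α) (hΩ : IsOpen Ω) (hb : Bornology.IsBounded Ω)
include h hΩ hb

theorem RegularKernel.measurable_iterIntegrand (hk : RegularKernel Ω m w k) (lam : ℂ)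
    {ψ : Space d × Space d → ℂ} (hψ : Measurable ψ) (x v : Space d) :
    Measurable fun q : Space d × Space d => iterIntegrand Ω m k lam ψ x v q.1 q.2 := by
  have hpr : Measurable fun q : Space d × Space d => (x, q.1) := by fun_prop
  have ht : Measurable fun q : Space d × Space d => travelTime Ω x q.1 :=
    ((measurable_travelTime hΩ hb).comp hpr :)
  have hy : Measurable fun q : Space d × Space d => exitPoint Ω q.1 x :=
    ((measurable_exitPoint hΩ hb).comp hpr :)
  have hny : Measurable fun q : Space d × Space d => normal Ω (exitPoint Ω q.1 x) :=
    ((h.measurable_normal hΩ).comp hy :)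
  have hz1 : Measurable fun q : Space d × Space d => zeroExt Ω m k x v q.1 :=
    hk.measurable_zeroExt_comp h hΩ measurable_const measurable_const measurable_fst
  have hz2 : Measurable fun q : Space d × Space d => zeroExt Ω m k (exitPoint Ω q.1 x) q.1 q.2 :=
    hk.measurable_zeroExt_comp h hΩ hy measurable_fst measurable_snd
  have hψ' : Measurable fun q : Space d × Space d => ψ (exitPoint Ω q.1 x, q.2) :=
    (hψ.comp (hy.prodMk measurable_snd) :)
  have hi1 : Measurable fun q : Space d × Space d => |inner ℝ q.1 (normal Ω x)| := by fun_prop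
  have hi2 : Measurable fun q : Space d × Space d =>
      |inner ℝ q.2 (normal Ω (exitPoint Ω q.1 x))| := by
    fun_prop
  have he : Measurable fun q : Space d × Space d =>
      Complex.exp (-lam * (travelTime Ω x q.1 : ℂ)) := by fun_prop
  exact (hz1.mul hi1).complex_ofReal.mul (he.mul ((hz2.mul hi2).complex_ofReal.mul hψ'))

/-- Three successive mass bounds, for emission, transport and emission, give absolute convergence
for a.e. `(x, v)`. This justifies Fubini before the oscillation is used. -/
theorem RegularKernel.ae_integrable_iterIntegrand (hk : RegularKernel Ω m w k) [SFinite m] {lam : ℂ}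
    (hlam : 0 ≤ lam.re) {ψ : Space d × Space d → ℂ} (hψ : Measurable ψ)
    (hψi : Integrable ψ (muPlus Ω m)) :
    ∀ᵐ p ∂muMinus Ω m,
      Integrable (fun q : Space d × Space d => iterIntegrand Ω m k lam ψ p.1 p.2 q.1 q.2)
        (m.prod m) := by
  have hz2 := hk.measurable_ofReal_zeroExt h hΩ
  have hout' : Measurable fun q : (Space d × Space d) × Space d =>
      outWeight Ω m q.1.1 q.2 * ‖ψ (q.1.1, q.2)‖ₑ :=
    (((h.measurable_outWeight hΩ (m := m)).mul hψ.enorm).comp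
      ((measurable_fst.comp measurable_fst).prodMk measurable_snd) :)
  have hF : Measurable fun p : Space d × Space d =>
      ∫⁻ u, ENNReal.ofReal (zeroExt Ω m k p.1 p.2 u) * (outWeight Ω m p.1 u * ‖ψ (p.1, u)‖ₑ) ∂m :=
    (hz2.mul hout').lintegral_prod_right'
  set F : Space d × Space d → ℝ≥0∞ := fun p =>
    ∫⁻ u, ENNReal.ofReal (zeroExt Ω m k p.1 p.2 u) * (outWeight Ω m p.1 u * ‖ψ (p.1, u)‖ₑ) ∂m with hFd
  have hFe : Measurable fun p => F (exitMap Ω p) := hF.comp (measurable_exitMap hΩ hb)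
  have hlt : ∫⁻ p, ∫⁻ v', ENNReal.ofReal (zeroExt Ω m k p.1 p.2 v') *
      (outWeight Ω m p.1 v' * F (exitMap Ω (p.1, v'))) ∂m ∂muMinus Ω m < ∞ :=
    (hk.lintegral_diffuse_le h hΩ hFe).trans_lt <| (h.lintegral_exitMap_le hΩ hb hF).trans_lt <|
      (hk.lintegral_diffuse_le h hΩ hψ.enorm).trans_lt hψi.2
  have hout2 : Measurable fun q : (Space d × Space d) × Space d =>
      outWeight Ω m q.1.1 q.2 * F (exitMap Ω (q.1.1, q.2)) :=
    (((h.measurable_outWeight hΩ (m := m)).mul hFe).comp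
      ((measurable_fst.comp measurable_fst).prodMk measurable_snd) :)
  filter_upwards [ae_lt_top (hz2.mul hout2).lintegral_prod_right' hlt.ne] with p hp
  have hG := hk.measurable_iterIntegrand h hΩ hb lam hψ p.1 p.2
  refine ⟨hG.aestronglyMeasurable, ?_⟩
  rw [hasFiniteIntegral_iff_enorm, lintegral_prod _ hG.enorm.aemeasurable]
  refine lt_of_le_of_lt (lintegral_mono fun v' => ?_) hp
  have hy : Measurable fun u => ENNReal.ofReal (zeroExt Ω m k (exitPoint Ω v' p.1) v' u) *
      (outWeight Ω m (exitPoint Ω v' p.1) u * ‖ψ (exitPoint Ω v' p.1, u)‖ₑ) :=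
    ((hz2.mul hout').comp (measurable_prodMk_left (x := (exitPoint Ω v' p.1, v'))) :)
  calc ∫⁻ u, ‖iterIntegrand Ω m k lam ψ p.1 p.2 v' u‖ₑ ∂m
      ≤ ∫⁻ u, ENNReal.ofReal (zeroExt Ω m k p.1 p.2 v') * (outWeight Ω m p.1 v' *
        (ENNReal.ofReal (zeroExt Ω m k (exitPoint Ω v' p.1) v' u) *
          (outWeight Ω m (exitPoint Ω v' p.1) u * ‖ψ (exitPoint Ω v' p.1, u)‖ₑ))) ∂m :=
        lintegral_mono fun u => hk.enorm_iterIntegrand_le hlam ψ _ _ _ _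
    _ = ENNReal.ofReal (zeroExt Ω m k p.1 p.2 v') * (outWeight Ω m p.1 v' *
        F (exitMap Ω (p.1, v'))) := by
        rw [lintegral_const_mul _ (hy.const_mul _), lintegral_const_mul _ hy]
        rfl

omit h hb hΩ in
/-- The radial integral of the integrand for a given pair of directions. -/
theorem RegularKernel.enorm_integral_iterIntegrand_le (hk : RegularKernel Ω m w k) (hd : 1 ≤ d)
    (hV : m.support = univ) {lam : ℂ} (hlam : 0 ≤ lam.re) (hlam0 : lam ≠ 0)
    (ψ : Space d × Space d → ℂ) (x v σ u : Space d) {J : ℝ≥0∞}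
    (hJ : x ∈ frontier Ω → σ ∈ outgoing Ω m x → (exitPoint Ω σ x, σ) ∈ gammaMinus Ω m →
      0 < travelTime Ω x σ ∧ ENNReal.ofReal (1 / travelTime Ω x σ) ≤ J) :
    ‖∫ r, iterIntegrand Ω m k lam ψ x v (r • σ) u ∂(volume.restrict (Ioi (0 : ℝ))).withDensity
        fun r => ENNReal.ofReal (r ^ (d - 1) * (Ioi (0 : ℝ)).indicator w r)‖ₑ ≤
      ENNReal.ofReal (1 / ‖lam‖) * ((outWeight Ω m x σ * (J *
        (outWeight Ω m (exitPoint Ω σ x) u * ‖ψ (exitPoint Ω σ x, u)‖ₑ))) *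
        ∫⁻ r in Ioi (0 : ℝ), majorant Ω m w k x (exitPoint Ω σ x) v σ u r) := by
  have hmeas := measurable_indicator_of_differentiableAt hk.profile_diff
  set y := exitPoint Ω σ x with hy
  rw [integral_withDensity_eq_integral_toReal_smul (by fun_prop)
    (Eventually.of_forall fun _ => ENNReal.ofReal_lt_top)]
  by_cases hgood : (x ∈ frontier Ω ∧ σ ∈ outgoing Ω m x) ∧ (y, σ) ∈ gammaMinus Ω m ∧
      u ∈ outgoing Ω m y
  · obtain ⟨⟨hx, hσ⟩, hyσ, hu⟩ := hgood
    obtain ⟨hτ, hJτ⟩ := hJ hx hσ hyσ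
    set c : ℂ := ((|inner ℝ σ (normal Ω x)| * |inner ℝ u (normal Ω y)| : ℝ) : ℂ) * ψ (y, u) with hc
    have hcn : ‖c‖ₑ = outWeight Ω m x σ * (outWeight Ω m y u * ‖ψ (y, u)‖ₑ) := by
      rw [hc, enorm_mul, outWeight, outWeight,
        indicator_of_mem (show (x, σ) ∈ gammaPlus Ω m from ⟨hx, hσ⟩),
        indicator_of_mem (show (y, u) ∈ gammaPlus Ω m from ⟨hyσ.1, hu⟩), ← mul_assoc,
        ← ENNReal.ofReal_mul (abs_nonneg _), ← ofReal_norm, Complex.norm_real,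
        Real.norm_of_nonneg (by positivity)]
    have hI : ∫ r in Ioi (0 : ℝ),
        (ENNReal.ofReal (r ^ (d - 1) * (Ioi (0 : ℝ)).indicator w r)).toReal •
          iterIntegrand Ω m k lam ψ x v (r • σ) u =
        c * ∫ r in Ioi (0 : ℝ), ((r⁻¹ ^ 2 * (r ^ (d + 2) * w r * (zeroExt Ω m k x v (r • σ) *
        zeroExt Ω m k y (r • σ) u)) : ℝ) : ℂ) *
          Complex.exp (-lam * ((r⁻¹ * travelTime Ω x σ : ℝ) : ℂ)) := by
      rw [← integral_const_mul]
      refine setIntegral_congr_fun measurableSet_Ioi fun r hr => ?_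
      have hr' : 0 < r := hr
      have hw := hk.profile_pos r hr
      -- The powers of `r` are `r ^ (d - 1)` from polar coordinates and one more from `|rσ·n(x)|`.
      -- Writing `d = e + 1` removes the truncated subtraction.
      have hpow : r⁻¹ ^ 2 * r ^ (d + 2) = r ^ (d - 1) * r := by
        obtain ⟨e, rfl⟩ : ∃ e, d = e + 1 := ⟨d - 1, by omega⟩
        rw [Nat.add_sub_cancel]
        field_simp
        ring
      rw [indicator_of_mem hr, ENNReal.toReal_ofReal (by positivity), iterIntegrand,
        exitPoint_smul Ω σ x hr', travelTime_smul Ω x σ hr', ← hy, inner_smul_left, conj_trivial,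
        abs_mul, abs_of_pos hr', hc, Complex.real_smul]
      have hpow' : ((r : ℂ)⁻¹ ^ 2 * (r : ℂ) ^ (d + 2)) = (r : ℂ) ^ (d - 1) * r := by
        exact_mod_cast hpow
      push_cast
      linear_combination (-((|inner ℝ σ (normal Ω x)| : ℝ) : ℂ) *
        ((|inner ℝ u (normal Ω y)| : ℝ) : ℂ) *
        ψ (y, u) * (w r : ℂ) * (zeroExt Ω m k x v (r • σ) : ℂ) * (zeroExt Ω m k y (r • σ) u : ℂ) *
        Complex.exp (-lam * ((r : ℂ)⁻¹ * (travelTime Ω x σ : ℂ)))) * hpow'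
    rw [hI, enorm_mul, hcn]
    refine (mul_le_mul_right (hk.enorm_radial_integral_le hV hlam hlam0 x y v σ u hτ) _).trans ?_
    have hsplit : ENNReal.ofReal (1 / (‖lam‖ * travelTime Ω x σ)) ≤
        ENNReal.ofReal (1 / ‖lam‖) * J := by
      rw [← one_div_mul_one_div, ENNReal.ofReal_mul (by positivity)]
      exact mul_le_mul_right hJτ _
    calc _ ≤ outWeight Ω m x σ * (outWeight Ω m y u * ‖ψ (y, u)‖ₑ) *
          (ENNReal.ofReal (1 / ‖lam‖) * J *
            ∫⁻ r in Ioi (0 : ℝ), majorant Ω m w k x y v σ u r) := by gcongr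
      _ = _ := by ring
  -- For inadmissible parameters one of the two kernels vanishes on the whole ray, again because the
  -- velocity sets are cones.
  · have hzero : ∀ r ∈ Ioi (0 : ℝ),
        (ENNReal.ofReal (r ^ (d - 1) * (Ioi (0 : ℝ)).indicator w r)).toReal •
          iterIntegrand Ω m k lam ψ x v (r • σ) u = 0 := fun r hr => by
      have hprod : zeroExt Ω m k x v (r • σ) * zeroExt Ω m k y (r • σ) u = 0 := by
        by_contra hc
        obtain ⟨a1, -, a3⟩ := mem_of_zeroExt_ne_zero (left_ne_zero_of_mul hc)
        obtain ⟨b1, b2, b3⟩ := mem_of_zeroExt_ne_zero (right_ne_zero_of_mul hc)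
        exact hgood ⟨⟨a1, (smul_mem_outgoing hV hr).1 a3⟩, ⟨b1, (smul_mem_incoming hV hr).1 b2⟩, b3⟩
      rw [iterIntegrand, exitPoint_smul Ω σ x hr, ← hy]
      rcases mul_eq_zero.1 hprod with h0 | h0 <;> simp [h0]
    rw [setIntegral_congr_fun measurableSet_Ioi hzero]
    simp

end Iterated

/-! ### An interchange of integrals -/

section Tonelli

variable {X Y : Type*} [MeasurableSpace X] [MeasurableSpace Y] {μ : Measure X} {ν : Measure Y}
  [SFinite μ] [SFinite ν]

/-- The bound on `M` is required only where `E` does not vanish, because the majorant is controlled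
only for admissible boundary points and velocities. -/
theorem lintegral_mul_lintegral_le {a : X → ℝ≥0∞} {E : Y → ℝ≥0∞} {M : X × Y → ℝ≥0∞} {C : ℝ≥0∞}
    (ha : Measurable a) (hE : Measurable E) (hM : Measurable M)
    (hC : ∀ y, E y ≠ 0 → ∫⁻ x, a x * M (x, y) ∂μ ≤ C) :
    ∫⁻ x, a x * (∫⁻ y, E y * M (x, y) ∂ν) ∂μ ≤ C * ∫⁻ y, E y ∂ν := by
  have hj : Measurable fun p : X × Y => a p.1 * (E p.2 * M p) := by fun_prop
  have hj1 : ∀ x, Measurable fun y => E y * M (x, y) := fun x => by fun_prop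
  have hj2 : ∀ y, Measurable fun x => a x * M (x, y) := fun y => by fun_prop
  calc ∫⁻ x, a x * (∫⁻ y, E y * M (x, y) ∂ν) ∂μ
      = ∫⁻ x, ∫⁻ y, a x * (E y * M (x, y)) ∂ν ∂μ :=
        lintegral_congr fun x => (lintegral_const_mul _ (hj1 x)).symm
    _ = ∫⁻ y, ∫⁻ x, a x * (E y * M (x, y)) ∂μ ∂ν :=
        lintegral_lintegral_swap (f := fun x y => a x * (E y * M (x, y))) hj.aemeasurable
    _ = ∫⁻ y, E y * ∫⁻ x, a x * M (x, y) ∂μ ∂ν := lintegral_congr fun y => by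
        rw [← lintegral_const_mul _ (hj2 y)]
        exact lintegral_congr fun x => by ring
    _ ≤ ∫⁻ y, C * E y ∂ν := lintegral_mono fun y => by
        by_cases h0 : E y = 0
        · simp [h0]
        · rw [mul_comm]
          exact mul_le_mul_left (hC y h0) _
    _ = C * ∫⁻ y, E y ∂ν := lintegral_const_mul _ hE

end Tonelli

/-! ### Integrability of the grazing weight -/

section MainEstimate

variable {Ω : Set (Space d)} {α : ℝ} {m : Measure (Space d)} {w : ℝ → ℝ}
  {k : Space d → Space d → Space d → ℝ}

/-- The bound for the inverse of the length of the chord which enters `Ω` at `y` with direction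
`σ`. -/
def grazing (Ω : Set (Space d)) (m : Measure (Space d)) (α K : ℝ) (y σ : Space d) : ℝ≥0∞ :=
  (gammaMinus Ω m).indicator
    (fun p => ENNReal.ofReal (K * |inner ℝ p.2 (normal Ω p.1)| ^ (-α⁻¹))) (y, σ)

/-- The weight of the trajectory which leaves `Ω` at `x` with direction `σ`, after having been
emitted from velocity `u`. -/
def flightWeight (Ω : Set (Space d)) (m : Measure (Space d)) (α K : ℝ)
    (ψ : Space d × Space d → ℂ) (x σ u : Space d) : ℝ≥0∞ :=
  outWeight Ω m x σ * (grazing Ω m α K (exitPoint Ω σ x) σ *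
    (outWeight Ω m (exitPoint Ω σ x) u * ‖ψ (exitPoint Ω σ x, u)‖ₑ))

theorem mem_of_flightWeight_ne_zero {K : ℝ} {ψ : Space d × Space d → ℂ} {x σ u : Space d}
    (h : flightWeight Ω m α K ψ x σ u ≠ 0) :
    (x, σ) ∈ gammaPlus Ω m ∧ (exitPoint Ω σ x, σ) ∈ gammaMinus Ω m ∧
      (exitPoint Ω σ x, u) ∈ gammaPlus Ω m := by
  have h1 := right_ne_zero_of_mul h
  refine ⟨?_, ?_, ?_⟩ <;> by_contra hc
  · exact left_ne_zero_of_mul h (indicator_of_notMem hc _)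
  · exact left_ne_zero_of_mul h1 (indicator_of_notMem hc _)
  · exact left_ne_zero_of_mul (right_ne_zero_of_mul h1) (indicator_of_notMem hc _)

variable (h : HasHolderBoundary Ω α) (hΩ : IsOpen Ω) (hb : Bornology.IsBounded Ω)
include h hΩ

theorem HasHolderBoundary.measurable_grazing (K : ℝ) :
    Measurable fun p : Space d × Space d => grazing Ω m α K p.1 p.2 := by
  have := h.measurable_inner_normal_prod hΩ
  exact Measurable.indicator (by fun_prop) (h.measurableSet_gammaMinus hΩ)

/-- The grazing weight is integrable against the flux, uniformly in space. -/
theorem HasHolderBoundary.exists_lintegral_grazing_le (hd : 1 ≤ d) (hα : 1 / 2 < α) {K : ℝ}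
    (hK : 0 ≤ K) :
    ∃ C : ℝ≥0, ∀ y : Space d, ∫⁻ σ : Metric.sphere (0 : Space d) 1,
      inWeight Ω m y σ * grazing Ω m α K y σ ∂(volume : Measure (Space d)).toSphere ≤ C := by
  have hα0 : 0 < α := by linarith
  -- The exponent combines one power of `|σ·n|` from the flux with `-1/α` from the inverse chord
  -- length. It exceeds `-1` exactly when `α > 1/2`.
  obtain ⟨C, hC⟩ := exists_sphere_bound hd (s := 1 - α⁻¹) (by
    have : α⁻¹ < 2 := by rw [inv_lt_comm₀ hα0 two_pos]; linarith
    linarith)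
  refine ⟨K.toNNReal * C, fun y => ?_⟩
  by_cases hy : y ∈ frontier Ω
  · have hm : Measurable fun σ : Metric.sphere (0 : Space d) 1 =>
        ENNReal.ofReal (|inner ℝ (σ : Space d) (normal Ω y)| ^ (1 - α⁻¹)) := by fun_prop
    calc _ ≤ ∫⁻ σ : Metric.sphere (0 : Space d) 1, ENNReal.ofReal K *
          ENNReal.ofReal (|inner ℝ (σ : Space d) (normal Ω y)| ^ (1 - α⁻¹))
            ∂(volume : Measure (Space d)).toSphere := lintegral_mono fun σ => by
          by_cases hσ : (y, (σ : Space d)) ∈ gammaMinus Ω m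
          · rw [inWeight, grazing, indicator_of_mem hσ, indicator_of_mem hσ,
              ← ENNReal.ofReal_mul (abs_nonneg _), ← ENNReal.ofReal_mul hK]
            refine le_of_eq (congrArg _ ?_)
            have ha : 0 < |inner ℝ (σ : Space d) (normal Ω y)| := abs_pos.2 hσ.2.2.ne
            rw [sub_eq_add_neg, Real.rpow_add ha, Real.rpow_one]
            ring
          · rw [inWeight, indicator_of_notMem hσ, zero_mul]
            exact zero_le
      _ = ENNReal.ofReal K * ∫⁻ σ : Metric.sphere (0 : Space d) 1,
          ENNReal.ofReal (|inner ℝ (σ : Space d) (normal Ω y)| ^ (1 - α⁻¹))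
            ∂(volume : Measure (Space d)).toSphere := lintegral_const_mul _ hm
      _ ≤ _ := by
          rw [ENNReal.coe_mul]
          exact mul_le_mul_right (hC _ (h.norm_normal hΩ hy)) _
  · have : ∀ σ, inWeight Ω m y σ = 0 := fun σ => indicator_of_notMem (fun hh => hy hh.1) _
    simp [this]

include hb

theorem HasHolderBoundary.measurable_flightWeight (K : ℝ) {ψ : Space d × Space d → ℂ}
    (hψ : Measurable ψ) {A : Type*} [MeasurableSpace A] {x σ u : A → Space d} (hx : Measurable x)
    (hσ : Measurable σ) (hu : Measurable u) :
    Measurable fun z => flightWeight Ω m α K ψ (x z) (σ z) (u z) := by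
  have hy : Measurable fun z => exitPoint Ω (σ z) (x z) :=
    ((measurable_exitPoint hΩ hb).comp (hx.prodMk hσ) :)
  have h1 : Measurable fun z => outWeight Ω m (x z) (σ z) := h.measurable_outWeight_comp hΩ hx hσ
  have h2 : Measurable fun z => outWeight Ω m (exitPoint Ω (σ z) (x z)) (u z) :=
    h.measurable_outWeight_comp hΩ hy hu
  have h3 : Measurable fun z => grazing Ω m α K (exitPoint Ω (σ z) (x z)) (σ z) :=
    ((h.measurable_grazing hΩ (m := m) K).comp (hy.prodMk hσ) :)
  have h4 : Measurable fun z => ‖ψ (exitPoint Ω (σ z) (x z), u z)‖ₑ :=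
    (hψ.enorm.comp (hy.prodMk hu) :)
  exact h1.mul (h3.mul (h2.mul h4))

/-- Transport along trajectories, in polar coordinates. -/
theorem HasHolderBoundary.lintegral_sphere_transport_le {F : Space d × Space d → ℝ≥0∞}
    (hF : Measurable F) :
    ∫⁻ x, ∫⁻ σ : Metric.sphere (0 : Space d) 1, outWeight Ω m x σ * F (exitPoint Ω σ x, σ)
        ∂(volume : Measure (Space d)).toSphere ∂surfaceMeasure Ω ≤
      ∫⁻ y, ∫⁻ σ : Metric.sphere (0 : Space d) 1, inWeight Ω m y σ * F (y, σ)
        ∂(volume : Measure (Space d)).toSphere ∂surfaceMeasure Ω := by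
  have := h.isFiniteMeasure hΩ hb
  have hp : Measurable fun q : Space d × Metric.sphere (0 : Space d) 1 =>
      (q.1, (q.2 : Space d)) := by fun_prop
  have hs : Measurable fun q : Space d × Metric.sphere (0 : Space d) 1 => (q.2 : Space d) := by
    fun_prop
  have hy : Measurable fun q : Space d × Metric.sphere (0 : Space d) 1 =>
      exitPoint Ω (q.2 : Space d) q.1 := ((measurable_exitPoint hΩ hb).comp hp :)
  have h1 : Measurable fun q : Space d × Metric.sphere (0 : Space d) 1 =>
      outWeight Ω m q.1 (q.2 : Space d) * F (exitPoint Ω (q.2 : Space d) q.1, q.2) :=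
    (h.measurable_outWeight_comp hΩ measurable_fst hs).mul ((hF.comp (hy.prodMk hs) :))
  have h2 : Measurable fun q : Space d × Metric.sphere (0 : Space d) 1 =>
      inWeight Ω m q.1 (q.2 : Space d) * F (q.1, q.2) :=
    (h.measurable_inWeight_comp hΩ measurable_fst hs).mul ((hF.comp hp :))
  rw [lintegral_lintegral_swap (f := fun (x : Space d) (σ : Metric.sphere (0 : Space d) 1) =>
      outWeight Ω m x (σ : Space d) * F (exitPoint Ω (σ : Space d) x, σ)) h1.aemeasurable,
    lintegral_lintegral_swap (f := fun (x : Space d) (σ : Metric.sphere (0 : Space d) 1) =>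
      inWeight Ω m x (σ : Space d) * F (x, σ)) h2.aemeasurable]
  refine lintegral_mono fun σ => ?_
  have hpr : Measurable fun y : Space d => (y, (σ : Space d)) := by fun_prop
  exact h.lintegral_transport_le hΩ hb (σ : Space d) (F := fun y => F (y, σ)) (hF.comp hpr :)

/-- Transport replaces the arrival point `x` by the departure point `y`, where the incoming flux
factor tempers the grazing singularity. The integral over directions is then bounded uniformly in
`y`, and what is left is the norm of `ψ`. -/
theorem HasHolderBoundary.exists_lintegral_flightWeight_le [SFinite m] (hd : 1 ≤ d)
    (hα : 1 / 2 < α) {K : ℝ} (hK : 0 ≤ K) :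
    ∃ C : ℝ≥0, ∀ ψ : Space d × Space d → ℂ, Measurable ψ →
      ∫⁻ x, ∫⁻ q : Metric.sphere (0 : Space d) 1 × Space d, flightWeight Ω m α K ψ x q.1 q.2
        ∂((volume : Measure (Space d)).toSphere.prod m) ∂surfaceMeasure Ω ≤
      C * ∫⁻ p, ‖ψ p‖ₑ ∂muPlus Ω m := by
  obtain ⟨C, hC⟩ := h.exists_lintegral_grazing_le hΩ (m := m) hd hα hK
  refine ⟨C, fun ψ hψ => ?_⟩
  have hout : Measurable fun p : Space d × Space d => outWeight Ω m p.1 p.2 * ‖ψ p‖ₑ :=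
    (h.measurable_outWeight hΩ).mul hψ.enorm
  have hA : Measurable fun y => ∫⁻ u, outWeight Ω m y u * ‖ψ (y, u)‖ₑ ∂m :=
    hout.lintegral_prod_right'
  have hsl : ∀ y, Measurable fun u => outWeight Ω m y u * ‖ψ (y, u)‖ₑ := fun y =>
    (hout.comp (measurable_prodMk_left (x := y)) :)
  have hF : Measurable fun p : Space d × Space d => grazing Ω m α K p.1 p.2 *
      ∫⁻ u, outWeight Ω m p.1 u * ‖ψ (p.1, u)‖ₑ ∂m :=
    (h.measurable_grazing hΩ K).mul (hA.comp measurable_fst :)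
  have hin : ∀ y, Measurable fun σ : Metric.sphere (0 : Space d) 1 =>
      inWeight Ω m y σ * grazing Ω m α K y σ := fun y => by
    have hp : Measurable fun σ : Metric.sphere (0 : Space d) 1 => (y, (σ : Space d)) := by fun_prop
    exact (((h.measurable_inWeight hΩ).mul (h.measurable_grazing hΩ K)).comp hp :)
  have e : ∀ x, ∫⁻ q : Metric.sphere (0 : Space d) 1 × Space d, flightWeight Ω m α K ψ x q.1 q.2
        ∂((volume : Measure (Space d)).toSphere.prod m) =
      ∫⁻ σ : Metric.sphere (0 : Space d) 1, outWeight Ω m x σ *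
        (grazing Ω m α K (exitPoint Ω σ x) σ *
          ∫⁻ u, outWeight Ω m (exitPoint Ω σ x) u * ‖ψ (exitPoint Ω σ x, u)‖ₑ ∂m)
        ∂(volume : Measure (Space d)).toSphere := fun x => by
    have hW : Measurable fun q : Metric.sphere (0 : Space d) 1 × Space d =>
        flightWeight Ω m α K ψ x q.1 q.2 :=
      h.measurable_flightWeight hΩ hb K hψ measurable_const
        (measurable_subtype_coe.comp measurable_fst) measurable_snd
    rw [lintegral_prod _ hW.aemeasurable]
    refine lintegral_congr fun σ => ?_
    simp only [flightWeight]
    rw [lintegral_const_mul _ ((hsl _).const_mul _), lintegral_const_mul _ (hsl _)]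
  rw [lintegral_congr e]
  refine (h.lintegral_sphere_transport_le hΩ hb hF).trans ?_
  rw [h.lintegral_muPlus hΩ hψ.enorm, ← lintegral_const_mul _ hA]
  refine lintegral_mono fun y => ?_
  simp only [← mul_assoc]
  rw [lintegral_mul_const _ (hin y)]
  exact mul_le_mul_left (hC y) _

end MainEstimate

/-! ### The iterated operator is of order `1/|λ|` -/

section IteratedBound

variable {Ω : Set (Space d)} {α : ℝ} {m : Measure (Space d)} {w : ℝ → ℝ}
  {k : Space d → Space d → Space d → ℝ}
  (h : HasHolderBoundary Ω α) (hΩ : IsOpen Ω) (hb : Bornology.IsBounded Ω)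

/-- The majorant, integrated along a ray of velocities. -/
def rayMajorant (Ω : Set (Space d)) (m : Measure (Space d)) (w : ℝ → ℝ)
    (k : Space d → Space d → Space d → ℝ) (x v σ u : Space d) : ℝ≥0∞ :=
  ∫⁻ r in Ioi (0 : ℝ), majorant Ω m w k x (exitPoint Ω σ x) v σ u r

include h hΩ hb

theorem RegularKernel.measurable_rayMajorant_comp (hk : RegularKernel Ω m w k)
    (hV : m.support = univ) {A : Type*} [MeasurableSpace A] {x v σ u : A → Space d}
    (hx : Measurable x) (hv : Measurable v) (hσ : Measurable σ) (hu : Measurable u) :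
    Measurable fun z => rayMajorant Ω m w k (x z) (v z) (σ z) (u z) := by
  have hy : Measurable fun z => exitPoint Ω (σ z) (x z) :=
    ((measurable_exitPoint hΩ hb).comp (hx.prodMk hσ) :)
  have h1 : Measurable fun p : A × ℝ => majorant Ω m w k (x p.1) (exitPoint Ω (σ p.1) (x p.1))
      (v p.1) (σ p.1) (u p.1) p.2 :=
    hk.measurable_majorant_comp h hΩ hV (hx.comp measurable_fst) (hy.comp measurable_fst :)
      (hv.comp measurable_fst) (hσ.comp measurable_fst) (hu.comp measurable_fst) measurable_snd
  exact h1.lintegral_prod_right'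

/-- Polar coordinates in the intermediate velocity, Fubini and the radial estimate, with the chord
length replaced by its grazing bound. The resulting majorant separates a factor independent of `v`
from the ray majorant. -/
theorem RegularKernel.exists_enorm_iterated_le (hk : RegularKernel Ω m w k)
    (hm : IsVelocityMeasure m) (hd : 1 ≤ d) (hα : 0 < α) [SFinite m] :
    ∃ K : ℝ, 0 ≤ K ∧ ∀ lam : ℂ, 0 ≤ lam.re → lam ≠ 0 → ∀ ψ : Space d × Space d → ℂ, Measurable ψ →
      ∀ p : Space d × Space d,
        Integrable (fun q : Space d × Space d => iterIntegrand Ω m k lam ψ p.1 p.2 q.1 q.2)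
          (m.prod m) →
        ‖diffuse Ω m k (transfer Ω lam (diffuse Ω m k ψ)) p‖ₑ ≤ ENNReal.ofReal (1 / ‖lam‖) *
          ∫⁻ q : Metric.sphere (0 : Space d) 1 × Space d, flightWeight Ω m α K ψ p.1 q.1 q.2 *
            rayMajorant Ω m w k p.1 p.2 q.1 q.2 ∂((volume : Measure (Space d)).toSphere.prod m) := by
  obtain ⟨K, hK0, hK⟩ := h.exists_inv_travelTime_le hΩ hb hα
  refine ⟨K, hK0, fun lam hlam hlam0 ψ hψ p hint => ?_⟩
  have hV := hk.support_eq_univ hm hd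
  have hmp : MeasurePreserving (polarMap (d := d)) ((volume : Measure (Space d)).toSphere.prod
      ((volume.restrict (Ioi (0 : ℝ))).withDensity
        fun r => ENNReal.ofReal (r ^ (d - 1) * (Ioi (0 : ℝ)).indicator w r))) m :=
    ⟨measurable_polarMap, (hk.eq_map_polarMap hm hd).symm⟩
  set S := (volume : Measure (Space d)).toSphere
  set b := (volume.restrict (Ioi (0 : ℝ))).withDensity
        fun r => ENNReal.ofReal (r ^ (d - 1) * (Ioi (0 : ℝ)).indicator w r) with hbd
  have hmap : ∀ g : Space d → ℂ, AEStronglyMeasurable g m →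
      ∫ v, g v ∂m = ∫ q, g (polarMap q) ∂(S.prod b) := fun g hg => by
    rw [← hmp.map_eq] at hg
    rw [← integral_map measurable_polarMap.aemeasurable hg, hmp.map_eq]
  have hint2 : Integrable (fun z : (Metric.sphere (0 : Space d) 1 × ℝ) × Space d =>
      iterIntegrand Ω m k lam ψ p.1 p.2 (polarMap z.1) z.2) ((S.prod b).prod m) :=
    (hmp.prod (MeasurePreserving.id m)).integrable_comp_of_integrable hint
  rw [diffuse_transfer_diffuse, hmap _ hint.integral_prod_left.aestronglyMeasurable]
  refine (enorm_integral_prod_le hint2).trans ?_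
  have hσm : Measurable fun q : Metric.sphere (0 : Space d) 1 × Space d => (q.1 : Space d) := by
    fun_prop
  have hW : Measurable fun q : Metric.sphere (0 : Space d) 1 × Space d =>
      flightWeight Ω m α K ψ p.1 q.1 q.2 * rayMajorant Ω m w k p.1 p.2 q.1 q.2 :=
    (h.measurable_flightWeight hΩ hb K hψ measurable_const hσm measurable_snd).mul
      (hk.measurable_rayMajorant_comp h hΩ hb hV measurable_const measurable_const hσm
        measurable_snd)
  rw [← lintegral_const_mul _ hW, lintegral_prod _ (hW.const_mul _).aemeasurable]
  refine lintegral_mono fun σ => lintegral_mono fun u => ?_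
  refine hk.enorm_integral_iterIntegrand_le hd hV hlam hlam0 ψ p.1 p.2 σ u
    (J := grazing Ω m α K (exitPoint Ω σ p.1) σ) (fun hx hσ hy => ?_)
  have hσ1 : ‖(σ : Space d)‖ = 1 := by simp
  refine ⟨(h.exit_mem hΩ hb (show p.1 ∈ outSide Ω (σ : Space d) from ⟨hx, hσ.2⟩)).1, ?_⟩
  rw [grazing, indicator_of_mem hy]
  exact ENNReal.ofReal_le_ofReal (hK p.1 hx σ hσ1 hσ.2 hy.2.2)

/-- The velocity averaging effect: the iterated operator is of order `1/|λ|`. -/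
theorem RegularKernel.exists_lintegral_iterated_le (hk : RegularKernel Ω m w k)
    (hm : IsVelocityMeasure m) (hd : 1 ≤ d) (hα : 1 / 2 < α) [SFinite m] :
    ∃ C : ℝ≥0, ∀ lam : ℂ, 0 ≤ lam.re → lam ≠ 0 → ∀ ψ : Space d × Space d → ℂ, Measurable ψ →
      Integrable ψ (muPlus Ω m) →
        ∫⁻ p, ‖diffuse Ω m k (transfer Ω lam (diffuse Ω m k ψ)) p‖ₑ ∂muMinus Ω m ≤
          ENNReal.ofReal (1 / ‖lam‖) * (C * ∫⁻ p, ‖ψ p‖ₑ ∂muPlus Ω m) := by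
  have hV := hk.support_eq_univ hm hd
  obtain ⟨K, hK0, hK⟩ := hk.exists_enorm_iterated_le h hΩ hb hm hd (by linarith)
  obtain ⟨C₁, hC₁⟩ := hk.lintegral_majorant_le h hΩ hV
  obtain ⟨C₂, hC₂⟩ := h.exists_lintegral_flightWeight_le hΩ hb (m := m) hd hα hK0
  refine ⟨C₁ * C₂, fun lam hlam hlam0 ψ hψ hψi => ?_⟩
  have hσm : Measurable fun z : (Space d × Space d) × (Metric.sphere (0 : Space d) 1 × Space d) =>
      (z.2.1 : Space d) := by fun_prop
  have hx : Measurable fun z : (Space d × Space d) × (Metric.sphere (0 : Space d) 1 × Space d) =>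
      z.1.1 := by fun_prop
  have hv : Measurable fun z : (Space d × Space d) × (Metric.sphere (0 : Space d) 1 × Space d) =>
      z.1.2 := by fun_prop
  have hu : Measurable fun z : (Space d × Space d) × (Metric.sphere (0 : Space d) 1 × Space d) =>
      z.2.2 := by fun_prop
  have hE : Measurable fun z : (Space d × Space d) × (Metric.sphere (0 : Space d) 1 × Space d) =>
      flightWeight Ω m α K ψ z.1.1 z.2.1 z.2.2 := h.measurable_flightWeight hΩ hb K hψ hx hσm hu
  have hR : Measurable fun z : (Space d × Space d) × (Metric.sphere (0 : Space d) 1 × Space d) =>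
      rayMajorant Ω m w k z.1.1 z.1.2 z.2.1 z.2.2 :=
    hk.measurable_rayMajorant_comp h hΩ hb hV hx hv hσm hu
  have hB : Measurable fun p : Space d × Space d =>
      ∫⁻ q : Metric.sphere (0 : Space d) 1 × Space d, flightWeight Ω m α K ψ p.1 q.1 q.2 *
        rayMajorant Ω m w k p.1 p.2 q.1 q.2 ∂((volume : Measure (Space d)).toSphere.prod m) :=
    (hE.mul hR).lintegral_prod_right'
  calc ∫⁻ p, ‖diffuse Ω m k (transfer Ω lam (diffuse Ω m k ψ)) p‖ₑ ∂muMinus Ω m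
      ≤ ∫⁻ p, ENNReal.ofReal (1 / ‖lam‖) *
        (∫⁻ q : Metric.sphere (0 : Space d) 1 × Space d, flightWeight Ω m α K ψ p.1 q.1 q.2 *
          rayMajorant Ω m w k p.1 p.2 q.1 q.2 ∂((volume : Measure (Space d)).toSphere.prod m))
        ∂muMinus Ω m := by
        refine lintegral_mono_ae ?_
        filter_upwards [hk.ae_integrable_iterIntegrand h hΩ hb hlam hψ hψi] with p hp
        exact hK lam hlam hlam0 ψ hψ p hp
    _ = ENNReal.ofReal (1 / ‖lam‖) * ∫⁻ x, ∫⁻ v, inWeight Ω m x v *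
        (∫⁻ q : Metric.sphere (0 : Space d) 1 × Space d, flightWeight Ω m α K ψ x q.1 q.2 *
          rayMajorant Ω m w k x v q.1 q.2 ∂((volume : Measure (Space d)).toSphere.prod m)) ∂m
        ∂surfaceMeasure Ω := by
        rw [lintegral_const_mul _ hB, h.lintegral_muMinus hΩ hB]
    _ ≤ ENNReal.ofReal (1 / ‖lam‖) * ∫⁻ x, C₁ * (∫⁻ q : Metric.sphere (0 : Space d) 1 × Space d,
        flightWeight Ω m α K ψ x q.1 q.2 ∂((volume : Measure (Space d)).toSphere.prod m))
        ∂surfaceMeasure Ω := by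
        -- At fixed `x`, direction and incoming velocity, integrating the ray majorant in `v` costs
        -- at most `C₁`. Nonvanishing of the flight weight supplies the admissibility conditions.
        refine mul_le_mul_right (lintegral_mono fun x => ?_) _
        have hσ1 : Measurable fun q : Metric.sphere (0 : Space d) 1 × Space d => (q.1 : Space d) := by
          fun_prop
        have hσ2 : Measurable fun z : Space d × (Metric.sphere (0 : Space d) 1 × Space d) =>
            (z.2.1 : Space d) := by fun_prop
        refine lintegral_mul_lintegral_le
          (M := fun z : Space d × (Metric.sphere (0 : Space d) 1 × Space d) =>
            rayMajorant Ω m w k x z.1 z.2.1 z.2.2)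
          (h.measurable_inWeight_comp hΩ measurable_const measurable_id)
          (h.measurable_flightWeight hΩ hb K hψ measurable_const hσ1 measurable_snd)
          (hk.measurable_rayMajorant_comp h hΩ hb hV measurable_const measurable_fst hσ2
            (measurable_snd.comp measurable_snd)) (fun q hq => ?_)
        obtain ⟨a, b, c⟩ := mem_of_flightWeight_ne_zero hq
        exact hC₁ x a.1 _ b.1 q.2 c.2 q.1 (by simp) a.2 b.2
    _ = ENNReal.ofReal (1 / ‖lam‖) * (C₁ * ∫⁻ x, ∫⁻ q : Metric.sphere (0 : Space d) 1 × Space d,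
        flightWeight Ω m α K ψ x q.1 q.2 ∂((volume : Measure (Space d)).toSphere.prod m)
        ∂surfaceMeasure Ω) := by
        rw [lintegral_const_mul' _ _ ENNReal.coe_ne_top]
    _ ≤ _ := by
        rw [ENNReal.coe_mul, mul_assoc]
        exact mul_le_mul_right (mul_le_mul_right (hC₂ ψ hψ) _) _

end IteratedBound

/-! ### From pointwise formulas to the operator norm -/

section OperatorBound

variable {Ω : Set (Space d)} {α : ℝ} {m : Measure (Space d)} {w : ℝ → ℝ}
  {k : Space d → Space d → Space d → ℝ}
  (h : HasHolderBoundary Ω α) (hΩ : IsOpen Ω) (hb : Bornology.IsBounded Ω)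
include h hΩ

/-- The mass bound applied to `‖φ₁ - φ₂‖ₑ` shows that, for a.e. `p`, the two integrands agree for
a.e. `v'`. Representatives may thus be exchanged inside the composed formula. -/
theorem RegularKernel.diffuse_congr (hk : RegularKernel Ω m w k) [SFinite m]
    {φ₁ φ₂ : Space d × Space d → ℂ} (h₁ : Measurable φ₁) (h₂ : Measurable φ₂)
    (he : φ₁ =ᵐ[muPlus Ω m] φ₂) : diffuse Ω m k φ₁ =ᵐ[muMinus Ω m] diffuse Ω m k φ₂ := by
  have hF : Measurable fun p => ‖φ₁ p - φ₂ p‖ₑ := (h₁.sub h₂).enorm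
  have h0 : ∫⁻ p, ‖φ₁ p - φ₂ p‖ₑ ∂muPlus Ω m = 0 := by
    rw [lintegral_eq_zero_iff hF]
    filter_upwards [he] with p hp
    simp [hp]
  have hle := hk.lintegral_diffuse_le h hΩ hF
  have hout : Measurable fun q : (Space d × Space d) × Space d =>
      outWeight Ω m q.1.1 q.2 * ‖φ₁ (q.1.1, q.2) - φ₂ (q.1.1, q.2)‖ₑ :=
    (((h.measurable_outWeight hΩ (m := m)).mul hF).comp
      ((measurable_fst.comp measurable_fst).prodMk measurable_snd) :)
  have hG : Measurable fun q : (Space d × Space d) × Space d =>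
      ENNReal.ofReal (zeroExt Ω m k q.1.1 q.1.2 q.2) *
      (outWeight Ω m q.1.1 q.2 * ‖φ₁ (q.1.1, q.2) - φ₂ (q.1.1, q.2)‖ₑ) :=
    (hk.measurable_ofReal_zeroExt h hΩ).mul hout
  have hGi : Measurable fun p : Space d × Space d => ∫⁻ v', ENNReal.ofReal
      (zeroExt Ω m k p.1 p.2 v') * (outWeight Ω m p.1 v' * ‖φ₁ (p.1, v') - φ₂ (p.1, v')‖ₑ) ∂m :=
    hG.lintegral_prod_right'
  rw [h0, nonpos_iff_eq_zero, lintegral_eq_zero_iff hGi] at hle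
  filter_upwards [hle] with p hp
  have hGp : Measurable fun v' => ENNReal.ofReal (zeroExt Ω m k p.1 p.2 v') *
      (outWeight Ω m p.1 v' * ‖φ₁ (p.1, v') - φ₂ (p.1, v')‖ₑ) :=
    (hG.comp (measurable_prodMk_left (x := p)) :)
  have hp' := (lintegral_eq_zero_iff hGp).1 hp
  refine integral_congr_ae ?_
  filter_upwards [hp'] with v' hv'
  rw [← hk.enorm_integrand] at hv'
  simp only [Pi.zero_apply, enorm_eq_zero, mul_sub, sub_eq_zero] at hv'
  exact hv'

include hb

/-- The last transfer is a contraction, so the estimate of `H M H` suffices. The constant `C + 1`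
only ensures positivity. -/
theorem RegularKernel.exists_norm_sq_le (hk : RegularKernel Ω m w k)
    (hm : IsVelocityMeasure m) (hd : 1 ≤ d) (hα : 1 / 2 < α) [SFinite m]
    {H : LOnePlus Ω m →L[ℂ] LOneMinus Ω m} {M : ℂ → LOneMinus Ω m →L[ℂ] LOnePlus Ω m}
    (hH : IsDiffuseOperator Ω m k H)
    (hM : ∀ lam : ℂ, 0 ≤ lam.re → IsTransferOperator Ω m lam (M lam)) :
    ∃ C : ℝ, 0 < C ∧ ∀ lam : ℂ, 0 ≤ lam.re → lam ≠ 0 → ‖((M lam).comp H) ^ 2‖ ≤ C / ‖lam‖ := by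
  obtain ⟨C, hC⟩ := hk.exists_lintegral_iterated_le h hΩ hb hm hd hα
  refine ⟨C + 1, by positivity, fun lam hlam hlam0 => ?_⟩
  have hl : 0 < ‖lam‖ := norm_pos_iff.2 hlam0
  have hH' := (isDiffuseOperator_iff h hΩ).1 hH
  have hM' : ∀ u : LOneMinus Ω m, ∀ᵐ p ∂muPlus Ω m, M lam u p = transfer Ω lam u p := hM lam hlam
  have h1 : ‖H.comp ((M lam).comp H)‖ ≤ (C + 1) / ‖lam‖ := by
    refine norm_le_of_lintegral_le
      (Φ := fun f => diffuse Ω m k (transfer Ω lam (diffuse Ω m k f))) (by positivity)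
      (fun f hf hfi => ?_) _ (fun f => ?_)
    · refine (hC lam hlam hlam0 f hf hfi).trans ?_
      rw [← mul_assoc]
      refine mul_le_mul_left ?_ _
      rw [← ENNReal.ofReal_coe_nnreal, ← ENNReal.ofReal_mul (by positivity)]
      refine ENNReal.ofReal_le_ofReal ?_
      rw [one_div_mul_eq_div]
      gcongr
      linarith
    · have hf := (Lp.stronglyMeasurable f).measurable
      have hHf := (Lp.stronglyMeasurable (H f)).measurable
      have hMf := (Lp.stronglyMeasurable (M lam (H f))).measurable
      have hdf := (hk.stronglyMeasurable_diffuse h hΩ hf).measurable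
      have e1 : (M lam (H f) : Space d × Space d → ℂ) =ᵐ[muPlus Ω m]
          transfer Ω lam (diffuse Ω m k f) := by
        filter_upwards [hM' (H f),
          (h.quasiMeasurePreserving_exitMap hΩ hb (m := m)).ae (hH' f)] with p hp1 hp2
        rw [hp1, transfer, transfer, hp2]
      rw [ContinuousLinearMap.comp_apply, ContinuousLinearMap.comp_apply]
      filter_upwards [hH' (M lam (H f)),
        hk.diffuse_congr h hΩ hMf (measurable_transfer hΩ hb lam hdf) e1] with p hp1 hp2
      exact hp1.trans hp2
  have h2 := h.norm_transfer_le hΩ hb hlam (hM lam hlam)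
  have e : ((M lam).comp H) ^ 2 = (M lam).comp (H.comp ((M lam).comp H)) := by
    rw [pow_two, ContinuousLinearMap.mul_def, ContinuousLinearMap.comp_assoc]
  rw [e]
  refine (ContinuousLinearMap.opNorm_comp_le _ _).trans ?_
  calc _ ≤ 1 * ((C + 1) / ‖lam‖) := by gcongr
    _ = _ := one_mul _

end OperatorBound

/-! ### Strongly continuous families of contractions -/

section StrongContinuity

variable {X Y : Type*} [NormedAddCommGroup X] [NormedSpace ℂ X] [NormedAddCommGroup Y]
  [NormedSpace ℂ Y] {T : ℝ → X →L[ℂ] X}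

/-- Each new factor is handled by splitting `T_t (T_t^n x)` into `T_t (T_t^n x - T_{t₀}^n x)`, small
by the uniform bound, and `T_t (T_{t₀}^n x)`, continuous by hypothesis. -/
theorem continuous_pow_apply (hT : ∀ x, Continuous fun t => T t x) (hb : ∀ t, ‖T t‖ ≤ 1) (n : ℕ)
    (x : X) : Continuous fun t => (T t ^ n) x := by
  induction n with
  | zero => simpa using continuous_const
  | succ n ih =>
    refine continuous_iff_continuousAt.2 fun t₀ => ?_
    have h1 := ((hT ((T t₀ ^ n) x)).tendsto t₀)
    have h2 : Tendsto (fun t => T t ((T t ^ n) x - (T t₀ ^ n) x)) (𝓝 t₀) (𝓝 0) := by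
      refine squeeze_zero_norm (a := fun t => ‖(T t ^ n) x - (T t₀ ^ n) x‖) (fun t => ?_) ?_
      · exact ((T t).le_of_opNorm_le (hb t) _).trans_eq (one_mul _)
      · exact tendsto_iff_norm_sub_tendsto_zero.1 (ih.tendsto t₀)
    have h3 := h2.add h1
    rw [zero_add] at h3
    have e : ∀ t, (T t ^ (n + 1)) x = T t ((T t ^ n) x) := fun t => by rw [pow_succ']; rfl
    simp only [ContinuousAt, e]
    refine h3.congr fun t => ?_
    rw [map_sub, sub_add_cancel]

/-- The operator norm is a supremum of continuous functions of `t`, hence lower semicontinuous;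
strong continuity is enough. -/
theorem measurable_norm_of_continuous_apply (hT : ∀ x, Continuous fun t => T t x) :
    Measurable fun t => ‖T t‖ := by
  refine LowerSemicontinuous.measurable fun t y hy => ?_
  obtain ⟨x, hx, hyx⟩ := (T t).exists_lt_apply_of_lt_opNorm hy
  filter_upwards [(hT x).norm.continuousAt.eventually (lt_mem_nhds hyx)] with s hs
  refine hs.trans_le (((T s).le_opNorm x).trans ?_)
  exact mul_le_of_le_one_right (norm_nonneg _) hx.le

end StrongContinuity

/-! ### Integrability of the fourth power -/

section IntegrablePower

variable {Ω : Set (Space d)} {α : ℝ} {m : Measure (Space d)}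
  (h : HasHolderBoundary Ω α) (hΩ : IsOpen Ω) (hb : Bornology.IsBounded Ω)
include h hΩ hb

/-- Only the exponential factor depends on `t`, continuously and with modulus at most one. Dominated
convergence applies with bound `2 ‖u‖` composed with the exit map, integrable by the transport
inequality. -/
theorem HasHolderBoundary.continuous_transfer_apply [SFinite m]
    {M : ℂ → LOneMinus Ω m →L[ℂ] LOnePlus Ω m}
    (hM : ∀ lam : ℂ, 0 ≤ lam.re → IsTransferOperator Ω m lam (M lam)) {z : ℝ → ℂ}
    (hz : Continuous z) (hz0 : ∀ t, 0 ≤ (z t).re) (u : LOneMinus Ω m) :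
    Continuous fun t => M (z t) u := by
  have hu := (Lp.stronglyMeasurable u).measurable
  have huT : Measurable fun p => (u : Space d × Space d → ℂ) (exitMap Ω p) :=
    (hu.comp (measurable_exitMap hΩ hb) :)
  refine continuous_iff_continuousAt.2 fun t₀ => ?_
  rw [ContinuousAt, tendsto_iff_edist_tendsto_0]
  have e : ∀ t, edist (M (z t) u) (M (z t₀) u) =
      ∫⁻ p, ‖transfer Ω (z t) u p - transfer Ω (z t₀) u p‖ₑ ∂muPlus Ω m := fun t => by
    rw [edist_eq_enorm_sub, enorm_lp_one]
    refine lintegral_congr_ae ?_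
    filter_upwards [hM _ (hz0 t) u, hM _ (hz0 t₀) u, Lp.coeFn_sub (M (z t) u) (M (z t₀) u)]
      with p h1 h2 h3
    rw [h3, Pi.sub_apply, h1, h2]
    rfl
  simp only [e]
  have hlim := tendsto_lintegral_filter_of_dominated_convergence (μ := muPlus Ω m) (l := 𝓝 t₀)
    (F := fun t p => ‖transfer Ω (z t) u p - transfer Ω (z t₀) u p‖ₑ) (f := fun _ => 0)
    (fun p => 2 * ‖(u : Space d × Space d → ℂ) (exitMap Ω p)‖ₑ)
    (Eventually.of_forall fun t =>
      ((measurable_transfer hΩ hb _ hu).sub (measurable_transfer hΩ hb _ hu)).enorm)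
    (Eventually.of_forall fun t => Eventually.of_forall fun p => ?_) ?_
    (Eventually.of_forall fun p => ?_)
  · simpa using hlim
  · rw [transfer, transfer, ← sub_mul, enorm_mul]
    refine mul_le_mul_left ((enorm_sub_le).trans ?_) _
    rw [← one_add_one_eq_two, ← ofReal_norm, ← ofReal_norm]
    exact add_le_add (ENNReal.ofReal_le_one.2 (norm_exp_travelTime_le (hz0 t) _ _))
      (ENNReal.ofReal_le_one.2 (norm_exp_travelTime_le (hz0 t₀) _ _))
  · rw [lintegral_const_mul _ huT.enorm]
    exact ENNReal.mul_ne_top ENNReal.ofNat_ne_top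
      ((h.lintegral_exitMap_le hΩ hb hu.enorm).trans_lt (integrable_lp_one u).2).ne
  · have hc : Continuous fun t => ‖transfer Ω (z t) u p - transfer Ω (z t₀) u p‖ₑ := by
      unfold transfer
      fun_prop
    have := hc.tendsto t₀
    simpa using this

theorem HasHolderBoundary.hasIntegrablePower [SFinite m]
    {H : LOnePlus Ω m →L[ℂ] LOneMinus Ω m} {M : ℂ → LOneMinus Ω m →L[ℂ] LOnePlus Ω m}
    (hH : ‖H‖ ≤ 1) (hM : ∀ lam : ℂ, 0 ≤ lam.re → IsTransferOperator Ω m lam (M lam))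
    (hC : ∃ C : ℝ, 0 < C ∧ ∀ lam : ℂ, 0 ≤ lam.re → lam ≠ 0 →
      ‖((M lam).comp H) ^ 2‖ ≤ C / ‖lam‖) :
    HasIntegrablePower (fun lam => (M lam).comp H) 4 := by
  obtain ⟨C, hC0, hC⟩ := hC
  -- The fourth power is dominated by `(1 + C²)/(1 + η²)` independently of `ε`, and `1/(1 + η²)` has
  -- integral `π`.
  refine ⟨(1 + C ^ 2) * Real.pi, by positivity, fun ε hε => ?_⟩
  set z : ℝ → ℂ := fun η => (ε : ℂ) + Complex.I * (η : ℂ) with hz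
  have hzre : ∀ η, (z η).re = ε := fun η => by simp [hz]
  have hz0 : ∀ η, 0 ≤ (z η).re := fun η => by rw [hzre]; exact hε
  have hzim : ∀ η, |η| ≤ ‖z η‖ := fun η => by
    have := Complex.abs_im_le_norm (z η)
    simpa [hz] using this
  set T : ℝ → LOnePlus Ω m →L[ℂ] LOnePlus Ω m := fun η => (M (z η)).comp H with hT
  have hT1 : ∀ η, ‖T η‖ ≤ 1 := fun η =>
    ((M (z η)).opNorm_comp_le H).trans
      (mul_le_one₀ (h.norm_transfer_le hΩ hb (hz0 η) (hM _ (hz0 η))) (norm_nonneg _) hH)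
  have hcont : ∀ ψ, Continuous fun η => T η ψ := fun ψ =>
    h.continuous_transfer_apply hΩ hb hM (by fun_prop) hz0 (H ψ)
  have hmeas : Measurable fun η => ‖T η ^ 4‖ :=
    measurable_norm_of_continuous_apply (fun ψ => continuous_pow_apply hcont hT1 4 ψ)
  have hbound : ∀ η, ‖T η ^ 4‖ ≤ (1 + C ^ 2) * (1 + η ^ 2)⁻¹ := fun η => by
    have h2 : ‖T η ^ 2‖ ≤ 1 := by
      rw [pow_two]
      exact ((T η).opNorm_comp_le (T η)).trans (mul_le_one₀ (hT1 η) (norm_nonneg _) (hT1 η))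
    have h4 : ‖T η ^ 4‖ ≤ ‖T η ^ 2‖ ^ 2 := by
      have e4 : T η ^ 4 = T η ^ 2 * T η ^ 2 := by rw [← pow_add]
      rw [e4, pow_two ‖T η ^ 2‖]
      exact (T η ^ 2).opNorm_comp_le (T η ^ 2)
    -- The excluded parameter `λ = 0` occurs only at `η = 0`, where the product vanishes.
    have h3 : ‖T η ^ 2‖ * |η| ≤ C := by
      by_cases h0 : z η = 0
      · have : |η| = 0 := le_antisymm ((hzim η).trans (by simp [h0])) (abs_nonneg _)
        rw [this, mul_zero]
        exact hC0.le
      · have h5 := hC (z η) (hz0 η) h0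
        rw [le_div_iff₀ (norm_pos_iff.2 h0)] at h5
        exact (mul_le_mul_of_nonneg_left (hzim η) (norm_nonneg _)).trans h5
    have h6 : (‖T η ^ 2‖ * |η|) ^ 2 ≤ C ^ 2 := by gcongr
    rw [mul_pow, sq_abs] at h6
    have h7 : ‖T η ^ 2‖ ^ 2 ≤ 1 := pow_le_one₀ (norm_nonneg _) h2
    rw [← div_eq_mul_inv, le_div_iff₀ (by positivity)]
    nlinarith [sq_nonneg η]
  have hint : Integrable fun η : ℝ => (1 + C ^ 2) * (1 + η ^ 2)⁻¹ :=
    integrable_inv_one_add_sq.const_mul _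
  have hint2 : Integrable fun η => ‖T η ^ 4‖ :=
    hint.mono' hmeas.aestronglyMeasurable
      (Eventually.of_forall fun η => by rw [norm_norm]; exact hbound η)
  refine ⟨hint2, (integral_mono hint2 hint hbound).trans_eq ?_⟩
  rw [integral_const_mul, integral_univ_inv_one_add_sq]

end IntegrablePower

/-! ### Maxwellians and Gaussian fluxes -/

section Gaussian

theorem maxwellian_pos {θ : ℝ} (hθ : 0 < θ) (v : Space d) : 0 < maxwellian θ v := by
  unfold maxwellian
  positivity

theorem hasFDerivAt_maxwellian (θ : ℝ) (v : Space d) :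
    HasFDerivAt (maxwellian θ) ((-maxwellian θ v / θ) • innerSL ℝ v) v := by
  have h1 : HasFDerivAt (fun v : Space d => ‖v‖ ^ 2) (2 • innerSL ℝ v) v :=
    (hasStrictFDerivAt_norm_sq v).hasFDerivAt
  have h2 := (((h1.neg.mul_const ((2 * θ)⁻¹)).exp).const_mul ((2 * Real.pi * θ) ^ (-(d : ℝ) / 2)))
  refine (h2.congr_fderiv ?_).congr_of_eventuallyEq (Eventually.of_forall fun u => ?_)
  · ext w
    simp [maxwellian]
    ring_nf
  · simp [maxwellian, div_eq_mul_inv]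

theorem norm_fderiv_maxwellian {θ : ℝ} (hθ : 0 < θ) (v : Space d) :
    ‖fderiv ℝ (maxwellian θ) v‖ = maxwellian θ v * (‖v‖ / θ) := by
  rw [(hasFDerivAt_maxwellian θ v).fderiv, norm_smul, innerSL_apply_norm, neg_div, norm_neg,
    Real.norm_of_nonneg (div_nonneg (maxwellian_pos hθ v).le hθ.le)]
  ring

theorem maxwellian_le {θ₀ θ₁ θ : ℝ} (h₀ : 0 < θ₀) (h : θ₀ ≤ θ) (h₁ : θ ≤ θ₁) (v : Space d) :
    maxwellian θ v ≤ (2 * Real.pi * θ₀) ^ (-(d : ℝ) / 2) * Real.exp (-(2 * θ₁)⁻¹ * ‖v‖ ^ 2) := by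
  have hθ : 0 < θ := h₀.trans_le h
  unfold maxwellian
  gcongr ?_ * Real.exp ?_
  · refine Real.rpow_le_rpow_of_nonpos (by positivity) (by gcongr) ?_
    have : (0 : ℝ) ≤ d := Nat.cast_nonneg d
    linarith
  · rw [neg_div, neg_mul, neg_le_neg_iff, div_eq_inv_mul]
    gcongr

theorem le_maxwellian {θ₀ θ₁ θ : ℝ} (h₀ : 0 < θ₀) (h : θ₀ ≤ θ) (h₁ : θ ≤ θ₁) (v : Space d) :
    (2 * Real.pi * θ₁) ^ (-(d : ℝ) / 2) * Real.exp (-(2 * θ₀)⁻¹ * ‖v‖ ^ 2) ≤ maxwellian θ v := by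
  have hθ : 0 < θ := h₀.trans_le h
  unfold maxwellian
  gcongr ?_ * Real.exp ?_
  · refine Real.rpow_le_rpow_of_nonpos (by positivity) (by gcongr) ?_
    have : (0 : ℝ) ≤ d := Nat.cast_nonneg d
    linarith
  · rw [neg_div, neg_mul, neg_le_neg_iff, div_eq_inv_mul]
    gcongr

theorem integrable_exp_mul_halfFlux {b : ℝ} (hb : 0 < b) (n : Space d) :
    Integrable fun u : Space d => Real.exp (-b * ‖u‖ ^ 2) * max (-inner ℝ u n) 0 := by
  have h1 : Integrable fun u : Space d => Real.exp (-(b / 2) * ‖u‖ ^ 2) := by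
    have := (GaussianFourier.integrable_cexp_neg_mul_sq_norm_add (b := ((b / 2 : ℝ) : ℂ))
      (by simpa using hb) 0 (0 : Space d)).norm
    refine this.congr (Eventually.of_forall fun u => ?_)
    simp only
    rw [Complex.norm_exp]
    congr 1
    simp [← Complex.ofReal_pow, -Complex.ofReal_div]
  -- Half of the Gaussian absorbs the linear growth, through `‖u‖ ≤ (1 + 2/b) exp(b‖u‖²/2)`; the
  -- other half remains as integrable majorant.
  refine (h1.const_mul ((1 + (b / 2)⁻¹) * ‖n‖)).mono' (by fun_prop)
    (Eventually.of_forall fun u => ?_)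
  have e1 : |inner ℝ u n| ≤ ‖u‖ * ‖n‖ := abs_real_inner_le_norm u n
  have e2 : max (-inner ℝ u n) 0 ≤ ‖u‖ * ‖n‖ :=
    max_le ((neg_le_abs _).trans e1) (by positivity)
  have e3 : ‖u‖ ≤ (1 + (b / 2)⁻¹) * Real.exp (b / 2 * ‖u‖ ^ 2) := by
    have h3 := Real.add_one_le_exp (b / 2 * ‖u‖ ^ 2)
    have h4 : (1 + (b / 2)⁻¹) * (b / 2 * ‖u‖ ^ 2 + 1) =
        b / 2 * ‖u‖ ^ 2 + 1 + ‖u‖ ^ 2 + (b / 2)⁻¹ := by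
      field_simp
      ring
    have h5 : (1 + (b / 2)⁻¹) * (b / 2 * ‖u‖ ^ 2 + 1) ≤
        (1 + (b / 2)⁻¹) * Real.exp (b / 2 * ‖u‖ ^ 2) := by gcongr
    have h6 : 0 ≤ b / 2 * ‖u‖ ^ 2 := by positivity
    have h7 : 0 < (b / 2)⁻¹ := by positivity
    nlinarith [sq_nonneg (‖u‖ - 1), norm_nonneg u]
  rw [Real.norm_of_nonneg (by positivity)]
  have e4 : Real.exp (-b * ‖u‖ ^ 2) * Real.exp (b / 2 * ‖u‖ ^ 2) =
      Real.exp (-(b / 2) * ‖u‖ ^ 2) := by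
    rw [← Real.exp_add]; ring_nf
  calc Real.exp (-b * ‖u‖ ^ 2) * max (-inner ℝ u n) 0
      ≤ Real.exp (-b * ‖u‖ ^ 2) * (((1 + (b / 2)⁻¹) * Real.exp (b / 2 * ‖u‖ ^ 2)) * ‖n‖) := by
        gcongr
        exact e2.trans (by gcongr)
    _ = (1 + (b / 2)⁻¹) * ‖n‖ * (Real.exp (-b * ‖u‖ ^ 2) * Real.exp (b / 2 * ‖u‖ ^ 2)) := by ring
    _ = _ := by rw [e4]

/-- The flux of a Gaussian through a hyperplane is bounded below independently of the
hyperplane. -/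
theorem exists_pos_le_halfFlux (hd : 1 ≤ d) {b : ℝ} (hb : 0 < b) :
    ∃ c : ℝ, 0 < c ∧ ∀ n : Space d, ‖n‖ = 1 →
      ∫ u : Space d, Real.exp (-b * ‖u‖ ^ 2) * max (-inner ℝ u n) 0 = c := by
  set e : Space d := EuclideanSpace.single ⟨0, hd⟩ 1 with he
  have he1 : ‖e‖ = 1 := by simp [he]
  refine ⟨∫ u : Space d, Real.exp (-b * ‖u‖ ^ 2) * max (-inner ℝ u e) 0, ?_, fun n hn => ?_⟩
  · rw [integral_pos_iff_support_of_nonneg (fun u => by positivity)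
      (integrable_exp_mul_halfFlux hb e)]
    refine lt_of_lt_of_le ?_ (measure_mono (show {u : Space d | inner ℝ u e < 0} ⊆ _ from ?_))
    · refine IsOpen.measure_pos _ (isOpen_lt (by fun_prop) continuous_const) ⟨-e, ?_⟩
      simp [he1]
    · intro u hu
      have hu' : inner ℝ u e < 0 := hu
      have : 0 < max (-inner ℝ u e) 0 := lt_max_of_lt_left (neg_pos.2 hu')
      exact (mul_pos (Real.exp_pos _) this).ne'
  · obtain ⟨Q, hQ⟩ := exists_isometry_apply_eq (a := e) (b := n) (by rw [he1, hn])
    rw [← Q.measurePreserving.integral_comp' (f := Q.toMeasurableEquiv)]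
    refine integral_congr_ae (Eventually.of_forall fun u => ?_)
    simp [← hQ]

end Gaussian

/-! ### The Maxwell kernel: normalization and measurability -/

section Maxwell

theorem isVelocityMeasure_volume (hd : 1 ≤ d) : IsVelocityMeasure (volume : Measure (Space d)) where
  invariant Q := Q.measurePreserving.map_eq
  zero_mem := by rw [Measure.support_eq_univ]; trivial
  zero_null := by
    have : NeZero d := ⟨by omega⟩
    exact measure_singleton 0
  ball_pos r hr := by
    rw [Measure.support_eq_univ, univ_inter]
    exact Metric.measure_ball_pos _ _ hr

variable {Ω : Set (Space d)} {α : ℝ}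

theorem mem_incoming_volume {x v : Space d} :
    v ∈ incoming Ω volume x ↔ inner ℝ v (normal Ω x) < 0 := by
  simp [incoming, Measure.support_eq_univ]

/-- The normalizing constant of the Maxwell kernel. -/
def halfFlux (θ : ℝ) (n : Space d) : ℝ := ∫ u : Space d, maxwellian θ u * max (-inner ℝ u n) 0

theorem setIntegral_incoming (θ : ℝ) (x : Space d) :
    ∫ u in incoming Ω volume x, maxwellian θ u * |inner ℝ u (normal Ω x)| =
      halfFlux θ (normal Ω x) := by
  have hin : MeasurableSet (incoming Ω volume x) :=
    Measure.isClosed_support.measurableSet.inter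
      (measurableSet_lt (f := fun v => inner ℝ v (normal Ω x)) (by fun_prop) measurable_const)
  rw [← integral_indicator hin, halfFlux]
  refine integral_congr_ae (Eventually.of_forall fun u => ?_)
  by_cases hu : u ∈ incoming Ω volume x
  · simp only [indicator_of_mem hu]
    rw [mem_incoming_volume] at hu
    rw [abs_of_neg hu, max_eq_left (by linarith)]
  · simp only [indicator_of_notMem hu]
    rw [mem_incoming_volume, not_lt] at hu
    rw [max_eq_right (by linarith), mul_zero]

theorem maxwellKernel_eq (θ : Space d → ℝ) (x v v' : Space d) :
    maxwellKernel Ω θ x v v' = (halfFlux (θ x) (normal Ω x))⁻¹ * maxwellian (θ x) v := by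
  rw [maxwellKernel, setIntegral_incoming]

/-- A Maxwellian with temperature in `[θ₀, θ₁]` dominates the Gaussian with the prefactor of `θ₁`
and the exponent of `θ₀`. The flux of that Gaussian is positive and, by rotation, the same through
every hyperplane. -/
theorem exists_pos_le_halfFlux_maxwellian (hd : 1 ≤ d) {θ₀ θ₁ : ℝ} (h₀ : 0 < θ₀) (h₁ : θ₀ ≤ θ₁) :
    ∃ c : ℝ, 0 < c ∧ ∀ θ : ℝ, θ₀ ≤ θ → θ ≤ θ₁ → ∀ n : Space d, ‖n‖ = 1 → c ≤ halfFlux θ n := by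
  obtain ⟨c, hc, hcn⟩ := exists_pos_le_halfFlux (d := d) hd (b := (2 * θ₀)⁻¹) (by positivity)
  have h1 : 0 < θ₁ := h₀.trans_le h₁
  refine ⟨(2 * Real.pi * θ₁) ^ (-(d : ℝ) / 2) * c, by positivity, fun θ hθ hθ' n hn => ?_⟩
  have hθ0 : 0 < θ := h₀.trans_le hθ
  rw [← hcn n hn, ← integral_const_mul, halfFlux]
  refine integral_mono ((integrable_exp_mul_halfFlux (by positivity) n).const_mul _) ?_ fun u => ?_
  · refine ((integrable_exp_mul_halfFlux (b := (2 * θ)⁻¹) (by positivity) n).const_mul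
      ((2 * Real.pi * θ) ^ (-(d : ℝ) / 2))).congr (Eventually.of_forall fun u => ?_)
    simp only [maxwellian]
    have e : -‖u‖ ^ 2 / (2 * θ) = -(2 * θ)⁻¹ * ‖u‖ ^ 2 := by ring
    rw [e]
    exact (mul_assoc _ _ _).symm
  · simp only
    rw [← mul_assoc]
    exact mul_le_mul_of_nonneg_right (le_maxwellian h₀ hθ hθ' u) (le_max_right _ _)

variable (h : HasHolderBoundary Ω α) (hΩ : IsOpen Ω) (hb : Bornology.IsBounded Ω)
include h hΩ

theorem HasHolderBoundary.measurable_maxwellKernel {θ : Space d → ℝ}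
    (hθ : ContinuousOn θ (frontier Ω)) :
    Measurable fun p : kernelDomain Ω volume => maxwellKernel Ω θ p.1.1 p.1.2.1 p.1.2.2 := by
  have hx : Measurable fun p : kernelDomain Ω (volume : Measure (Space d)) =>
      (⟨p.1.1, p.2.1⟩ : frontier Ω) :=
    (measurable_fst.comp measurable_subtype_coe).subtype_mk
  have hθm : Measurable fun p : kernelDomain Ω (volume : Measure (Space d)) => θ p.1.1 := by
    have := (continuousOn_iff_continuous_domRestrict.1 hθ).measurable.comp hx
    exact this
  have hn : Measurable fun p : kernelDomain Ω (volume : Measure (Space d)) => normal Ω p.1.1 :=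
    by
    have hx' : Measurable fun p : kernelDomain Ω (volume : Measure (Space d)) => p.1.1 := by
      fun_prop
    exact ((h.measurable_normal hΩ).comp hx' :)
  have hM : Measurable fun q : ℝ × Space d => maxwellian q.1 q.2 := by
    unfold maxwellian
    fun_prop
  have hI : Measurable fun q : kernelDomain Ω (volume : Measure (Space d)) × Space d =>
      maxwellian (θ q.1.1.1) q.2 * max (-inner ℝ q.2 (normal Ω q.1.1.1)) 0 := by
    have h1 : Measurable fun q : kernelDomain Ω (volume : Measure (Space d)) × Space d =>
        maxwellian (θ q.1.1.1) q.2 := (hM.comp ((hθm.comp measurable_fst).prodMk measurable_snd) :)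
    have h2 : Measurable fun q : kernelDomain Ω (volume : Measure (Space d)) × Space d =>
        normal Ω q.1.1.1 := (hn.comp measurable_fst :)
    fun_prop
  have hγ : Measurable fun p : kernelDomain Ω (volume : Measure (Space d)) =>
      halfFlux (θ p.1.1) (normal Ω p.1.1) := hI.stronglyMeasurable.integral_prod_right'.measurable
  have hv : Measurable fun p : kernelDomain Ω (volume : Measure (Space d)) =>
      maxwellian (θ p.1.1) p.1.2.1 := by
    have hv' : Measurable fun p : kernelDomain Ω (volume : Measure (Space d)) => p.1.2.1 := by
      fun_prop
    exact (hM.comp (hθm.prodMk hv') :)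
  simp only [maxwellKernel_eq]
  exact hγ.inv.mul hv

end Maxwell

/-! ### The Maxwell kernel satisfies the assumptions -/

section MaxwellRegular

variable {Ω : Set (Space d)} {α : ℝ}

theorem gradient_maxwellKernel_three (θ : Space d → ℝ) (x v z : Space d) :
    gradient (fun u => maxwellKernel Ω θ x v u) z = 0 := by
  rw [← norm_eq_zero, norm_gradient, norm_eq_zero]
  exact fderiv_const_apply _

theorem norm_gradient_maxwellKernel_two {θ : Space d → ℝ} {x : Space d} (hθ : 0 < θ x)
    (hγ : 0 < halfFlux (θ x) (normal Ω x)) (v' z : Space d) :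
    ‖gradient (fun v => maxwellKernel Ω θ x v v') z‖ =
      (halfFlux (θ x) (normal Ω x))⁻¹ * (maxwellian (θ x) z * (‖z‖ / θ x)) := by
  rw [norm_gradient]
  simp only [maxwellKernel_eq]
  rw [fderiv_const_mul (hasFDerivAt_maxwellian (θ x) z).differentiableAt, norm_smul,
    norm_fderiv_maxwellian hθ, Real.norm_of_nonneg (inv_nonneg.2 hγ.le)]

theorem exists_lintegral_gaussian_le (d : ℕ) {b : ℝ} (hb : 0 < b) (A : ℝ) :
    ∃ B : ℝ≥0, ∫⁻ r in Ioi (0 : ℝ), ENNReal.ofReal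
      (A * (r ^ (d + 3) * Real.exp (-b * r ^ 2)) + A * (r ^ (d + 1) * Real.exp (-b * r ^ 2))) ≤ B := by
  have hint : ∀ n : ℕ, IntegrableOn (fun r : ℝ => A * (r ^ n * Real.exp (-b * r ^ 2))) (Ioi 0) :=
    fun n => by
    have h1 := integrableOn_rpow_mul_exp_neg_mul_sq hb (s := n)
      (neg_one_lt_zero.trans_le (Nat.cast_nonneg n))
    simp only [Real.rpow_natCast] at h1
    exact h1.const_mul A
  have h2 := ((hint (d + 3)).add (hint (d + 1))).lintegral_lt_top
  exact ⟨_, (ENNReal.coe_toNNReal h2.ne).ge⟩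

theorem tendsto_pow_mul_exp_neg_mul_sq {b : ℝ} (hb : 0 < b) (n : ℕ) :
    Tendsto (fun r : ℝ => r ^ n * Real.exp (-b * r ^ 2)) atTop (𝓝 0) := by
  have h1 := rpow_mul_exp_neg_mul_sq_isLittleO_exp_neg hb n
  simp only [Real.rpow_natCast] at h1
  refine h1.trans_tendsto ?_
  refine Real.tendsto_exp_atBot.comp ?_
  exact tendsto_id.const_mul_atTop_of_neg (by norm_num)

/-- The kernel does not depend on the incident velocity `v'`, so its third gradient vanishes and the
last bound holds with constant `0`. The remaining bound is a Gaussian moment, uniform since `θ`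
ranges in a compact subset of `(0, ∞)` over the boundary. -/
theorem HasHolderBoundary.regularKernel_maxwell (h : HasHolderBoundary Ω α) (hΩ : IsOpen Ω)
    (hb : Bornology.IsBounded Ω) (hd : 1 ≤ d) {θ : Space d → ℝ} (hθ : ContinuousOn θ (frontier Ω))
    {θ₀ : ℝ} (hθ₀ : 0 < θ₀) (hle : ∀ x ∈ frontier Ω, θ₀ ≤ θ x) :
    RegularKernel Ω volume (fun _ => 1) (maxwellKernel Ω θ) := by
  obtain ⟨T, hT⟩ := (isCompact_frontier hb).exists_bound_of_continuousOn hθ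
  have hθ₁ : ∀ x ∈ frontier Ω, θ x ≤ max θ₀ T := fun x hx =>
    ((le_abs_self _).trans (hT x hx)).trans (le_max_right _ _)
  set θ₁ := max θ₀ T
  have h01 : θ₀ ≤ θ₁ := le_max_left _ _
  have hθ₁0 : 0 < θ₁ := hθ₀.trans_le h01
  have hpos : ∀ x ∈ frontier Ω, 0 < θ x := fun x hx => hθ₀.trans_le (hle x hx)
  obtain ⟨c, hc, hγc⟩ := exists_pos_le_halfFlux_maxwellian hd hθ₀ h01
  have hγ : ∀ x ∈ frontier Ω, c ≤ halfFlux (θ x) (normal Ω x) := fun x hx =>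
    hγc _ (hle x hx) (hθ₁ x hx) _ (h.norm_normal hΩ hx)
  have hγ0 : ∀ x ∈ frontier Ω, 0 < halfFlux (θ x) (normal Ω x) := fun x hx => hc.trans_le (hγ x hx)
  have hknn : ∀ x ∈ frontier Ω, ∀ v v', 0 ≤ maxwellKernel Ω θ x v v' := fun x hx v v' => by
    rw [maxwellKernel_eq]
    exact mul_nonneg (inv_nonneg.2 (hγ0 x hx).le) (maxwellian_pos (hpos x hx) v).le
  refine ⟨fun p hp => hknn _ hp.1 _ _, h.measurable_maxwellKernel hΩ hθ, fun x hx v' _ => ?_,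
    fun _ _ => one_pos, ?_, fun _ _ => differentiableAt_const _, fun p _ => ?_, fun p _ => ?_, ?_,
    ?_, ⟨0, ?_⟩⟩
  · simp only [maxwellKernel_eq, mul_assoc]
    rw [integral_const_mul, setIntegral_incoming, inv_mul_cancel₀ (hγ0 x hx).ne']
  · have := map_norm_withDensity hd (f := fun _ => (1 : ℝ≥0∞)) measurable_const
    simpa [withDensity_one] using this
  · simp only [maxwellKernel_eq]
    exact (hasFDerivAt_maxwellian _ _).differentiableAt.const_mul _
  · simp only [maxwellKernel_eq]
    exact differentiableAt_const _
  · intro x hx v hv y hy v' hv' σ hσ hσx hσy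
    -- Positivity of `σ·n(x)` excludes `σ = 0`, the case `x = y`, so the Maxwellian at `y` decays
    -- along the ray while the kernel at `x` is constant in its last argument.
    have hσ0 : 0 < ‖σ‖ := norm_pos_iff.2 fun h0 => by simp [h0] at hσx
    have hθy := hpos y hy
    have h1 := (tendsto_pow_mul_exp_neg_mul_sq (b := ‖σ‖ ^ 2 / (2 * θ y)) (by positivity)
      (d + 2)).const_mul (maxwellKernel Ω θ x v 0 * (halfFlux (θ y) (normal Ω y))⁻¹ *
        (2 * Real.pi * θ y) ^ (-(d : ℝ) / 2))
    rw [mul_zero] at h1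
    refine h1.congr fun r => ?_
    have e : -‖r • σ‖ ^ 2 / (2 * θ y) = -(‖σ‖ ^ 2 / (2 * θ y)) * r ^ 2 := by
      rw [norm_smul, mul_pow, Real.norm_eq_abs, sq_abs]
      ring
    rw [maxwellKernel_eq θ x, maxwellKernel_eq θ x, maxwellKernel_eq θ y, maxwellian.eq_1 (θ y), e]
    ring
  · set D := (2 * Real.pi * θ₀) ^ (-(d : ℝ) / 2) with hD
    have hD0 : 0 < D := by positivity
    -- Here `c⁻¹` bounds the inverse fluxes, `D` is the largest Maxwellian prefactor, and `(2 *
    -- θ₁)⁻¹` gives the slowest decay. The gradient brings a factor `‖z‖/θ`, hence `θ₀⁻¹`; the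
    -- summand `1` covers the undifferentiated kernel.
    obtain ⟨B, hB⟩ := exists_lintegral_gaussian_le d (b := (2 * θ₁)⁻¹) (by positivity)
      (c⁻¹ * D * (θ₀⁻¹ + 1))
    refine ⟨B, fun y hy v' hv' σ hσ hσy => le_trans ?_ hB⟩
    refine setLIntegral_mono' measurableSet_Ioi fun r hr => ENNReal.ofReal_le_ofReal ?_
    have hr' : 0 < r := hr
    have hθy := hpos y hy
    have hnr : ‖r • σ‖ = r := by rw [norm_smul, hσ, mul_one, Real.norm_of_nonneg hr'.le]
    have hM := maxwellian_le hθ₀ (hle y hy) (hθ₁ y hy) (r • σ)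
    rw [hnr] at hM
    set E := Real.exp (-(2 * θ₁)⁻¹ * r ^ 2) with hE
    have hE0 : 0 < E := Real.exp_pos _
    have hM0 := maxwellian_pos hθy (r • σ)
    have hg : (halfFlux (θ y) (normal Ω y))⁻¹ ≤ c⁻¹ := by
      gcongr
      exact hγ y hy
    have hg0 : 0 ≤ (halfFlux (θ y) (normal Ω y))⁻¹ := inv_nonneg.2 (hγ0 y hy).le
    rw [norm_gradient_maxwellKernel_two hθy (hγ0 y hy), maxwellKernel_eq, hnr, deriv_const, abs_zero,
      mul_zero, zero_add, mul_one, mul_one]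
    have hdiv : r / θ y ≤ r * θ₀⁻¹ := by
      rw [div_eq_mul_inv]
      gcongr
      exact hle y hy
    calc r ^ (d + 1) * (r * ((halfFlux (θ y) (normal Ω y))⁻¹ *
          (maxwellian (θ y) (r • σ) * (r / θ y))) +
          (halfFlux (θ y) (normal Ω y))⁻¹ * maxwellian (θ y) (r • σ))
        ≤ r ^ (d + 1) * (r * (c⁻¹ * (D * E * (r * θ₀⁻¹))) + c⁻¹ * (D * E)) := by gcongr
      _ = c⁻¹ * D * θ₀⁻¹ * (r ^ (d + 3) * E) + c⁻¹ * D * (r ^ (d + 1) * E) := by ring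
      _ ≤ c⁻¹ * D * (θ₀⁻¹ + 1) * (r ^ (d + 3) * E) + c⁻¹ * D * (θ₀⁻¹ + 1) * (r ^ (d + 1) * E) := by
        have h3 : 0 ≤ c⁻¹ * D * (r ^ (d + 3) * E) := by positivity
        have h4 : 0 ≤ c⁻¹ * D * θ₀⁻¹ * (r ^ (d + 1) * E) := by positivity
        nlinarith
  · intro x hx y hy v' hv' σ hσ hσx hσy
    simp only [gradient_maxwellKernel_three, norm_zero, zero_mul, ENNReal.ofReal_zero,
      lintegral_zero, mul_zero, ENNReal.coe_zero, le_refl]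

end MaxwellRegular

end Kinetic

end

/-! ### The proposition -/

theorem proposition6p8 {d : ℕ} (hd : 2 ≤ d) (Ω : Set (Space d)) (hΩ : IsOpen Ω)
    (hΩb : Bornology.IsBounded Ω) (α : ℝ) (hα : 1 / 2 < α) (hα1 : α ≤ 1)
    (hreg : HasHolderBoundary Ω α) :
    (∀ (m : Measure (Space d)) (w : ℝ → ℝ) (k : Space d → Space d → Space d → ℝ),
      IsVelocityMeasure m → RegularKernel Ω m w k →
        (∃! H : LOnePlus Ω m →L[ℂ] LOneMinus Ω m, IsDiffuseOperator Ω m k H) ∧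
        (∀ lam : ℂ, 0 ≤ lam.re →
          ∃! M : LOneMinus Ω m →L[ℂ] LOnePlus Ω m, IsTransferOperator Ω m lam M) ∧
        ∀ (H : LOnePlus Ω m →L[ℂ] LOneMinus Ω m)
          (M : ℂ → LOneMinus Ω m →L[ℂ] LOnePlus Ω m),
          IsDiffuseOperator Ω m k H →
          (∀ lam : ℂ, 0 ≤ lam.re → IsTransferOperator Ω m lam (M lam)) →
            (∃ C : ℝ, 0 < C ∧ ∀ lam : ℂ, 0 ≤ lam.re → lam ≠ 0 →
              ‖((M lam).comp H) ^ 2‖ ≤ C / ‖lam‖) ∧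
            HasIntegrablePower (fun lam => (M lam).comp H) 4) ∧
    (∀ θ : Space d → ℝ, ContinuousOn θ (frontier Ω) →
      (∃ θ₀ : ℝ, 0 < θ₀ ∧ ∀ x ∈ frontier Ω, θ₀ ≤ θ x) →
        IsVelocityMeasure (volume : Measure (Space d)) ∧
        RegularKernel Ω volume (fun _ => 1) (maxwellKernel Ω θ)) := by
  have hd1 : 1 ≤ d := by omega
  refine ⟨fun m w k hm hk => ?_, fun θ hθ ⟨θ₀, hθ₀, hle⟩ =>
    ⟨isVelocityMeasure_volume hd1, hreg.regularKernel_maxwell hΩ hΩb hd1 hθ hθ₀ hle⟩⟩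
  -- The density of `m` makes it σ-finite, as every use of Fubini and Tonelli for `m` requires.
  have := hk.sigmaFinite hm hd1
  refine ⟨hk.existsUnique_diffuse hreg hΩ,
    fun lam hlam => hreg.existsUnique_transfer hΩ hΩb hlam, fun H M hH hM => ?_⟩
  have hC := hk.exists_norm_sq_le hreg hΩ hΩb hm hd1 hα hH hM
  exact ⟨hC, hreg.hasIntegrablePower hΩ hΩb (hk.norm_diffuse_le hreg hΩ hH) hM hC⟩
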